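/- Let $n\ge 1$, $d\ge 1$ be integers, $\alpha>-1$, $1<p<\infty$ and $\frac1p+\frac1q=1$. Let $\mathbb B^n$ be the open unit ball of $\mathbb C^n$, write $\bar z w=\sum_i \bar z_i w_i$, and let $dv_\alpha(z)=c_\alpha(1-|z|^2)^\alpha\,dV(z)$ with $c_\alpha$ such that $v_\alpha(\mathbb B^n)=1$. For $r\in\{p,q\}$ let $A^r_\alpha$ be the Banach space of holomorphic $f:\mathbb B^n\to\mathbb C^d$ with $\|f\|^r=\int_{\mathbb B^n}\|f(z)\|_{r}^r\,dv_\alpha(z)<\infty$, where $\|v\|_r=(\sum_i|v_i|^r)^{1/r}$, and for $f\in A^p_\alpha$, $g\in A^q_\alpha$ put $\langle f,g\rangle_{A^2_\alpha}=\int_{\mathbb B^n}\langle f(w),g(w)\rangle_{\mathbb C^d}\,dv_\alpha(w)$. Let $k_z^{(p,\alpha)}(w)=\dfrac{(1-|z|^2)^{(n+1+\alpha)/q}}{(1-\bar z w)^{n+1+\alpha}}$, and $k_z^{(q,\alpha)}$ likewise with $p$ and $q$ exchanged. For a bounded operator $S$ on $A^p_\alpha$ its Berezin transform is the $d\times d$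 matrix-valued function $B(S)$ on $\mathbb B^n$ given by $\langle B(S)(z)e,h\rangle_{\mathbb C^d}=\langle S(k_z^{(p,\alpha)}e),k_z^{(q,\alpha)}h\rangle_{A^2_\alpha}$ for $e,h\in\mathbb C^d$. Let $\varphi_z(w)=\dfrac{z-P_zw-(1-|z|^2)^{1/2}(w-P_zw)}{1-\bar z w}$, with $P_z$ the orthogonal projection of $\mathbb C^n$ onto $\mathbb C z$, be the involutive automorphism of $\mathbb B^n$ interchanging $z$ and $0$, and let $\rho(z,w)=|\varphi_z(w)|$. Let $\mathcal A$ be the algebra, with the supremum norm, of bounded functions $\mathbb B^n\to\mathbb C$ that are uniformly continuous with respect to $\rho$. Let $M_{\mathcal A}$ be its maximal ideal space (the nonzero multiplicative linear functionals, with the weak-* topology), into which $\mathbb B^n$ is embedded by point evaluations. For $r\in\{p,q\}$ and $z\in\mathbb B^n$ let $U_z^{(r,\alpha)}$ be the bounded operator on $A^r_\alpha$ given by $$(U_z^{(r,\alpha)}f)(w)=f(\varphi_z(w))\,\frac{(1-|z|^2)^{(n+1+\alpha)/r}}{(1-\bar z w)^{2(n+1+\alpha)/r}}$$ (principal branch),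 let $(U_z^{(q,\alpha)})^*$ be the bounded operator on $A^p_\alpha$ which is adjoint to $U_z^{(q,\alpha)}$ for the pairing $\langle\cdot,\cdot\rangle_{A^2_\alpha}$, and put $S_z=U_z^{(p,\alpha)}S(U_z^{(q,\alpha)})^*$. For $x\in M_{\mathcal A}$ let $S_x$ be the limit of $S_z$ in the weak operator topology (WOT) as $z\in\mathbb B^n$ tends to $x$ in $M_{\mathcal A}$. **Proposition.** Let $S$ be a bounded linear operator on $A^p_\alpha$. The objects above are well defined: the bounded operators $U_z^{(p,\alpha)}$, $U_z^{(q,\alpha)}$ and $(U_z^{(q,\alpha)})^*$ exist for every $z\in\mathbb B^n$, and $x\mapsto S_x$ is a WOT-continuous map on $M_{\mathcal A}$ that extends $z\mapsto S_z$. Moreover, $$B(S)(z)\to 0\ \text{ as }\ |z|\to1\qquad\Longleftrightarrow\qquad S_x=0\ \text{ for every } x\in M_{\mathcal A}\setminus\mathbb B^n .$$ -/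

import Mathlib

open MeasureTheory Filter Topology
open scoped ENNReal BoundedContinuousFunction

namespace VectorBergman

noncomputable section

/-! ### The ball, the weighted measures and the Bergman spaces -/

/-- Complex Euclidean space `ℂⁿ`. In Mathlib, `inner ℂ z w = ∑ i, conj (z i) * w i`, which is the
quantity usually written `z̄ w`. -/
abbrev Cn (n : ℕ) : Type := EuclideanSpace ℂ (Fin n)

/-- The open unit ball of `ℂⁿ`, as a set. -/
abbrev ball (n : ℕ) : Set (Cn n) := Metric.ball 0 1

/-- The open unit ball of `ℂⁿ`, as a type. -/
abbrev Bn (n : ℕ) : Type := ball n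

/-- The space `ℂᵈ` with the `ℓᵖ` norm. -/
abbrev Cd (d : ℕ) (p : ℝ≥0∞) : Type := PiLp p (fun _ : Fin d => ℂ)

/-- The measure `(1 - |z|²)^α dV(z)` on the ball. -/
def weightMeasure (n : ℕ) (α : ℝ) : Measure (Cn n) :=
  (volume.restrict (ball n)).withDensity (fun z => ENNReal.ofReal ((1 - ‖z‖ ^ 2) ^ α))

/-- The normalised measure `dv_α = c_α (1 - |z|²)^α dV`, where `c_α` makes the total mass `1`. -/
def va (n : ℕ) (α : ℝ) : Measure (Cn n) :=
  (weightMeasure n α Set.univ)⁻¹ • weightMeasure n α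

instance (n : ℕ) (α : ℝ) : IsFiniteMeasure (va n α) :=
  ⟨lt_of_le_of_lt (by simp [va, ENNReal.inv_mul_le_one]) ENNReal.one_lt_top⟩

/-- The Bergman space `A^p_α(𝔹ⁿ; ℂᵈ)`: the subspace of `L^p_α(𝔹ⁿ; ℂᵈ)` of (classes of) functions
that are holomorphic on the ball, with the norm `(∫ ‖f(z)‖_p^p dv_α(z))^{1/p}`. -/
def A (n d : ℕ) (α : ℝ) (p : ℝ≥0∞) [Fact (1 ≤ p)] : Submodule ℂ (Lp (Cd d p) p (va n α)) where
  carrier := {f | ∃ F : Cn n → Cd d p, DifferentiableOn ℂ F (ball n) ∧ f =ᵐ[va n α] F}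
  zero_mem' := ⟨0, differentiableOn_const 0, Lp.coeFn_zero _ _ _⟩
  add_mem' := by
    rintro f g ⟨F, hF, hfF⟩ ⟨G, hG, hgG⟩
    exact ⟨F + G, hF.add hG, (Lp.coeFn_add f g).trans (hfF.add hgG)⟩
  smul_mem' := by
    rintro c f ⟨F, hF, hfF⟩
    exact ⟨c • F, hF.const_smul c, (Lp.coeFn_smul c f).trans (hfF.const_smul c)⟩

/-- Bounded operators on `A^p_α`. -/
abbrev Op (n d : ℕ) (α : ℝ) (p : ℝ≥0∞) [Fact (1 ≤ p)] : Type :=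
  A n d α p →L[ℂ] A n d α p

variable {n d : ℕ} {α : ℝ} {p : ℝ≥0∞} [Fact (1 ≤ p)] {q : ℝ≥0∞} [Fact (1 ≤ q)]

/-- The function underlying an element of `A^p_α`: its holomorphic representative, whose values
on the ball are uniquely determined. -/
def rep (f : A n d α p) : Cn n → Cd d p := Classical.choose f.2

/-- The pairing `⟨f, g⟩_{A²} = ∫ ⟨f(w), g(w)⟩_{ℂᵈ} dv_α(w)` of `f ∈ A^p_α` and `g ∈ A^q_α`,
linear in `f` and conjugate linear in `g`. -/
def pairing (f : A n d α p) (g : A n d α q) : ℂ :=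
  ∫ w, ∑ i, rep f w i * (starRingEnd ℂ) (rep g w i) ∂(va n α)

/-! ### Normalised reproducing kernels and the Berezin transform -/

/-- The function `w ↦ (1 - |z|²)^{(n+1+α)/q} (1 - z̄ w)^{-(n+1+α)} v`, with `v ∈ ℂᵈ`. -/
def kernelFun (α : ℝ) (p q : ℝ≥0∞) (z : Bn n) (v : Fin d → ℂ) (w : Cn n) : Cd d p :=
  ((((1 - ‖(z : Cn n)‖ ^ 2) ^ ((n + 1 + α) / q.toReal) : ℝ) : ℂ) /
    (1 - inner ℂ (z : Cn n) w) ^ ((n + 1 + α : ℝ) : ℂ)) • WithLp.toLp p v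

theorem re_pos_of_mem (z : Bn n) {w : Cn n} (hw : w ∈ Metric.closedBall (0 : Cn n) 1) :
    0 < (1 - inner ℂ (z : Cn n) w).re := by
  have hz : ‖(z : Cn n)‖ < 1 := mem_ball_zero_iff.mp z.2
  have hw' : ‖w‖ ≤ 1 := by simpa using hw
  have h1 : (inner ℂ (z : Cn n) w).re ≤ ‖(z : Cn n)‖ * ‖w‖ :=
    (Complex.re_le_norm _).trans (norm_inner_le_norm _ _)
  have h2 : ‖(z : Cn n)‖ * ‖w‖ ≤ ‖(z : Cn n)‖ := by
    nlinarith [norm_nonneg (z : Cn n), norm_nonneg w]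
  simp only [Complex.sub_re, Complex.one_re]
  linarith

theorem kernelFun_differentiableAt (α : ℝ) (p q : ℝ≥0∞) [Fact (1 ≤ p)] (z : Bn n)
    (v : Fin d → ℂ) {w : Cn n} (hw : w ∈ Metric.closedBall (0 : Cn n) 1) :
    DifferentiableAt ℂ (kernelFun α p q z v) w := by
  have hs : (1 - inner ℂ (z : Cn n) w) ∈ Complex.slitPlane := Or.inl (re_pos_of_mem z hw)
  have hd : DifferentiableAt ℂ (fun w : Cn n => 1 - inner ℂ (z : Cn n) w) w :=
    (differentiableAt_const _).sub (innerSL ℂ (z : Cn n)).differentiableAt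
  have hc : DifferentiableAt ℂ
      (fun w : Cn n => (1 - inner ℂ (z : Cn n) w) ^ ((n + 1 + α : ℝ) : ℂ)) w :=
    hd.cpow (differentiableAt_const _) hs
  have hne : (1 - inner ℂ (z : Cn n) w) ^ ((n + 1 + α : ℝ) : ℂ) ≠ 0 := by
    rw [Complex.cpow_def_of_ne_zero (Complex.slitPlane_ne_zero hs)]
    exact Complex.exp_ne_zero _
  unfold kernelFun
  simp only [div_eq_mul_inv]
  exact DifferentiableAt.smul_const (DifferentiableAt.const_mul (hc.fun_inv hne) _) _

theorem kernelFun_differentiableOn (α : ℝ) (p q : ℝ≥0∞) [Fact (1 ≤ p)] (z : Bn n)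
    (v : Fin d → ℂ) : DifferentiableOn ℂ (kernelFun α p q z v) (ball n) := fun _ hw =>
  (kernelFun_differentiableAt α p q z v (Metric.ball_subset_closedBall hw)).differentiableWithinAt

theorem va_absolutelyContinuous (n : ℕ) (α : ℝ) : va n α ≪ volume.restrict (ball n) :=
  (Measure.smul_absolutelyContinuous).trans (withDensity_absolutelyContinuous _ _)

theorem kernelFun_memLp (α : ℝ) (p q : ℝ≥0∞) [Fact (1 ≤ p)] (z : Bn n) (v : Fin d → ℂ) :
    MemLp (kernelFun α p q z v) p (va n α) := by
  obtain ⟨C, hC⟩ := (isCompact_closedBall (0 : Cn n) 1).exists_bound_of_continuousOn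
    (f := kernelFun α p q z v)
    (fun w hw => (kernelFun_differentiableAt α p q z v hw).continuousAt.continuousWithinAt)
  refine MemLp.of_bound ?_ C ?_
  · exact (((kernelFun_differentiableOn α p q z v).continuousOn).aestronglyMeasurable
      Metric.isOpen_ball.measurableSet).mono_ac (va_absolutelyContinuous n α)
  · refine (va_absolutelyContinuous n α).ae_le ?_
    filter_upwards [ae_restrict_mem Metric.isOpen_ball.measurableSet] with w hw
    exact hC w (Metric.ball_subset_closedBall hw)

/-- The normalised reproducing kernel `k_z^{(p,α)} v` as an element of `A^p_α`; here `q` is the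
conjugate exponent of `p`. -/
def kernel (α : ℝ) (p q : ℝ≥0∞) [Fact (1 ≤ p)] (z : Bn n) (v : Fin d → ℂ) : A n d α p :=
  ⟨(kernelFun_memLp α p q z v).toLp _,
    kernelFun α p q z v, kernelFun_differentiableOn α p q z v, MemLp.coeFn_toLp _⟩

/-- The matrix-valued Berezin transform of `T`, determined by
`⟨T̃(z) e, h⟩_{ℂᵈ} = ⟨T (k_z^{(p,α)} e), k_z^{(q,α)} h⟩_{A²}`: its `(i, j)` entry is the case
`e = e_j`, `h = e_i`, and the general case follows by sesquilinearity. -/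
def berezin (q : ℝ≥0∞) [Fact (1 ≤ q)] (T : Op n d α p) (z : Bn n) : Matrix (Fin d) (Fin d) ℂ :=
  Matrix.of fun i j =>
    pairing (T (kernel α p q z (Pi.single j 1))) (kernel α q p z (Pi.single i 1))

/-! ### Automorphisms of the ball, the algebra `𝒜` and its maximal ideal space -/

/-- The involutive automorphism of the ball interchanging `z` and `0`:
`φ_z(w) = (z - P_z w - (1 - |z|²)^{1/2} (w - P_z w)) / (1 - z̄ w)`, where
`P_z w = (z̄ w / |z|²) z` is the orthogonal projection onto `ℂ z` (and `P_0 = 0`). -/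
def phi (z w : Cn n) : Cn n :=
  let P : Cn n := (inner ℂ z w / ((‖z‖ ^ 2 : ℝ) : ℂ)) • z
  (1 - inner ℂ z w)⁻¹ • (z - P - ((√(1 - ‖z‖ ^ 2) : ℝ) : ℂ) • (w - P))

/-- The pseudo-hyperbolic metric `ρ(z, w) = |φ_z(w)|` on the ball. -/
def rho (z w : Bn n) : ℝ := ‖phi (z : Cn n) (w : Cn n)‖

/-- Uniform continuity of a function from `(𝔹ⁿ, ρ)` to `ℂ`. -/
def RhoUniformContinuous (f : Bn n → ℂ) : Prop :=
  ∀ ε > 0, ∃ δ > 0, ∀ z w : Bn n, rho z w < δ → ‖f z - f w‖ < ε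

/-- The algebra `𝒜` of bounded functions on the ball that are uniformly continuous from `(𝔹ⁿ, ρ)`
to `ℂ`, with the supremum norm. (The metric `ρ` induces the Euclidean topology of the ball, so
these functions are continuous.) -/
def uniformAlgebra (n : ℕ) : StarSubalgebra ℂ (Bn n →ᵇ ℂ) where
  carrier := {f | RhoUniformContinuous f}
  algebraMap_mem' := by
    intro c ε hε
    exact ⟨1, one_pos, fun z w _ => by simpa using hε⟩
  add_mem' := by
    intro f g hf hg ε hε
    obtain ⟨δ₁, h₁, H₁⟩ := hf (ε / 2) (by positivity)
    obtain ⟨δ₂, h₂, H₂⟩ := hg (ε / 2) (by positivity)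
    refine ⟨min δ₁ δ₂, lt_min h₁ h₂, fun z w h => ?_⟩
    have a := H₁ z w (h.trans_le (min_le_left _ _))
    have b := H₂ z w (h.trans_le (min_le_right _ _))
    have : (f + g) z - (f + g) w = (f z - f w) + (g z - g w) := by
      simp only [BoundedContinuousFunction.coe_add, Pi.add_apply]; ring
    rw [this]
    exact (norm_add_le _ _).trans_lt (by linarith)
  mul_mem' := by
    intro f g hf hg ε hε
    obtain ⟨δ₁, h₁, H₁⟩ := hf (ε / (2 * (‖g‖ + 1))) (by positivity)
    obtain ⟨δ₂, h₂, H₂⟩ := hg (ε / (2 * (‖f‖ + 1))) (by positivity)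
    refine ⟨min δ₁ δ₂, lt_min h₁ h₂, fun z w h => ?_⟩
    have a := H₁ z w (h.trans_le (min_le_left _ _))
    have b := H₂ z w (h.trans_le (min_le_right _ _))
    have hg' := g.norm_coe_le_norm z
    have hf' := f.norm_coe_le_norm w
    have e : (f * g) z - (f * g) w = (f z - f w) * g z + f w * (g z - g w) := by
      simp only [BoundedContinuousFunction.coe_mul, Pi.mul_apply]; ring
    have a' : ‖(f z - f w) * g z‖ < ε / 2 := by
      rw [norm_mul]
      rw [lt_div_iff₀ (by positivity)] at a
      nlinarith [norm_nonneg (f z - f w), norm_nonneg (g z)]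
    have b' : ‖f w * (g z - g w)‖ < ε / 2 := by
      rw [norm_mul]
      rw [lt_div_iff₀ (by positivity)] at b
      nlinarith [norm_nonneg (g z - g w), norm_nonneg (f w)]
    rw [e]
    exact (norm_add_le _ _).trans_lt (by linarith)
  star_mem' := by
    intro f hf ε hε
    obtain ⟨δ, h, H⟩ := hf ε hε
    refine ⟨δ, h, fun z w hzw => ?_⟩
    have : (star f) z - (star f) w = star (f z - f w) := by simp
    rw [this, norm_star]
    exact H z w hzw

/-- The maximal ideal space `M_𝒜`: the nonzero multiplicative linear functionals on `𝒜`, with the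
weak-* topology. -/
abbrev MA (n : ℕ) : Type := WeakDual.characterSpace ℂ (uniformAlgebra n)

/-- The embedding of the ball into `M_𝒜` through point evaluations. -/
def evalChar (z : Bn n) : MA n :=
  ⟨StrongDual.toWeakDual ((BoundedContinuousFunction.evalCLM ℂ z).comp
      (uniformAlgebra n).toSubalgebra.toSubmodule.subtypeL), by
    constructor
    · intro h
      have := DFunLike.congr_fun h (1 : uniformAlgebra n)
      exact one_ne_zero this
    · intro x y
      rfl⟩

/-! ### The operators `U_z`, `S_z` and `S_x` -/

/-- `U` is the operator `U_z^{(p,α)}` on `A^p_α`: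
`(U f)(w) = (1 - |z|²)^{(n+1+α)/p} (1 - z̄ w)^{-2(n+1+α)/p} f(φ_z(w))`, with the principal branch
of the power (`1 - z̄ w` has positive real part). -/
def IsU (z : Bn n) (U : Op n d α p) : Prop :=
  ∀ f : A n d α p, ∀ w ∈ ball n,
    rep (U f) w =
      ((((1 - ‖(z : Cn n)‖ ^ 2) ^ ((n + 1 + α) / p.toReal) : ℝ) : ℂ) /
        (1 - inner ℂ (z : Cn n) w) ^ ((2 * (n + 1 + α) / p.toReal : ℝ) : ℂ)) •
      rep f (phi (z : Cn n) w)

/-- `V` on `A^p_α` is the adjoint of `U` on `A^q_α` with respect to the pairing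
`⟨·, ·⟩_{A²}`. -/
def IsAdjoint (U : Op n d α q) (V : Op n d α p) : Prop :=
  ∀ (f : A n d α p) (g : A n d α q), pairing (V f) g = pairing f (U g)

open Classical in
/-- The operator `U_z^{(p,α)}` on `A^p_α`. -/
def opU (d : ℕ) (α : ℝ) (p : ℝ≥0∞) [Fact (1 ≤ p)] (z : Bn n) : Op n d α p :=
  if h : ∃ U : Op n d α p, IsU z U then Classical.choose h else 0

open Classical in
/-- The adjoint `U^*`, a bounded operator on `A^p_α`, of a bounded operator `U` on `A^q_α`. -/
def adj (p : ℝ≥0∞) [Fact (1 ≤ p)] (U : Op n d α q) : Op n d α p :=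
  if h : ∃ V : Op n d α p, IsAdjoint U V then Classical.choose h else 0

/-- `S_z = U_z^{(p,α)} S (U_z^{(q,α)})^*`. -/
def opAt (q : ℝ≥0∞) [Fact (1 ≤ q)] (S : Op n d α p) (z : Bn n) : Op n d α p :=
  (opU d α p z).comp (S.comp (adj p (opU d α q z)))

/-- `S_x` for `x ∈ M_𝒜`: the limit of `S_z`, in the weak operator topology, as `z ∈ 𝔹ⁿ` tends to
`x` in `M_𝒜`. -/
def opLim (q : ℝ≥0∞) [Fact (1 ≤ q)] (S : Op n d α p) (x : MA n) :
    A n d α p →WOT[ℂ] A n d α p :=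
  limUnder (comap evalChar (𝓝 x)) (fun z : Bn n => ContinuousLinearMapWOT.ofCLM (opAt q S z))

end

end VectorBergman

open VectorBergman

/-!
# The Berezin transform and limit operators on vector-valued Bergman spaces

Write `K_w v` for the reproducing kernel `u ↦ (1 - w̄ u)^{-(n+1+α)} v`, so that
`⟨f, K_w v⟩ = ⟨f(w), v⟩`, and put `s = n + 1 + α`.

*Duality.* The maximal Bergman operator, with kernel `|1 - z̄ w|^{-s}`, is bounded on `L^p_α` by
Schur's test and the Forelli–Rudin estimate (`exists_bergman_bound`). Hence `A^p_α` is complemented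
in `L^p_α`, and testing a functional `y` on kernels produces a function in `A^q_α` which represents
it (`exists_pairing_eq`). Consequently bounded sesquilinear forms come from operators
(`exists_operator_of_form`), so that adjoints for the pairing exist, and the kernels span a dense
subspace (`eq_top_of_kern_mem`).

*Uniform continuity.* The operators `U_z` are isometries, and `(U_z)^*` maps `K_w v` to a multiple
of `K_{φ_z(w)} v` (`adj_opU_kern`). For `z' = φ_z(c)` this makes `(U_{z'})^* K_w v` a multiple, with
factor close to one, of `(U_z)^* K_{w'} v` with `w' = φ_z(φ_{z'}(w))`. An explicit formula for `w'`
(`smul_phi_phi`), in which the factor `1 - |z|²` has cancelled, shows `w' → w` as `c → 0`,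
*uniformly in* `z`. Therefore `z ↦ (U_z)^* f` is uniformly continuous for `ρ`, first for kernels and
then, by density and boundedness, for all `f` (`tendsto_adj_opU`), and every coefficient
`z ↦ ⟨S_z f, g⟩ = ⟨S (U_z^{(q)})^* f, (U_z^{(p)})^* g⟩` belongs to the algebra `𝒜`.

*Limit operators.* `𝒜` is a commutative C⋆-algebra, so by Gelfand duality the ball is dense in
`M_𝒜` (`denseRange_evalChar`). The values of a character `x` at the coefficients form a bounded
sesquilinear form, whose operator is the limit `S_x`; since all functionals are pairings, the limit
is one in the weak operator topology and depends continuously on `x`.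

*The equivalence.* The entries of `B(S)(z)` are coefficients of `S_z` at constant vectors
(`berezin_apply`). If all `S_x` off the ball vanish, they tend to zero at the boundary by
compactness of `M_𝒜`. Conversely, the coefficients of `S_z` at `K_w e`, `K_w e'` are multiples of
entries of `B(S)(φ_z(w))` by factors bounded in `z`, so that `⟨S_x K_w e, K_w e'⟩ = 0` for all `w`
if `B(S)` vanishes at the boundary. Now `⟨S_x K_w e, K_{w'} e'⟩` is antiholomorphic in `w` and
holomorphic in `w'`, hence determined by its values on the diagonal, and `S_x = 0`
(`eq_zero_of_diagonal`).
-/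

namespace VectorBergman

noncomputable section

set_option linter.unusedSectionVars false

/-! ### The involutions `phi z` of the ball -/

section Involution

variable {n : ℕ}

/-- The number `(1 - |z|²)^{1/2}`. -/
def defect (z : Cn n) : ℝ := √(1 - ‖z‖ ^ 2)

/-- The linear map `w ↦ P_z w + (1 - |z|²)^{1/2} (w - P_z w)`, in the form
`s w + (1 + s)⁻¹ (z̄ w) z` with `s = (1 - |z|²)^{1/2}`, which involves no division by `|z|²`. -/
def shrink (z w : Cn n) : Cn n :=
  ((defect z : ℝ) : ℂ) • w + (inner ℂ z w / (1 + (defect z : ℝ) : ℂ)) • z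

theorem defect_nonneg (z : Cn n) : 0 ≤ defect z := Real.sqrt_nonneg _

theorem one_add_defect_ne_zero (z : Cn n) : (1 + (defect z : ℝ) : ℂ) ≠ 0 := by
  have : (0 : ℝ) < 1 + defect z := by linarith [defect_nonneg z]
  exact_mod_cast this.ne'

theorem norm_lt_one (z : Bn n) : ‖(z : Cn n)‖ < 1 := mem_ball_zero_iff.mp z.2

theorem norm_lt_one_of_mem {w : Cn n} (hw : w ∈ ball n) : ‖w‖ < 1 := mem_ball_zero_iff.mp hw

theorem one_sub_sq_pos {w : Cn n} (hw : w ∈ ball n) : 0 < 1 - ‖w‖ ^ 2 := by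
  have := norm_lt_one_of_mem hw
  nlinarith [norm_nonneg w]

theorem defect_sq {z : Cn n} (hz : z ∈ ball n) : defect z ^ 2 = 1 - ‖z‖ ^ 2 :=
  Real.sq_sqrt (one_sub_sq_pos hz).le

theorem defect_pos {z : Cn n} (hz : z ∈ ball n) : 0 < defect z :=
  Real.sqrt_pos.mpr (one_sub_sq_pos hz)

theorem inner_self_eq (z : Cn n) : inner ℂ z z = ((‖z‖ ^ 2 : ℝ) : ℂ) := by
  rw [inner_self_eq_norm_sq_to_K]; norm_cast

theorem inner_self_eq_defect {z : Cn n} (hz : z ∈ ball n) :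
    inner ℂ z z = 1 - ((defect z : ℝ) : ℂ) ^ 2 := by
  rw [inner_self_eq]
  have := defect_sq hz
  rw [← Complex.ofReal_pow, this]; push_cast; ring

theorem phi_eq {z : Cn n} (hz : z ∈ ball n) (w : Cn n) :
    phi z w = (1 - inner ℂ z w)⁻¹ • (z - shrink z w) := by
  unfold phi shrink
  simp only
  have h1 := one_add_defect_ne_zero z
  have hs : (√(1 - ‖z‖ ^ 2) : ℝ) = defect z := rfl
  rw [hs]
  by_cases h0 : z = 0
  · subst h0; simp
  · have hn : ((‖z‖ ^ 2 : ℝ) : ℂ) ≠ 0 := by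
      have : ‖z‖ ≠ 0 := norm_ne_zero_iff.mpr h0
      exact_mod_cast pow_ne_zero 2 this
    have h2 := inner_self_eq_defect hz
    rw [inner_self_eq] at h2
    have : inner ℂ z w / (1 + ((defect z : ℝ) : ℂ)) =
        (1 - ((defect z : ℝ) : ℂ)) * (inner ℂ z w / ((‖z‖ ^ 2 : ℝ) : ℂ)) := by
      rw [h2] at hn ⊢
      field_simp
      ring
    rw [this]
    module

theorem norm_inner_lt_one {z w : Cn n} (hz : z ∈ ball n) (hw : ‖w‖ ≤ 1) :
    ‖inner ℂ z w‖ < 1 := by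
  have h1 := norm_lt_one_of_mem hz
  refine (norm_inner_le_norm z w).trans_lt ?_
  nlinarith [norm_nonneg z, norm_nonneg w]

theorem one_sub_inner_re_pos {z w : Cn n} (hz : z ∈ ball n) (hw : w ∈ ball n) :
    0 < (1 - inner ℂ z w).re :=
  re_pos_of_mem ⟨z, hz⟩ (Metric.ball_subset_closedBall hw)

theorem ne_zero_of_re_pos {x : ℂ} (h : 0 < x.re) : x ≠ 0 := by
  rintro rfl; simp at h

theorem one_sub_inner_ne_zero {z w : Cn n} (hz : z ∈ ball n) (hw : w ∈ ball n) :
    1 - inner ℂ z w ≠ 0 :=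
  ne_zero_of_re_pos (one_sub_inner_re_pos hz hw)

theorem inner_shrink_self {z : Cn n} (hz : z ∈ ball n) (w : Cn n) :
    inner ℂ z (shrink z w) = inner ℂ z w := by
  unfold shrink
  rw [inner_add_right, inner_smul_right, inner_smul_right, inner_self_eq_defect hz]
  have := one_add_defect_ne_zero z
  field_simp
  ring

/-- Expansion of the inner product of the numerators of `phi z x` and `phi z' y`. -/
theorem inner_sub_shrink (z z' x y : Cn n) :
    inner ℂ (z - shrink z x) (z' - shrink z' y) =
      inner ℂ z z' - ((defect z' : ℂ) * inner ℂ z y +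
        inner ℂ z z' * inner ℂ z' y / (1 + (defect z' : ℂ)))
      - ((defect z : ℂ) * inner ℂ x z' + inner ℂ x z * inner ℂ z z' / (1 + (defect z : ℂ)))
      + ((defect z : ℂ) * (defect z' : ℂ) * inner ℂ x y
        + (defect z : ℂ) * inner ℂ z' y * inner ℂ x z' / (1 + (defect z' : ℂ))
        + (defect z' : ℂ) * inner ℂ x z * inner ℂ z y / (1 + (defect z : ℂ))
        + inner ℂ x z * inner ℂ z' y * inner ℂ z z' /
          ((1 + (defect z : ℂ)) * (1 + (defect z' : ℂ)))) := by
  unfold shrink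
  simp only [inner_add_right, inner_add_left, inner_smul_right, inner_smul_left, inner_sub_left,
    inner_sub_right, map_div₀, inner_conj_symm, map_add, map_one, Complex.conj_ofReal]
  have h1 := one_add_defect_ne_zero z
  have h2 := one_add_defect_ne_zero z'
  field_simp
  ring

theorem one_sub_inner_phi_aux {z : Cn n} (hz : z ∈ ball n) (x y : Cn n) :
    (1 - inner ℂ x z) * (1 - inner ℂ z y) - inner ℂ (z - shrink z x) (z - shrink z y) =
      ((1 - ‖z‖ ^ 2 : ℝ) : ℂ) * (1 - inner ℂ x y) := by
  rw [inner_sub_shrink, inner_self_eq_defect hz, ← defect_sq hz]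
  have h1 := one_add_defect_ne_zero z
  field_simp
  push_cast
  ring

/-- The fundamental identity for the involution `phi z`. -/
theorem one_sub_inner_phi {z x y : Cn n} (hz : z ∈ ball n) (hx : x ∈ ball n) (hy : y ∈ ball n) :
    1 - inner ℂ (phi z x) (phi z y) =
      ((1 - ‖z‖ ^ 2 : ℝ) : ℂ) * (1 - inner ℂ x y) /
        ((1 - inner ℂ x z) * (1 - inner ℂ z y)) := by
  have h1 := one_sub_inner_ne_zero hx hz
  have h2 := one_sub_inner_ne_zero hz hy
  rw [← one_sub_inner_phi_aux hz, phi_eq hz, phi_eq hz, inner_smul_left, inner_smul_right]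
  simp only [map_inv₀, map_sub, map_one, inner_conj_symm]
  field_simp

theorem normSq_one_sub_inner (z w : Cn n) :
    (1 - inner ℂ w z) * (1 - inner ℂ z w) = ((‖1 - inner ℂ z w‖ ^ 2 : ℝ) : ℂ) := by
  have : (1 - inner ℂ w z) = (starRingEnd ℂ) (1 - inner ℂ z w) := by simp [inner_conj_symm]
  rw [this, mul_comm, Complex.mul_conj, Complex.normSq_eq_norm_sq]

theorem one_sub_norm_phi_sq {z w : Cn n} (hz : z ∈ ball n) (hw : w ∈ ball n) :
    1 - ‖phi z w‖ ^ 2 = (1 - ‖z‖ ^ 2) * (1 - ‖w‖ ^ 2) / ‖1 - inner ℂ z w‖ ^ 2 := by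
  have := one_sub_inner_phi hz hw hw
  rw [normSq_one_sub_inner, inner_self_eq, inner_self_eq] at this
  exact_mod_cast this

theorem phi_mem {z w : Cn n} (hz : z ∈ ball n) (hw : w ∈ ball n) : phi z w ∈ ball n := by
  have h := one_sub_norm_phi_sq hz hw
  have h1 := norm_pos_iff.mpr (one_sub_inner_ne_zero hz hw)
  have h2 : 0 < 1 - ‖phi z w‖ ^ 2 := by
    rw [h]
    have := one_sub_sq_pos hz
    have := one_sub_sq_pos hw
    positivity
  rw [mem_ball_zero_iff]
  nlinarith [norm_nonneg (phi z w)]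

theorem shrink_zero (z : Cn n) : shrink z 0 = 0 := by simp [shrink]

theorem phi_zero_right {z : Cn n} (hz : z ∈ ball n) : phi z 0 = z := by
  rw [phi_eq hz]; simp [shrink_zero]

theorem zero_mem_ball : (0 : Cn n) ∈ ball n := by simp

theorem inner_phi_left {z w : Cn n} (hz : z ∈ ball n) (hw : w ∈ ball n) :
    1 - inner ℂ z (phi z w) = ((1 - ‖z‖ ^ 2 : ℝ) : ℂ) / (1 - inner ℂ z w) := by
  have := one_sub_inner_phi hz zero_mem_ball hw
  rw [phi_zero_right hz] at this
  simpa using this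

theorem shrink_shrink {z : Cn n} (hz : z ∈ ball n) (w : Cn n) :
    shrink z (shrink z w) = ((1 - ‖z‖ ^ 2 : ℝ) : ℂ) • w + (inner ℂ z w) • z := by
  have h := inner_shrink_self hz w
  have e : shrink z (shrink z w) = ((defect z : ℝ) : ℂ) • shrink z w +
    (inner ℂ z (shrink z w) / (1 + (defect z : ℝ) : ℂ)) • z := rfl
  rw [e, h]
  unfold shrink
  rw [← defect_sq hz]
  have h1 := one_add_defect_ne_zero z
  have : (inner ℂ z w : ℂ) = (defect z : ℂ) * (inner ℂ z w / (1 + (defect z : ℂ))) +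
    inner ℂ z w / (1 + (defect z : ℂ)) := by field_simp; ring
  push_cast
  conv_rhs => rw [this]
  module

theorem shrink_smul (z : Cn n) (c : ℂ) (w : Cn n) : shrink z (c • w) = c • shrink z w := by
  unfold shrink; rw [inner_smul_right]; module

theorem shrink_sub (z v w : Cn n) : shrink z (v - w) = shrink z v - shrink z w := by
  unfold shrink; rw [inner_sub_right]; module

theorem shrink_self {z : Cn n} (hz : z ∈ ball n) : shrink z z = z := by
  unfold shrink
  rw [inner_self_eq_defect hz]
  have h1 := one_add_defect_ne_zero z
  have : (1 - (defect z : ℂ) ^ 2) / (1 + (defect z : ℂ)) = 1 - (defect z : ℂ) := by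
    field_simp; ring
  rw [this]; module

theorem phi_phi {z w : Cn n} (hz : z ∈ ball n) (hw : w ∈ ball n) : phi z (phi z w) = w := by
  have h1 := one_sub_inner_ne_zero hz hw
  have h2 : ((1 - ‖z‖ ^ 2 : ℝ) : ℂ) ≠ 0 := by exact_mod_cast (one_sub_sq_pos hz).ne'
  have e : shrink z (phi z w) = (1 - inner ℂ z w)⁻¹ •
      (z - (((1 - ‖z‖ ^ 2 : ℝ) : ℂ) • w + inner ℂ z w • z)) := by
    rw [phi_eq hz w, shrink_smul, shrink_sub, shrink_shrink hz, shrink_self hz]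
  rw [phi_eq hz (phi z w), inner_phi_left hz hw, e, inv_div, div_eq_mul_inv]
  generalize ((1 - ‖z‖ ^ 2 : ℝ) : ℂ) = k at h2 ⊢
  generalize inner ℂ z w = u at h1 ⊢
  match_scalars
  all_goals field_simp
  all_goals ring

theorem phi_self {z : Cn n} (hz : z ∈ ball n) : phi z z = 0 := by
  conv_lhs => rw [← phi_zero_right hz]
  rw [phi_zero_right hz, phi_eq hz, shrink_self hz]; simp

theorem image_phi {z : Cn n} (hz : z ∈ ball n) : phi z '' ball n = ball n := by
  ext w
  constructor
  · rintro ⟨u, hu, rfl⟩; exact phi_mem hz hu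
  · intro hw; exact ⟨phi z w, phi_mem hz hw, phi_phi hz hw⟩

theorem injOn_phi {z : Cn n} (hz : z ∈ ball n) : Set.InjOn (phi z) (ball n) := by
  intro x hx y hy h
  rw [← phi_phi hz hx, h, phi_phi hz hy]

/-- The complex derivative of `phi z` at `w`: a rank one perturbation of a multiple of the
identity. -/
def phiDeriv (z w : Cn n) : Cn n →L[ℂ] Cn n :=
  (-(1 - inner ℂ z w)⁻¹) • (((defect z : ℝ) : ℂ) • ContinuousLinearMap.id ℂ (Cn n) +
    (innerSL ℂ z).smulRight ((1 + (defect z : ℝ) : ℂ)⁻¹ • z - phi z w))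

theorem hasFDerivAt_inv_smul_sub {E : Type*} [NormedAddCommGroup E] [NormedSpace ℂ E]
    (l : E →L[ℂ] ℂ) (T : E →L[ℂ] E) (z w : E) (h : 1 - l w ≠ 0) :
    HasFDerivAt (fun w => (1 - l w)⁻¹ • (z - T w))
      ((-(1 - l w)⁻¹) • (T - l.smulRight ((1 - l w)⁻¹ • (z - T w)))) w := by
  have hc : HasFDerivAt (fun w => 1 - l w) (-l) w := l.hasFDerivAt.const_sub 1
  have hinv : HasFDerivAt (fun w => (1 - l w)⁻¹) ((-((1 - l w) ^ 2)⁻¹) • (-l)) w :=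
    (hasDerivAt_inv h).comp_hasFDerivAt w hc
  have hlin : HasFDerivAt (fun w => z - T w) (-T) w := T.hasFDerivAt.const_sub z
  refine (hinv.fun_smul hlin).congr_fderiv (ContinuousLinearMap.ext fun v => ?_)
  simp only [add_apply, smul_apply, _root_.neg_apply, _root_.sub_apply,
    ContinuousLinearMap.smulRight_apply, smul_eq_mul]
  generalize 1 - l w = k at h
  match_scalars <;> field_simp

theorem hasFDerivAt_phi {z w : Cn n} (hz : z ∈ ball n) (hw : w ∈ ball n) :
    HasFDerivAt (phi z) (phiDeriv z w) w := by
  have h1 := one_sub_inner_ne_zero hz hw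
  let T : Cn n →L[ℂ] Cn n := ((defect z : ℝ) : ℂ) • ContinuousLinearMap.id ℂ (Cn n) +
    (innerSL ℂ z).smulRight ((1 + (defect z : ℝ) : ℂ)⁻¹ • z)
  have hT : ∀ w, T w = shrink z w := fun w => by
    simp only [T, shrink, add_apply, smul_apply, ContinuousLinearMap.coe_id', id_eq,
      ContinuousLinearMap.smulRight_apply, innerSL_apply_apply, smul_smul, div_eq_mul_inv]
  have h := hasFDerivAt_inv_smul_sub (innerSL ℂ z) T z w h1
  have e : phi z = fun w => (1 - innerSL ℂ z w)⁻¹ • (z - T w) := by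
    funext w; rw [phi_eq hz, hT]; rfl
  have e' : (1 - innerSL ℂ z w)⁻¹ • (z - T w) = phi z w := by rw [e]
  rw [e'] at h
  rw [← e] at h
  refine h.congr_fderiv (ContinuousLinearMap.ext fun v => ?_)
  simp only [T, phiDeriv, innerSL_apply_apply, add_apply, smul_apply, _root_.sub_apply,
    ContinuousLinearMap.smulRight_apply, ContinuousLinearMap.coe_id', id_eq]
  module

theorem det_phiDeriv {z w : Cn n} (hz : z ∈ ball n) (hw : w ∈ ball n) :
    ‖(LinearMap.det (phiDeriv z w : Cn n →ₗ[ℂ] Cn n))‖ ^ 2 =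
      ((1 - ‖z‖ ^ 2) / ‖1 - inner ℂ z w‖ ^ 2) ^ (n + 1) := by
  have hs := defect_pos hz
  have hs' : ((defect z : ℝ) : ℂ) ≠ 0 := by exact_mod_cast hs.ne'
  have h1 := one_sub_inner_ne_zero hz hw
  have e : (phiDeriv z w : Cn n →ₗ[ℂ] Cn n) =
      (-(1 - inner ℂ z w)⁻¹ * ((defect z : ℝ) : ℂ)) • LinearMap.transvection
        ((innerSL ℂ z : Cn n →L[ℂ] ℂ) : Cn n →ₗ[ℂ] ℂ)
        (((defect z : ℝ) : ℂ)⁻¹ • ((1 + (defect z : ℝ) : ℂ)⁻¹ • z - phi z w)) := by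
    refine LinearMap.ext fun x => ?_
    simp only [phiDeriv, ContinuousLinearMap.coe_coe, LinearMap.smul_apply,
      innerSL_apply_apply, add_apply, smul_apply, LinearMap.transvection.apply,
      ContinuousLinearMap.smulRight_apply, ContinuousLinearMap.coe_id', id_eq]
    match_scalars <;> field_simp
  have hd : 1 + inner ℂ z ((((defect z : ℝ) : ℂ)⁻¹ • ((1 + (defect z : ℝ) : ℂ)⁻¹ • z - phi z w)))
      = ((defect z : ℝ) : ℂ) / (1 - inner ℂ z w) := by
    have h2 : inner ℂ z (phi z w) = 1 - ((1 - ‖z‖ ^ 2 : ℝ) : ℂ) / (1 - inner ℂ z w) := by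
      rw [← inner_phi_left hz hw]; ring
    rw [inner_smul_right, inner_sub_right, inner_smul_right, h2, inner_self_eq_defect hz,
      ← defect_sq hz]
    have := one_add_defect_ne_zero z
    push_cast
    field_simp
    ring
  rw [e, LinearMap.det_smul, LinearMap.transvection.det]
  simp only [ContinuousLinearMap.coe_coe, innerSL_apply_apply]
  rw [hd, ← defect_sq hz]
  simp only [norm_mul, norm_pow, norm_neg, norm_inv, norm_div, Complex.norm_real, Real.norm_eq_abs,
    abs_of_pos hs, finrank_euclideanSpace_fin]
  have := norm_pos_iff.mpr h1
  rw [← div_pow, ← pow_mul, mul_pow, ← pow_mul, inv_mul_eq_div]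
  ring

theorem abs_det_phiDeriv {z w : Cn n} (hz : z ∈ ball n) (hw : w ∈ ball n) :
    |((phiDeriv z w).restrictScalars ℝ).det| =
      ((1 - ‖z‖ ^ 2) / ‖1 - inner ℂ z w‖ ^ 2) ^ (n + 1) := by
  rw [← det_phiDeriv hz hw]
  have : ((phiDeriv z w).restrictScalars ℝ).det =
      LinearMap.det ((phiDeriv z w : Cn n →ₗ[ℂ] Cn n).restrictScalars ℝ) := rfl
  rw [this, LinearMap.det_restrictScalars, Algebra.norm_complex_apply, Complex.normSq_eq_norm_sq,
    abs_of_nonneg (by positivity)]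

theorem differentiableOn_phi {z : Cn n} (hz : z ∈ ball n) :
    DifferentiableOn ℂ (phi z) (ball n) := fun _ hw =>
  (hasFDerivAt_phi hz hw).differentiableAt.differentiableWithinAt

end Involution

/-! ### Real powers of complex numbers with positive real part -/

section Powers

theorem arg_mem_of_re_pos {x : ℂ} (hx : 0 < x.re) : |x.arg| < Real.pi / 2 :=
  Complex.abs_arg_lt_pi_div_two_iff.mpr (Or.inl hx)

theorem arg_ne_pi_of_re_pos {x : ℂ} (hx : 0 < x.re) : x.arg ≠ Real.pi := by
  intro h
  have := arg_mem_of_re_pos hx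
  rw [h, abs_of_pos Real.pi_pos] at this
  linarith [Real.pi_pos]

theorem mul_cpow_of_re_pos {x y : ℂ} (hx : 0 < x.re) (hy : 0 < y.re) (t : ℂ) :
    (x * y) ^ t = x ^ t * y ^ t := by
  have hx0 := ne_zero_of_re_pos hx
  have hy0 := ne_zero_of_re_pos hy
  have h1 := abs_lt.mp (arg_mem_of_re_pos hx)
  have h2 := abs_lt.mp (arg_mem_of_re_pos hy)
  have hl : Complex.log (x * y) = Complex.log x + Complex.log y :=
    (Complex.log_mul_eq_add_log_iff hx0 hy0).mpr ⟨by linarith, by linarith⟩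
  rw [Complex.cpow_def_of_ne_zero (mul_ne_zero hx0 hy0), Complex.cpow_def_of_ne_zero hx0,
    Complex.cpow_def_of_ne_zero hy0, hl, add_mul, Complex.exp_add]

theorem re_inv_pos {x : ℂ} (hx : 0 < x.re) : 0 < (x⁻¹).re := by
  rw [Complex.inv_re]
  exact div_pos hx (Complex.normSq_pos.mpr (ne_zero_of_re_pos hx))

theorem div_cpow_of_re_pos {x y : ℂ} (hx : 0 < x.re) (hy : 0 < y.re) (t : ℂ) :
    (x / y) ^ t = x ^ t / y ^ t := by
  rw [div_eq_mul_inv, mul_cpow_of_re_pos hx (re_inv_pos hy),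
    Complex.inv_cpow _ _ (arg_ne_pi_of_re_pos hy), div_eq_mul_inv]

theorem re_ofReal_pos {r : ℝ} (hr : 0 < r) : 0 < (r : ℂ).re := by simpa using hr

theorem conj_cpow_of_re_pos {x : ℂ} (hx : 0 < x.re) (t : ℝ) :
    (starRingEnd ℂ x) ^ (t : ℂ) = starRingEnd ℂ (x ^ (t : ℂ)) := by
  rw [Complex.conj_cpow _ _ (arg_ne_pi_of_re_pos hx), Complex.conj_ofReal]

theorem cpow_ne_zero_of_re_pos {x : ℂ} (hx : 0 < x.re) (t : ℂ) : x ^ t ≠ 0 := by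
  rw [Complex.cpow_def_of_ne_zero (ne_zero_of_re_pos hx)]
  exact Complex.exp_ne_zero _

theorem cpow_mul_conj_cpow {x : ℂ} (hx : 0 < x.re) (t : ℝ) :
    x ^ (t : ℂ) * (starRingEnd ℂ x) ^ (t : ℂ) = (((‖x‖ ^ 2) ^ t : ℝ) : ℂ) := by
  rw [conj_cpow_of_re_pos hx, Complex.mul_conj, Complex.normSq_eq_norm_sq, Complex.norm_cpow_real,
    ← Real.rpow_natCast, ← Real.rpow_natCast, ← Real.rpow_mul (norm_nonneg _),
    ← Real.rpow_mul (norm_nonneg _), mul_comm]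

end Powers

/-! ### The measures `va n α` -/

section Measures

variable {n : ℕ} {α : ℝ}

theorem measurable_weight (n : ℕ) (α : ℝ) :
    Measurable (fun z : Cn n => ENNReal.ofReal ((1 - ‖z‖ ^ 2) ^ α)) := by
  fun_prop

theorem integrableOn_weight (hn : 1 ≤ n) (hα : -1 < α) :
    IntegrableOn (fun z : Cn n => (1 - ‖z‖ ^ 2) ^ α) (ball n) := by
  have : Nonempty (Fin n) := ⟨⟨0, hn⟩⟩
  rw [integrableOn_fun_norm_addHaar volume (f := fun y : ℝ => (1 - y ^ 2) ^ α) (r := 1)]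
  have h0 : IntervalIntegrable (fun y : ℝ => y ^ α) volume 0 1 :=
    intervalIntegral.intervalIntegrable_rpow' hα
  have h1 : IntervalIntegrable (fun y : ℝ => (1 - y) ^ α) volume 0 1 := by
    have := (h0.comp_sub_left 1).symm
    simpa using this
  have h2 : IntervalIntegrable (fun y : ℝ => (1 - y) ^ α *
      (y ^ (Module.finrank ℝ (Cn n) - 1) * (1 + y) ^ α)) volume 0 1 := by
    refine h1.mul_continuousOn ?_
    refine (continuousOn_pow _).mul ?_
    refine ContinuousOn.rpow_const (by fun_prop) fun y hy => Or.inl ?_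
    rw [Set.uIcc_of_le zero_le_one] at hy
    linarith [hy.1]
  rw [intervalIntegrable_iff_integrableOn_Ioo_of_le zero_le_one] at h2
  refine h2.congr_fun (fun y hy => ?_) measurableSet_Ioo
  have e : 1 - y ^ 2 = (1 - y) * (1 + y) := by ring
  simp only [smul_eq_mul]
  rw [e, Real.mul_rpow (by linarith [hy.2]) (by linarith [hy.1])]
  ring

theorem weightMeasure_univ (n : ℕ) (α : ℝ) : weightMeasure n α Set.univ =
    ∫⁻ z in ball n, ENNReal.ofReal ((1 - ‖z‖ ^ 2) ^ α) := by
  rw [weightMeasure, withDensity_apply _ MeasurableSet.univ, Measure.restrict_univ]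

theorem weightMeasure_univ_ne_top (hn : 1 ≤ n) (hα : -1 < α) :
    weightMeasure n α Set.univ ≠ ∞ := by
  rw [weightMeasure_univ]
  exact (integrableOn_weight hn hα).lintegral_lt_top.ne

theorem restrict_absolutelyContinuous_weightMeasure (n : ℕ) (α : ℝ) :
    (volume.restrict (ball n) : Measure (Cn n)) ≪ weightMeasure n α := by
  refine withDensity_absolutelyContinuous' (measurable_weight n α).aemeasurable ?_
  filter_upwards [ae_restrict_mem Metric.isOpen_ball.measurableSet] with z hz
  simpa using Real.rpow_pos_of_pos (one_sub_sq_pos hz) α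

theorem weightMeasure_univ_ne_zero (n : ℕ) (α : ℝ) : weightMeasure n α Set.univ ≠ 0 := by
  intro h
  have := restrict_absolutelyContinuous_weightMeasure n α h
  rw [Measure.restrict_apply_univ] at this
  exact (Metric.measure_ball_pos volume (0 : Cn n) one_pos).ne' this

theorem isProbabilityMeasure_va (hn : 1 ≤ n) (hα : -1 < α) : IsProbabilityMeasure (va n α) :=
  ⟨by
    rw [va, Measure.smul_apply, smul_eq_mul]
    exact ENNReal.inv_mul_cancel (weightMeasure_univ_ne_zero n α)
      (weightMeasure_univ_ne_top hn hα)⟩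

theorem restrict_absolutelyContinuous_va (hn : 1 ≤ n) (hα : -1 < α) :
    (volume.restrict (ball n) : Measure (Cn n)) ≪ va n α :=
  (restrict_absolutelyContinuous_weightMeasure n α).trans
    (Measure.absolutelyContinuous_smul (ENNReal.inv_ne_zero.mpr (weightMeasure_univ_ne_top hn hα)))

theorem ae_mem_ball (n : ℕ) (α : ℝ) : ∀ᵐ w ∂(va n α), w ∈ ball n :=
  (va_absolutelyContinuous n α).ae_le (ae_restrict_mem Metric.isOpen_ball.measurableSet)

theorem aestronglyMeasurable_of_continuousOn {E : Type*} [NormedAddCommGroup E]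
    {f : Cn n → E} (hf : ContinuousOn f (ball n)) : AEStronglyMeasurable f (va n α) :=
  (hf.aestronglyMeasurable Metric.isOpen_ball.measurableSet).mono_ac (va_absolutelyContinuous n α)

theorem lintegral_va (n : ℕ) (α : ℝ) (g : Cn n → ℝ≥0∞) :
    ∫⁻ w, g w ∂(va n α) = (weightMeasure n α Set.univ)⁻¹ *
      ∫⁻ w in ball n, ENNReal.ofReal ((1 - ‖w‖ ^ 2) ^ α) * g w := by
  rw [va, lintegral_smul_measure, weightMeasure,
    lintegral_withDensity_eq_lintegral_mul_non_measurable _ (measurable_weight n α)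
      (Eventually.of_forall fun _ => ENNReal.ofReal_lt_top)]
  rfl

theorem integral_va {E : Type*} [NormedAddCommGroup E] [NormedSpace ℝ E] (n : ℕ) (α : ℝ)
    (g : Cn n → E) :
    ∫ w, g w ∂(va n α) = (weightMeasure n α Set.univ)⁻¹.toReal •
      ∫ w in ball n, ((1 - ‖w‖ ^ 2) ^ α) • g w := by
  rw [va, integral_smul_measure, weightMeasure,
    integral_withDensity_eq_integral_toReal_smul (measurable_weight n α)
      (Eventually.of_forall fun _ => ENNReal.ofReal_lt_top)]
  congr 1
  refine setIntegral_congr_fun Metric.isOpen_ball.measurableSet fun w hw => ?_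
  rw [ENNReal.toReal_ofReal (Real.rpow_nonneg (one_sub_sq_pos hw).le _)]

/-! ### Change of variables -/

/-- The Jacobian of `phi z` with respect to `va n α`. -/
def jac (α : ℝ) (z u : Cn n) : ℝ :=
  ((1 - ‖z‖ ^ 2) / ‖1 - inner ℂ z u‖ ^ 2) ^ ((n : ℝ) + 1 + α)

theorem ratio_pos {z u : Cn n} (hz : z ∈ ball n) (hu : u ∈ ball n) :
    0 < (1 - ‖z‖ ^ 2) / ‖1 - inner ℂ z u‖ ^ 2 :=
  div_pos (one_sub_sq_pos hz) (pow_pos (norm_pos_iff.mpr (one_sub_inner_ne_zero hz hu)) 2)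

theorem jac_pos {z u : Cn n} (hz : z ∈ ball n) (hu : u ∈ ball n) : 0 < jac α z u :=
  Real.rpow_pos_of_pos (ratio_pos hz hu) _

theorem det_mul_weight {z u : Cn n} (hz : z ∈ ball n) (hu : u ∈ ball n) :
    |((phiDeriv z u).restrictScalars ℝ).det| * (1 - ‖phi z u‖ ^ 2) ^ α =
      (1 - ‖u‖ ^ 2) ^ α * jac α z u := by
  have h := ratio_pos hz hu
  rw [abs_det_phiDeriv hz hu, one_sub_norm_phi_sq hz hu, jac, mul_div_right_comm,
    Real.mul_rpow h.le (one_sub_sq_pos hu).le, Real.rpow_add h, ← Nat.cast_add_one,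
    Real.rpow_natCast]
  ring

theorem hasFDerivWithinAt_phi_real {z : Cn n} (hz : z ∈ ball n) : ∀ u ∈ ball n,
    HasFDerivWithinAt (phi z) ((phiDeriv z u).restrictScalars ℝ) (ball n) u := fun _ hu =>
  ((hasFDerivAt_phi hz hu).restrictScalars ℝ).hasFDerivWithinAt

theorem lintegral_comp_phi {z : Cn n} (hz : z ∈ ball n) (g : Cn n → ℝ≥0∞) :
    ∫⁻ w, g w ∂(va n α) = ∫⁻ u, ENNReal.ofReal (jac α z u) * g (phi z u) ∂(va n α) := by
  rw [lintegral_va, lintegral_va]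
  congr 1
  conv_lhs => rw [← image_phi hz]
  rw [lintegral_image_eq_lintegral_abs_det_fderiv_mul volume Metric.isOpen_ball.measurableSet
    (hasFDerivWithinAt_phi_real hz) (injOn_phi hz)]
  refine setLIntegral_congr_fun Metric.isOpen_ball.measurableSet fun u hu => ?_
  simp only
  rw [← mul_assoc, ← mul_assoc, ← ENNReal.ofReal_mul (abs_nonneg _),
    ← ENNReal.ofReal_mul (Real.rpow_nonneg (one_sub_sq_pos hu).le _), det_mul_weight hz hu]

theorem integral_comp_phi {E : Type*} [NormedAddCommGroup E] [NormedSpace ℝ E]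
    {z : Cn n} (hz : z ∈ ball n) (g : Cn n → E) :
    ∫ w, g w ∂(va n α) = ∫ u, jac α z u • g (phi z u) ∂(va n α) := by
  rw [integral_va, integral_va]
  congr 1
  conv_lhs => rw [← image_phi hz]
  rw [integral_image_eq_integral_abs_det_fderiv_smul volume Metric.isOpen_ball.measurableSet
    (hasFDerivWithinAt_phi_real hz) (injOn_phi hz)]
  refine setIntegral_congr_fun Metric.isOpen_ball.measurableSet fun u hu => ?_
  simp only
  rw [smul_smul, smul_smul, det_mul_weight hz hu]

/-! ### Rotations and the mean value property -/

theorem measurePreserving_smul (n : ℕ) (α : ℝ) {c : ℂ} (hc : ‖c‖ = 1) :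
    MeasurePreserving (fun w : Cn n => c • w) (va n α) (va n α) := by
  have hc0 : c ≠ 0 := by rintro rfl; simp at hc
  let e : Cn n ≃ₗᵢ[ℝ] Cn n :=
    { (LinearEquiv.smulOfNeZero ℂ (Cn n) c hc0).restrictScalars ℝ with
      norm_map' := fun x => by
        change ‖c • x‖ = ‖x‖
        rw [norm_smul, hc, one_mul] }
  have he : MeasurePreserving (fun w : Cn n => c • w) volume volume := e.measurePreserving
  refine ⟨he.measurable, Measure.ext fun s hs => ?_⟩
  rw [Measure.map_apply he.measurable hs, ← lintegral_indicator_one hs,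
    ← lintegral_indicator_one (he.measurable hs), lintegral_va, lintegral_va]
  congr 1
  have hpre : (fun w : Cn n => c • w) ⁻¹' ball n = ball n := by
    ext w; simp [norm_smul, hc]
  conv_rhs =>
    rw [← he.setLIntegral_comp_preimage_emb e.toHomeomorph.measurableEmbedding _ (ball n), hpre]
  simp only [norm_smul, hc, one_mul]
  rfl

theorem measurableEmbedding_smul {c : ℂ} (hc : ‖c‖ = 1) :
    MeasurableEmbedding (fun w : Cn n => c • w) := by
  have hc0 : c ≠ 0 := by rintro rfl; simp at hc
  exact (Homeomorph.smulOfNeZero c hc0).measurableEmbedding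

theorem integral_smul_va {E : Type*} [NormedAddCommGroup E] [NormedSpace ℝ E]
    {c : ℂ} (hc : ‖c‖ = 1) (g : Cn n → E) :
    ∫ w, g (c • w) ∂(va n α) = ∫ w, g w ∂(va n α) :=
  (measurePreserving_smul n α hc).integral_comp (measurableEmbedding_smul hc) g

theorem circle_mean {E : Type*} [NormedAddCommGroup E] [NormedSpace ℂ E] [CompleteSpace E]
    {F : Cn n → E} (hF : DifferentiableOn ℂ F (ball n)) {w : Cn n} (hw : w ∈ ball n) :
    ∫ θ in (0 : ℝ)..2 * Real.pi, F (Complex.exp (θ * Complex.I) • w) = (2 * Real.pi) • F 0 := by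
  have hd : DiffContOnCl ℂ (fun ζ : ℂ => F (ζ • w)) (Metric.ball 0 |1|) := by
    refine DifferentiableOn.diffContOnCl ?_
    intro ζ hζ
    have hζ' : ‖ζ‖ ≤ 1 := by
      have := Metric.closure_ball_subset_closedBall hζ
      simpa using this
    have hm : ζ • w ∈ ball n := by
      rw [mem_ball_zero_iff, norm_smul]
      have := norm_lt_one_of_mem hw
      nlinarith [norm_nonneg w]
    have h1 : DifferentiableAt ℂ F (ζ • w) := (hF _ hm).differentiableAt (Metric.isOpen_ball.mem_nhds hm)
    have h2 : DifferentiableAt ℂ (fun ζ : ℂ => ζ • w) ζ := by fun_prop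
    exact (h1.comp ζ h2).differentiableWithinAt
  have h := hd.circleAverage
  rw [Real.circleAverage_def] at h
  simp only [circleMap_zero, Complex.ofReal_one, one_mul, zero_smul] at h
  rw [← h, smul_smul, mul_inv_cancel₀ (by positivity), one_smul]

/-- The mean value property with respect to the rotation invariant measure `va n α`. -/
theorem integral_va_holomorphic {E : Type*} [NormedAddCommGroup E] [NormedSpace ℂ E]
    [CompleteSpace E] (hn : 1 ≤ n) (hα : -1 < α) {F : Cn n → E}
    (hF : DifferentiableOn ℂ F (ball n)) (hi : Integrable F (va n α)) :
    ∫ w, F w ∂(va n α) = F 0 := by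
  have := isProbabilityMeasure_va hn hα
  have hpi : (0 : ℝ) ≤ 2 * Real.pi := by positivity
  have hexp : ∀ θ : ℝ, ‖Complex.exp (θ * Complex.I)‖ = 1 := Complex.norm_exp_ofReal_mul_I
  have hrot : ∀ θ : ℝ, ∫ w, F (Complex.exp (θ * Complex.I) • w) ∂(va n α) =
      ∫ w, F w ∂(va n α) := fun θ => integral_smul_va (hexp θ) F
  let ν : Measure ℝ := volume.restrict (Set.Ioc 0 (2 * Real.pi))
  have hmeas : AEStronglyMeasurable
      (fun x : ℝ × Cn n => F (Complex.exp (x.1 * Complex.I) • x.2)) (ν.prod (va n α)) := by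
    have hc : ContinuousOn (fun x : ℝ × Cn n => F (Complex.exp (x.1 * Complex.I) • x.2))
        (Set.univ ×ˢ ball n) := by
      refine hF.continuousOn.comp (by fun_prop) ?_
      rintro ⟨θ, w⟩ ⟨-, hw⟩
      rw [mem_ball_zero_iff, norm_smul, hexp, one_mul]
      exact norm_lt_one_of_mem hw
    have hm := hc.aestronglyMeasurable (μ := ν.prod (va n α))
      (MeasurableSet.univ.prod Metric.isOpen_ball.measurableSet)
    rw [← Measure.prod_restrict, Measure.restrict_univ,
      Measure.restrict_eq_self_of_ae_mem (ae_mem_ball n α)] at hm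
    exact hm
  have hint : Integrable (fun x : ℝ × Cn n => F (Complex.exp (x.1 * Complex.I) • x.2))
      (ν.prod (va n α)) := by
    rw [integrable_prod_iff hmeas]
    constructor
    · exact Eventually.of_forall fun θ =>
        (measurePreserving_smul n α (hexp θ)).integrable_comp_of_integrable hi
    · have : (fun θ : ℝ => ∫ w, ‖F (Complex.exp (θ * Complex.I) • w)‖ ∂(va n α)) =
          fun _ => ∫ w, ‖F w‖ ∂(va n α) := by
        funext θ; exact integral_smul_va (hexp θ) fun w => ‖F w‖
      simp only [this]
      exact integrable_const _
  have h1 : ∫ θ, ∫ w, F (Complex.exp (θ * Complex.I) • w) ∂(va n α) ∂ν =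
      (2 * Real.pi) • ∫ w, F w ∂(va n α) := by
    simp only [hrot]
    rw [integral_const]
    simp [ν, Measure.real, Real.pi_nonneg]
  have h2 : ∫ w, ∫ θ, F (Complex.exp (θ * Complex.I) • w) ∂ν ∂(va n α) = (2 * Real.pi) • F 0 := by
    have : ∀ᵐ w ∂(va n α), ∫ θ, F (Complex.exp (θ * Complex.I) • w) ∂ν =
        (2 * Real.pi) • F 0 := by
      filter_upwards [ae_mem_ball n α] with w hw
      rw [← circle_mean hF hw, intervalIntegral.integral_of_le hpi]
    rw [integral_congr_ae this, integral_const]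
    simp
  rw [integral_integral_swap hint, h2] at h1
  have h3 : (2 * Real.pi) ≠ 0 := by positivity
  exact (smul_right_injective E h3 h1).symm

theorem integrable_cpow_inv_smul {E : Type*} [NormedAddCommGroup E] [NormedSpace ℂ E]
    {F : Cn n → E} (hi : Integrable F (va n α)) {z : Cn n} (hz : z ∈ ball n) {s : ℝ}
    (hs0 : 0 < s) :
    Integrable (fun w => ((1 - inner ℂ w z) ^ (s : ℂ))⁻¹ • F w) (va n α) := by
  have hb : ∀ w ∈ ball n, ‖((1 - inner ℂ w z) ^ (s : ℂ))⁻¹‖ ≤ ((1 - ‖z‖) ^ s)⁻¹ := by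
    intro w hw
    have hz1 := norm_lt_one_of_mem hz
    rw [norm_inv, Complex.norm_cpow_real]
    refine inv_anti₀ (Real.rpow_pos_of_pos (by linarith) _)
      (Real.rpow_le_rpow (by linarith) ?_ hs0.le)
    have h1 : ‖inner ℂ w z‖ ≤ ‖z‖ := by
      refine (norm_inner_le_norm w z).trans ?_
      have := (norm_lt_one_of_mem hw).le
      nlinarith [norm_nonneg z]
    have h2 := norm_sub_norm_le (1 : ℂ) (inner ℂ w z)
    rw [norm_one] at h2
    linarith
  refine Integrable.bdd_smul (C := ((1 - ‖z‖) ^ s)⁻¹) hi ?_ ?_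
  · refine aestronglyMeasurable_of_continuousOn (ContinuousOn.inv₀ ?_ ?_)
    · exact ContinuousOn.cpow_const (by fun_prop) fun u hu =>
        Or.inl (one_sub_inner_re_pos hu hz)
    · exact fun u hu => cpow_ne_zero_of_re_pos (one_sub_inner_re_pos hu hz) _
  · filter_upwards [ae_mem_ball n α] with w hw using hb w hw

/-- The reproducing formula: it is the mean value property, transported by `phi z`. -/
theorem reproducing {E : Type*} [NormedAddCommGroup E] [NormedSpace ℂ E]
    [CompleteSpace E] (hn : 1 ≤ n) (hα : -1 < α) {F : Cn n → E}
    (hF : DifferentiableOn ℂ F (ball n)) (hi : Integrable F (va n α)) {z : Cn n}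
    (hz : z ∈ ball n) :
    ∫ w, ((1 - inner ℂ w z) ^ (((n : ℝ) + 1 + α : ℝ) : ℂ))⁻¹ • F w ∂(va n α) = F z := by
  set s : ℝ := (n : ℝ) + 1 + α with hs
  have hs0 : 0 < s := by
    have : (0 : ℝ) ≤ n := n.cast_nonneg
    linarith
  have key : ∀ u ∈ ball n, jac α z u • ((1 - inner ℂ (phi z u) z) ^ (s : ℂ))⁻¹ • F (phi z u) =
      ((1 - inner ℂ z u) ^ (s : ℂ))⁻¹ • F (phi z u) := by
    intro u hu
    have hr := one_sub_inner_re_pos hz hu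
    have hz' := one_sub_sq_pos hz
    have hconj : ∀ a b : Cn n, (1 - inner ℂ a b) = starRingEnd ℂ (1 - inner ℂ b a) := by
      intro a b; simp
    have e1 : (1 - inner ℂ (phi z u) z) =
        ((1 - ‖z‖ ^ 2 : ℝ) : ℂ) / starRingEnd ℂ (1 - inner ℂ z u) := by
      rw [hconj, inner_phi_left hz hu, map_div₀, Complex.conj_ofReal]
    have hr' : 0 < (starRingEnd ℂ (1 - inner ℂ z u)).re := by rwa [Complex.conj_re]
    have e2 : ((jac α z u : ℝ) : ℂ) = ((1 - ‖z‖ ^ 2 : ℝ) : ℂ) ^ (s : ℂ) /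
        ((1 - inner ℂ z u) ^ (s : ℂ) * (starRingEnd ℂ (1 - inner ℂ z u)) ^ (s : ℂ)) := by
      rw [cpow_mul_conj_cpow hr, ← Complex.ofReal_cpow hz'.le, ← Complex.ofReal_div, jac,
        Real.div_rpow hz'.le (by positivity)]
    rw [RCLike.real_smul_eq_coe_smul (K := ℂ), smul_smul]
    congr 1
    change ((jac α z u : ℝ) : ℂ) * _ = _
    rw [e2, e1, div_cpow_of_re_pos (re_ofReal_pos hz') hr']
    have h1 := cpow_ne_zero_of_re_pos hr s
    have h2 := cpow_ne_zero_of_re_pos hr' s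
    have h3 := cpow_ne_zero_of_re_pos (re_ofReal_pos hz') s
    field_simp
  have hcont : ContinuousOn (fun u : Cn n => (1 - inner ℂ z u) ^ (s : ℂ)) (ball n) := by
    refine ContinuousOn.cpow_const (by fun_prop) fun u hu =>
      Or.inl (one_sub_inner_re_pos hz hu)
  have hdiff : DifferentiableOn ℂ
      (fun u => ((1 - inner ℂ z u) ^ (s : ℂ))⁻¹ • F (phi z u)) (ball n) := by
    refine DifferentiableOn.smul (DifferentiableOn.inv ?_ ?_) ?_
    · refine DifferentiableOn.cpow_const ?_ fun u hu => Or.inl (one_sub_inner_re_pos hz hu)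
      exact ((differentiable_const _).sub (innerSL ℂ z).differentiable).differentiableOn
    · exact fun u hu => cpow_ne_zero_of_re_pos (one_sub_inner_re_pos hz hu) _
    · exact hF.comp (differentiableOn_phi hz) fun u hu => phi_mem hz hu
  have hint : Integrable (fun u => ((1 - inner ℂ z u) ^ (s : ℂ))⁻¹ • F (phi z u)) (va n α) := by
    refine ⟨aestronglyMeasurable_of_continuousOn hdiff.continuousOn, ?_⟩
    have hI := integrable_cpow_inv_smul hi hz hs0
    have h1 := hI.2
    rw [HasFiniteIntegral, lintegral_comp_phi hz] at h1
    rw [HasFiniteIntegral]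
    refine lt_of_eq_of_lt (lintegral_congr_ae ?_) h1
    filter_upwards [ae_mem_ball n α] with u hu
    rw [← key u hu, enorm_smul, Real.enorm_eq_ofReal (jac_pos hz hu).le]
  rw [integral_comp_phi hz]
  have h := integral_va_holomorphic hn hα hdiff hint
  rw [phi_zero_right hz] at h
  simp only [inner_zero_right, sub_zero, Complex.one_cpow, inv_one, one_smul] at h
  rw [← h]
  refine integral_congr_ae ?_
  filter_upwards [ae_mem_ball n α] with u hu using key u hu

end Measures

/-! ### Binomial coefficients -/

section Binomial

/-- The coefficients of `(1 - x)^{-a} = ∑ binCoeff a k * x ^ k`. -/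
def binCoeff (a : ℝ) : ℕ → ℝ
  | 0 => 1
  | k + 1 => binCoeff a k * (a + k) / (k + 1)

theorem binCoeff_succ (a : ℝ) (k : ℕ) : binCoeff a (k + 1) = binCoeff a k * (a + k) / (k + 1) :=
  rfl

theorem binCoeff_pos {a : ℝ} (ha : 0 < a) (k : ℕ) : 0 < binCoeff a k := by
  induction k with
  | zero => simp [binCoeff]
  | succ k ih => rw [binCoeff_succ]; positivity

theorem choose_eq_binCoeff (a : ℝ) (k : ℕ) :
    Ring.choose ((a : ℂ) + k - 1) k = (binCoeff a k : ℂ) := by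
  have h1 : Ring.choose ((a : ℂ) + k - 1) k = Ring.multichoose (a : ℂ) k := by
    rw [Ring.choose]; congr 1; ring
  have h2 : ∀ k : ℕ, (ascPochhammer ℕ k).smeval (a : ℂ) = (k.factorial : ℂ) * binCoeff a k := by
    intro k
    induction k with
    | zero => simp [binCoeff]
    | succ k ih =>
      rw [ascPochhammer_succ_right, Polynomial.smeval_mul, ih, binCoeff_succ, Nat.factorial_succ]
      have : ((k : ℂ) + 1) ≠ 0 := by exact_mod_cast k.succ_ne_zero
      simp only [Polynomial.smeval_add, Polynomial.smeval_X, pow_one, Polynomial.smeval_natCast,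
        pow_zero, nsmul_eq_mul, mul_one]
      push_cast
      field_simp
  have h3 := Ring.factorial_nsmul_multichoose_eq_ascPochhammer (a : ℂ) k
  rw [h2, nsmul_eq_mul] at h3
  rw [h1]
  exact mul_left_cancel₀ (by exact_mod_cast k.factorial_ne_zero) h3

theorem hasSum_binCoeff (a : ℝ) {x : ℂ} (hx : ‖x‖ < 1) :
    HasSum (fun k : ℕ => (binCoeff a k : ℂ) * x ^ k) ((1 - x) ^ (a : ℂ))⁻¹ := by
  have h := (Complex.one_div_one_sub_cpow_hasFPowerSeriesOnBall_zero (a : ℂ)).hasSum (y := x)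
    (by simpa [Metric.mem_eball, edist_eq_enorm_sub, enorm_lt_coe, ← ENNReal.coe_one] using hx)
  simpa [choose_eq_binCoeff, FormalMultilinearSeries.ofScalars_apply_eq, mul_comm] using h

theorem summable_binCoeff (a : ℝ) {r : ℝ} (hr : 0 ≤ r) (hr1 : r < 1) :
    Summable (fun k : ℕ => binCoeff a k * r ^ k) := by
  have h := (hasSum_binCoeff a (x := (r : ℂ)) (by simpa [abs_of_nonneg hr] using hr1)).summable
  exact_mod_cast h

/-- Raabe's test for the coefficients of a hypergeometric series `F(a, a; c; x)` at `x = 1`. -/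
theorem summable_binCoeff_sq_div {a c : ℝ} (ha : 0 < a) (hc : 2 * a < c) :
    Summable (fun k : ℕ => binCoeff a k ^ 2 / binCoeff c k) := by
  have hc0 : 0 < c := by linarith
  set t : ℕ → ℝ := fun k => binCoeff a k ^ 2 / binCoeff c k with ht
  have htpos : ∀ k, 0 < t k := fun k =>
    div_pos (pow_pos (binCoeff_pos ha k) 2) (binCoeff_pos hc0 k)
  have hrec : ∀ k : ℕ, t (k + 1) * (k + 1) * (c + k) = t k * (a + k) ^ 2 := by
    intro k
    have h1 := (binCoeff_pos hc0 k).ne'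
    have h2 : (k : ℝ) + 1 ≠ 0 := by positivity
    have h3 : c + k ≠ 0 := by positivity
    simp only [ht, binCoeff_succ]
    field_simp
  obtain ⟨K, hK⟩ := exists_nat_ge ((4 * a ^ 2 + c * (c - 2 * a)) / (3 * (c - 2 * a)))
  rw [div_le_iff₀ (by linarith)] at hK
  -- beyond `K`, each term is dominated by a multiple of an increment of `k * t k`
  have htel : ∀ k : ℕ, K ≤ k → (c - 2 * a) / 4 * t k ≤ k * t k - (k + 1) * t (k + 1) := by
    intro k hk
    have hk' : (K : ℝ) ≤ k := by exact_mod_cast hk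
    have h3 : 0 < c + k := by positivity
    have e : (k + 1) * t (k + 1) = t k * (a + k) ^ 2 / (c + k) := by
      rw [eq_div_iff h3.ne', ← hrec]; ring
    rw [e, ← sub_nonneg]
    have : k * t k - t k * (a + k) ^ 2 / (c + k) - (c - 2 * a) / 4 * t k =
        t k / (4 * (c + k)) * (3 * (c - 2 * a) * k - (4 * a ^ 2 + c * (c - 2 * a))) := by
      field_simp; ring
    rw [this]
    refine mul_nonneg (div_nonneg (htpos k).le (by positivity)) ?_
    nlinarith
  have hsum : ∀ N : ℕ, (c - 2 * a) / 4 * ∑ i ∈ Finset.range N, t (i + K) ≤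
      K * t K - ((N + K : ℕ) : ℝ) * t (N + K) := by
    intro N
    induction N with
    | zero => simp
    | succ N ih =>
      rw [Finset.sum_range_succ, mul_add]
      have h := htel (N + K) (by omega)
      have e : N + 1 + K = N + K + 1 := by ring
      rw [e]
      push_cast at h ih ⊢
      linarith
  rw [← summable_nat_add_iff K]
  refine summable_of_sum_range_le (c := 4 / (c - 2 * a) * (K * t K)) (fun i => (htpos _).le)
    fun N => ?_
  have h1 := hsum N
  have h2 : 0 ≤ ((N + K : ℕ) : ℝ) * t (N + K) := mul_nonneg (Nat.cast_nonneg _) (htpos _).le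
  have h3 : 0 < c - 2 * a := by linarith
  rw [div_mul_eq_mul_div, le_div_iff₀ h3]
  linarith

end Binomial

/-! ### The Forelli–Rudin estimate -/

section ForelliRudin

variable {n : ℕ} {α : ℝ}

theorem norm_inner_le_left {z u : Cn n} (hu : u ∈ ball n) : ‖inner ℂ z u‖ ≤ ‖z‖ := by
  refine (norm_inner_le_norm z u).trans ?_
  have := (norm_lt_one_of_mem hu).le
  nlinarith [norm_nonneg z]

theorem continuous_inner_right (z : Cn n) : Continuous (fun u : Cn n => inner ℂ z u) := by
  fun_prop

theorem integrable_of_continuousOn_of_bound [IsFiniteMeasure (va n α)] {E : Type*}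
    [NormedAddCommGroup E] {f : Cn n → E} (hf : ContinuousOn f (ball n)) (C : ℝ)
    (hC : ∀ u ∈ ball n, ‖f u‖ ≤ C) : Integrable f (va n α) := by
  refine Integrable.of_bound (aestronglyMeasurable_of_continuousOn hf) C ?_
  filter_upwards [ae_mem_ball n α] with u hu using hC u hu

theorem continuousOn_cpow_inv {z : Cn n} (hz : z ∈ ball n) (a : ℂ) :
    ContinuousOn (fun u : Cn n => ((1 - inner ℂ z u) ^ a)⁻¹) (ball n) := by
  refine ContinuousOn.inv₀ ?_ fun u hu => cpow_ne_zero_of_re_pos (one_sub_inner_re_pos hz hu) _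
  exact ContinuousOn.cpow_const (by fun_prop) fun u hu => Or.inl (one_sub_inner_re_pos hz hu)

theorem norm_one_sub_inner_ge {z u : Cn n} (hu : u ∈ ball n) :
    1 - ‖z‖ ≤ ‖1 - inner ℂ z u‖ := by
  have h2 := norm_sub_norm_le (1 : ℂ) (inner ℂ z u)
  rw [norm_one] at h2
  linarith [norm_inner_le_left (z := z) hu]

theorem norm_cpow_inv_le {z u : Cn n} (hz : z ∈ ball n) (hu : u ∈ ball n) {a : ℝ} (ha : 0 < a) :
    ‖((1 - inner ℂ z u) ^ (a : ℂ))⁻¹‖ ≤ ((1 - ‖z‖) ^ a)⁻¹ := by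
  have hz1 := norm_lt_one_of_mem hz
  rw [norm_inv, Complex.norm_cpow_real]
  exact inv_anti₀ (Real.rpow_pos_of_pos (by linarith) _)
    (Real.rpow_le_rpow (by linarith) (norm_one_sub_inner_ge hu) ha.le)

/-- Distinct powers of a coordinate are orthogonal, by rotation invariance. -/
theorem integral_inner_pow_mul_conj_pow (z : Cn n) {j k : ℕ} (hjk : j ≠ k) :
    ∫ u, inner ℂ z u ^ k * (starRingEnd ℂ) (inner ℂ z u) ^ j ∂(va n α) = 0 := by
  have hd : ((k : ℝ) - j) ≠ 0 := by
    rw [sub_ne_zero]; exact_mod_cast hjk.symm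
  -- rotate by an angle for which `c ^ k * conj c ^ j = -1`
  set c : ℂ := Complex.exp (((Real.pi / (k - j) : ℝ) : ℂ) * Complex.I) with hc
  have hc1 : ‖c‖ = 1 := Complex.norm_exp_ofReal_mul_I _
  have hcc : c ^ k * (starRingEnd ℂ c) ^ j = -1 := by
    rw [hc, ← Complex.exp_conj, ← Complex.exp_nat_mul, ← Complex.exp_nat_mul, ← Complex.exp_add,
      ← Complex.exp_pi_mul_I]
    congr 1
    simp only [map_mul, Complex.conj_ofReal, Complex.conj_I]
    have : ((k : ℂ) - j) ≠ 0 := by exact_mod_cast hd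
    push_cast
    field_simp
    ring
  have h := integral_smul_va (α := α) hc1
    (fun u : Cn n => inner ℂ z u ^ k * (starRingEnd ℂ) (inner ℂ z u) ^ j)
  have e : ∀ u : Cn n, inner ℂ z (c • u) ^ k * (starRingEnd ℂ) (inner ℂ z (c • u)) ^ j =
      -(inner ℂ z u ^ k * (starRingEnd ℂ) (inner ℂ z u) ^ j) := by
    intro u
    rw [inner_smul_right, map_mul, mul_pow, mul_pow]
    linear_combination (inner ℂ z u ^ k * (starRingEnd ℂ) (inner ℂ z u) ^ j) * hcc
  simp only [e, integral_neg] at h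
  exact self_eq_neg.mp h.symm

/-- The moment `∫ |z̄ u|^{2k} dv_α(u)`. -/
def moment (α : ℝ) (z : Cn n) (k : ℕ) : ℂ :=
  ∫ u, inner ℂ z u ^ k * (starRingEnd ℂ) (inner ℂ z u) ^ k ∂(va n α)

theorem integral_inner_pow_mul_conj_cpow {z : Cn n} (hz : z ∈ ball n) {a : ℝ} (ha : 0 < a)
    (k : ℕ) :
    ∫ u, inner ℂ z u ^ k * (starRingEnd ℂ) ((1 - inner ℂ z u) ^ (a : ℂ))⁻¹ ∂(va n α) =
      binCoeff a k * moment α z k := by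
  have hz1 := norm_lt_one_of_mem hz
  let F : ℕ → Cn n → ℂ := fun j u =>
    inner ℂ z u ^ k * ((binCoeff a j : ℂ) * (starRingEnd ℂ) (inner ℂ z u) ^ j)
  have hFb : ∀ j, ∀ u ∈ ball n, ‖F j u‖ ≤ binCoeff a j * ‖z‖ ^ j := by
    intro j u hu
    have h1 := norm_inner_le_left (z := z) hu
    simp only [F, norm_mul, norm_pow, RCLike.norm_conj, Complex.norm_real, Real.norm_eq_abs,
      abs_of_pos (binCoeff_pos ha j)]
    have h2 : ‖inner ℂ z u‖ ^ k ≤ 1 := pow_le_one₀ (norm_nonneg _) (h1.trans hz1.le)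
    have h3 : ‖inner ℂ z u‖ ^ j ≤ ‖z‖ ^ j := pow_le_pow_left₀ (norm_nonneg _) h1 j
    have h4 := binCoeff_pos ha j
    calc _ ≤ 1 * (binCoeff a j * ‖inner ℂ z u‖ ^ j) :=
          mul_le_mul_of_nonneg_right h2 (by positivity)
      _ ≤ _ := by rw [one_mul]; exact mul_le_mul_of_nonneg_left h3 h4.le
  have hFc : ∀ j, Continuous (F j) := fun j => by
    have := continuous_inner_right z
    fun_prop
  have hFi : ∀ j, Integrable (F j) (va n α) := fun j =>
    integrable_of_continuousOn_of_bound (hFc j).continuousOn _ (hFb j)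
  have hs := summable_binCoeff a (norm_nonneg z) hz1
  have hsum : Summable (fun j => ∫ u, ‖F j u‖ ∂(va n α)) := by
    refine Summable.of_nonneg_of_le (fun j => integral_nonneg fun u => norm_nonneg _)
      (fun j => ?_) (hs.mul_right ((va n α).real Set.univ))
    calc ∫ u, ‖F j u‖ ∂(va n α) ≤ ∫ u, binCoeff a j * ‖z‖ ^ j ∂(va n α) := by
          refine integral_mono_ae (hFi j).norm (integrable_const _) ?_
          filter_upwards [ae_mem_ball n α] with u hu using hFb j u hu
      _ = _ := by rw [integral_const, smul_eq_mul, mul_comm]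
  have h1 := hasSum_integral_of_summable_integral_norm hFi hsum
  have h2 : ∫ u, ∑' j, F j u ∂(va n α) =
      ∫ u, inner ℂ z u ^ k * (starRingEnd ℂ) ((1 - inner ℂ z u) ^ (a : ℂ))⁻¹ ∂(va n α) := by
    refine integral_congr_ae ?_
    filter_upwards [ae_mem_ball n α] with u hu
    have h3 := hasSum_binCoeff a (x := inner ℂ z u)
      ((norm_inner_le_left hu).trans_lt hz1)
    have h4 := (h3.map (starRingEnd ℂ : ℂ →+* ℂ) Complex.continuous_conj).mul_left
      (inner ℂ z u ^ k)
    rw [← h4.tsum_eq]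
    simp [F]
  have h3 : ∀ j, j ≠ k → ∫ u, F j u ∂(va n α) = 0 := by
    intro j hj
    have : ∀ u, F j u = (binCoeff a j : ℂ) *
        (inner ℂ z u ^ k * (starRingEnd ℂ) (inner ℂ z u) ^ j) := fun u => by
      simp only [F]; ring
    simp only [this]
    rw [integral_const_mul, integral_inner_pow_mul_conj_pow z hj, mul_zero]
  have h4 : ∫ u, F k u ∂(va n α) = binCoeff a k * moment α z k := by
    rw [moment, ← integral_const_mul]
    congr 1
    funext u
    simp only [F]; ring
  rw [← h2, ← h4]
  exact h1.unique (hasSum_single k h3)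

theorem conj_cpow_inv {z u : Cn n} (hz : z ∈ ball n) (hu : u ∈ ball n) (a : ℝ) :
    (starRingEnd ℂ) ((1 - inner ℂ z u) ^ (a : ℂ))⁻¹ = ((1 - inner ℂ u z) ^ (a : ℂ))⁻¹ := by
  rw [map_inv₀, ← conj_cpow_of_re_pos (one_sub_inner_re_pos hz hu)]
  simp

/-- The moments, read off from the reproducing formula for the powers of `u ↦ z̄ u`. -/
theorem binCoeff_mul_moment (hn : 1 ≤ n) (hα : -1 < α) {z : Cn n} (hz : z ∈ ball n) (k : ℕ) :
    (binCoeff ((n : ℝ) + 1 + α) k : ℂ) * moment α z k = ((‖z‖ ^ 2) ^ k : ℝ) := by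
  have hs : 0 < (n : ℝ) + 1 + α := by
    have : (0 : ℝ) ≤ n := n.cast_nonneg
    linarith
  rw [← integral_inner_pow_mul_conj_cpow hz hs]
  have hz1 := norm_lt_one_of_mem hz
  have hd : DifferentiableOn ℂ (fun u : Cn n => inner ℂ z u ^ k) (ball n) :=
    ((innerSL ℂ z).differentiable.pow k).differentiableOn
  have hi : Integrable (fun u : Cn n => inner ℂ z u ^ k) (va n α) := by
    refine integrable_of_continuousOn_of_bound hd.continuousOn 1 fun u hu => ?_
    rw [norm_pow]
    exact pow_le_one₀ (norm_nonneg _) ((norm_inner_le_left hu).trans hz1.le)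
  have h := reproducing hn hα hd hi hz
  rw [inner_self_eq] at h
  rw [Complex.ofReal_pow, ← h]
  refine integral_congr_ae ?_
  filter_upwards [ae_mem_ball n α] with u hu
  rw [conj_cpow_inv hz hu, smul_eq_mul, mul_comm]

/-- The Forelli–Rudin integrals of subcritical exponent are bounded. -/
theorem exists_integral_norm_cpow_le (hn : 1 ≤ n) (hα : -1 < α) {a : ℝ} (ha : 0 < a)
    (hac : 2 * a < (n : ℝ) + 1 + α) :
    ∃ M : ℝ, ∀ z ∈ ball n, ∫ u, ‖1 - inner ℂ z u‖ ^ (-(2 * a)) ∂(va n α) ≤ M := by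
  refine ⟨∑' k, binCoeff a k ^ 2 / binCoeff ((n : ℝ) + 1 + α) k, fun z hz => ?_⟩
  have hc : 0 < (n : ℝ) + 1 + α := by linarith
  have hz1 := norm_lt_one_of_mem hz
  set g : Cn n → ℂ := fun u => ((1 - inner ℂ z u) ^ (a : ℂ))⁻¹ with hg
  have hgc : ContinuousOn g (ball n) := continuousOn_cpow_inv hz a
  set B : ℝ := ((1 - ‖z‖) ^ a)⁻¹ with hB
  have hgb : ∀ u ∈ ball n, ‖g u‖ ≤ B := fun u hu => norm_cpow_inv_le hz hu ha
  have hB0 : 0 ≤ B := (norm_nonneg _).trans (hgb 0 zero_mem_ball)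
  let F : ℕ → Cn n → ℂ := fun k u =>
    ((binCoeff a k : ℂ) * inner ℂ z u ^ k) * (starRingEnd ℂ) (g u)
  have hFb : ∀ k, ∀ u ∈ ball n, ‖F k u‖ ≤ (binCoeff a k * ‖z‖ ^ k) * B := by
    intro k u hu
    simp only [F, norm_mul, norm_pow, RCLike.norm_conj, Complex.norm_real, Real.norm_eq_abs,
      abs_of_pos (binCoeff_pos ha k)]
    have h3 : ‖inner ℂ z u‖ ^ k ≤ ‖z‖ ^ k :=
      pow_le_pow_left₀ (norm_nonneg _) (norm_inner_le_left hu) k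
    have h4 := (binCoeff_pos ha k).le
    exact mul_le_mul (mul_le_mul_of_nonneg_left h3 h4) (hgb u hu) (norm_nonneg _) (by positivity)
  have hFi : ∀ k, Integrable (F k) (va n α) := fun k => by
    refine integrable_of_continuousOn_of_bound ?_ _ (hFb k)
    have := (continuous_inner_right z).continuousOn (s := ball n)
    exact (continuousOn_const.mul (this.pow k)).mul
      (Complex.continuous_conj.comp_continuousOn hgc)
  have hs := (summable_binCoeff a (norm_nonneg z) hz1).mul_right B
  have hsum : Summable (fun j => ∫ u, ‖F j u‖ ∂(va n α)) := by
    refine Summable.of_nonneg_of_le (fun j => integral_nonneg fun u => norm_nonneg _)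
      (fun j => ?_) (hs.mul_right ((va n α).real Set.univ))
    calc ∫ u, ‖F j u‖ ∂(va n α) ≤ ∫ u, binCoeff a j * ‖z‖ ^ j * B ∂(va n α) := by
          refine integral_mono_ae (hFi j).norm (integrable_const _) ?_
          filter_upwards [ae_mem_ball n α] with u hu using hFb j u hu
      _ = _ := by rw [integral_const, smul_eq_mul, mul_comm]
  have h1 := hasSum_integral_of_summable_integral_norm hFi hsum
  have h2 : ∫ u, ∑' k, F k u ∂(va n α) =
      ((∫ u, ‖1 - inner ℂ z u‖ ^ (-(2 * a)) ∂(va n α) : ℝ) : ℂ) := by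
    rw [← integral_complex_ofReal]
    refine integral_congr_ae ?_
    filter_upwards [ae_mem_ball n α] with u hu
    have h3 := (hasSum_binCoeff a (x := inner ℂ z u)
      ((norm_inner_le_left hu).trans_lt hz1)).mul_right ((starRingEnd ℂ) (g u))
    rw [h3.tsum_eq, show ((1 - inner ℂ z u) ^ (a : ℂ))⁻¹ = g u from rfl, Complex.mul_conj,
      Complex.normSq_eq_norm_sq, hg]
    simp only [norm_inv, Complex.norm_cpow_real]
    rw [Real.rpow_neg (norm_nonneg _), mul_comm 2 a, Real.rpow_mul (norm_nonneg _), inv_pow]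
    norm_cast
  have h3 : ∀ k, ∫ u, F k u ∂(va n α) =
      ((binCoeff a k ^ 2 / binCoeff ((n : ℝ) + 1 + α) k * (‖z‖ ^ 2) ^ k : ℝ) : ℂ) := by
    intro k
    have e : ∀ u, F k u = (binCoeff a k : ℂ) * (inner ℂ z u ^ k * (starRingEnd ℂ) (g u)) :=
      fun u => by simp only [F]; ring
    simp only [e]
    rw [integral_const_mul, integral_inner_pow_mul_conj_cpow hz ha]
    have hm := binCoeff_mul_moment hn hα hz k
    have hb : (binCoeff ((n : ℝ) + 1 + α) k : ℂ) ≠ 0 := by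
      exact_mod_cast (binCoeff_pos hc k).ne'
    rw [Complex.ofReal_mul, ← hm]
    push_cast
    field_simp
  rw [h2] at h1
  simp only [h3] at h1
  have h4 : HasSum (fun k => binCoeff a k ^ 2 / binCoeff ((n : ℝ) + 1 + α) k * (‖z‖ ^ 2) ^ k)
      (∫ u, ‖1 - inner ℂ z u‖ ^ (-(2 * a)) ∂(va n α)) := by exact_mod_cast h1
  rw [← h4.tsum_eq]
  refine h4.summable.tsum_le_tsum (fun k => ?_) (summable_binCoeff_sq_div ha hac)
  refine mul_le_of_le_one_right ?_ (pow_le_one₀ (by positivity) ?_)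
  · exact div_nonneg (sq_nonneg _) (binCoeff_pos hc k).le
  · exact pow_le_one₀ (norm_nonneg _) hz1.le

/-- The Forelli–Rudin estimate for the kernel `|1 - z̄ w|^{-(n+1+α)}` and the weight
`(1 - |w|²)^{-t}`: the involution `phi z` turns it into a bounded integral of subcritical
exponent. -/
theorem exists_lintegral_kernel_le (hn : 1 ≤ n) {t : ℝ} (ht : 0 < t)
    (ht1 : t < 1 + α) (ht2 : 2 * t < (n : ℝ) + 1 + α) :
    ∃ C : ℝ≥0∞, C ≠ ∞ ∧ ∀ z ∈ ball n,
      ∫⁻ w, ENNReal.ofReal (‖1 - inner ℂ z w‖ ^ (-((n : ℝ) + 1 + α))) *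
        ENNReal.ofReal ((1 - ‖w‖ ^ 2) ^ (-t)) ∂(va n α) ≤
      C * ENNReal.ofReal ((1 - ‖z‖ ^ 2) ^ (-t)) := by
  have hβ : -1 < α - t := by linarith
  obtain ⟨M, hM⟩ := exists_integral_norm_cpow_le (α := α - t) hn hβ
    (a := ((n : ℝ) + 1 + α - 2 * t) / 2) (by linarith) (by linarith)
  set Wα := weightMeasure n α Set.univ with hWα
  set Wβ := weightMeasure n (α - t) Set.univ with hWβ
  have hWα0 : Wα ≠ 0 := weightMeasure_univ_ne_zero n α
  have hWβ0 : Wβ ≠ 0 := weightMeasure_univ_ne_zero n _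
  have hWβt : Wβ ≠ ∞ := weightMeasure_univ_ne_top hn hβ
  refine ⟨Wα⁻¹ * Wβ * ENNReal.ofReal M, ENNReal.mul_ne_top (ENNReal.mul_ne_top
    (ENNReal.inv_ne_top.mpr hWα0) hWβt) ENNReal.ofReal_ne_top, fun z hz => ?_⟩
  have hδ := one_sub_sq_pos hz
  have e1 : ∫⁻ w, ENNReal.ofReal (‖1 - inner ℂ z w‖ ^ (-((n : ℝ) + 1 + α))) *
      ENNReal.ofReal ((1 - ‖w‖ ^ 2) ^ (-t)) ∂(va n α) = Wα⁻¹ * Wβ *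
      ∫⁻ w, ENNReal.ofReal (‖1 - inner ℂ z w‖ ^ (-((n : ℝ) + 1 + α))) ∂(va n (α - t)) := by
    rw [lintegral_va, lintegral_va, mul_assoc, ← mul_assoc Wβ, ENNReal.mul_inv_cancel hWβ0 hWβt,
      one_mul]
    congr 1
    refine setLIntegral_congr_fun Metric.isOpen_ball.measurableSet fun w hw => ?_
    have hw' := one_sub_sq_pos hw
    rw [sub_eq_add_neg α t, Real.rpow_add hw', ENNReal.ofReal_mul (by positivity)]
    ring
  have e2 : ∫⁻ w, ENNReal.ofReal (‖1 - inner ℂ z w‖ ^ (-((n : ℝ) + 1 + α))) ∂(va n (α - t)) =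
      ENNReal.ofReal ((1 - ‖z‖ ^ 2) ^ (-t)) *
      ∫⁻ u, ENNReal.ofReal (‖1 - inner ℂ z u‖ ^ (-(2 * (((n : ℝ) + 1 + α - 2 * t) / 2))))
        ∂(va n (α - t)) := by
    rw [lintegral_comp_phi hz, ← lintegral_const_mul' _ _ ENNReal.ofReal_ne_top]
    refine lintegral_congr_ae ?_
    filter_upwards [ae_mem_ball n (α - t)] with u hu
    have hN : 0 < ‖1 - inner ℂ z u‖ := norm_pos_iff.mpr (one_sub_inner_ne_zero hz hu)
    rw [← ENNReal.ofReal_mul (jac_pos hz hu).le, ← ENNReal.ofReal_mul (by positivity),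
      inner_phi_left hz hu, norm_div, Complex.norm_real, Real.norm_of_nonneg hδ.le, jac]
    congr 1
    have e3 : (‖1 - inner ℂ z u‖ ^ 2) = ‖1 - inner ℂ z u‖ ^ (2 : ℝ) := by norm_cast
    rw [e3, Real.div_rpow hδ.le (by positivity), Real.div_rpow hδ.le hN.le,
      ← Real.rpow_mul hN.le, div_mul_div_comm, ← Real.rpow_add hδ, ← Real.rpow_add hN,
      div_eq_mul_inv, ← Real.rpow_neg hN.le]
    congr 2 <;> ring
  have e4 : ∫⁻ u, ENNReal.ofReal (‖1 - inner ℂ z u‖ ^ (-(2 * (((n : ℝ) + 1 + α - 2 * t) / 2))))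
        ∂(va n (α - t)) ≤ ENNReal.ofReal M := by
    rw [← ofReal_integral_eq_lintegral_ofReal]
    · exact ENNReal.ofReal_le_ofReal (hM z hz)
    · refine integrable_of_continuousOn_of_bound ?_
        ((1 - ‖z‖) ^ (-(2 * (((n : ℝ) + 1 + α - 2 * t) / 2)))) fun u hu => ?_
      · refine ContinuousOn.rpow_const (by fun_prop) fun u hu => Or.inl ?_
        exact norm_ne_zero_iff.mpr (one_sub_inner_ne_zero hz hu)
      · rw [Real.norm_of_nonneg (by positivity)]
        refine Real.rpow_le_rpow_of_nonpos ?_ (norm_one_sub_inner_ge hu) (by linarith)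
        linarith [norm_lt_one_of_mem hz]
    · exact Eventually.of_forall fun u => by positivity
  rw [e1, e2, mul_assoc (Wα⁻¹ * Wβ), mul_comm (ENNReal.ofReal M)]
  gcongr

end ForelliRudin

/-! ### Schur's test -/

section Schur

/-- **Schur's test** for a symmetric positive kernel. -/
theorem schur_test {X : Type*} [MeasurableSpace X] {μ : Measure X} [SFinite μ] {p q : ℝ}
    (hpq : p.HolderConjugate q) {k : X → X → ℝ≥0∞} (hk : Measurable (Function.uncurry k))
    (hsymm : ∀ x y, k x y = k y x) {h : X → ℝ≥0∞} (hh : Measurable h) (hh0 : ∀ᵐ x ∂μ, h x ≠ 0)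
    (hht : ∀ᵐ x ∂μ, h x ≠ ∞) {C : ℝ≥0∞}
    (hCp : ∀ᵐ x ∂μ, ∫⁻ y, k x y * h y ^ p ∂μ ≤ C * h x ^ p)
    (hCq : ∀ᵐ x ∂μ, ∫⁻ y, k x y * h y ^ q ∂μ ≤ C * h x ^ q)
    {f : X → ℝ≥0∞} (hf : Measurable f) :
    ∫⁻ x, (∫⁻ y, k x y * f y ∂μ) ^ p ∂μ ≤ C ^ p * ∫⁻ x, f x ^ p ∂μ := by
  have hp0 := hpq.pos
  have hq0 := hpq.symm.pos
  have hkx : ∀ x, Measurable (k x) := fun x => hk.comp measurable_prodMk_left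
  have step : ∀ᵐ x ∂μ, (∫⁻ y, k x y * f y ∂μ) ^ p ≤
      C ^ (p / q) * ∫⁻ y, h x ^ p * (k x y * (f y * (h y)⁻¹) ^ p) ∂μ := by
    filter_upwards [hCq] with x hx
    have e : ∫⁻ y, k x y * f y ∂μ = ∫⁻ y, ((fun y => k x y ^ (1 / p) * (f y * (h y)⁻¹)) *
        (fun y => k x y ^ (1 / q) * h y)) y ∂μ := by
      refine lintegral_congr_ae ?_
      filter_upwards [hh0, hht] with y h0 ht
      simp only [Pi.mul_apply]
      have e1 : k x y ^ (1 / p) * k x y ^ (1 / q) = k x y := by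
        rw [← ENNReal.rpow_add_of_nonneg _ _ (by positivity) (by positivity), one_div, one_div,
          hpq.inv_add_inv_eq_one, ENNReal.rpow_one]
      have e2 : (h y)⁻¹ * h y = 1 := ENNReal.inv_mul_cancel h0 ht
      calc k x y * f y = (k x y ^ (1 / p) * k x y ^ (1 / q)) * (f y * ((h y)⁻¹ * h y)) := by
            rw [e1, e2, mul_one]
        _ = _ := by ring
    have holder := ENNReal.lintegral_mul_le_Lp_mul_Lq μ hpq
      (f := fun y => k x y ^ (1 / p) * (f y * (h y)⁻¹)) (g := fun y => k x y ^ (1 / q) * h y)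
      (((hkx x).pow_const _).mul (hf.mul hh.inv)).aemeasurable
      (((hkx x).pow_const _).mul hh).aemeasurable
    have e3 : ∀ y, (k x y ^ (1 / p) * (f y * (h y)⁻¹)) ^ p = k x y * (f y * (h y)⁻¹) ^ p := by
      intro y
      rw [ENNReal.mul_rpow_of_nonneg _ _ hp0.le, ← ENNReal.rpow_mul, one_div_mul_cancel hp0.ne',
        ENNReal.rpow_one]
    have e4 : ∀ y, (k x y ^ (1 / q) * h y) ^ q = k x y * h y ^ q := by
      intro y
      rw [ENNReal.mul_rpow_of_nonneg _ _ hq0.le, ← ENNReal.rpow_mul, one_div_mul_cancel hq0.ne',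
        ENNReal.rpow_one]
    simp only [e3, e4] at holder
    rw [e]
    calc (∫⁻ y, ((fun y => k x y ^ (1 / p) * (f y * (h y)⁻¹)) *
          (fun y => k x y ^ (1 / q) * h y)) y ∂μ) ^ p
        ≤ ((∫⁻ y, k x y * (f y * (h y)⁻¹) ^ p ∂μ) ^ (1 / p) * (C * h x ^ q) ^ (1 / q)) ^ p := by
          gcongr
          exact holder.trans (by gcongr)
      _ = C ^ (p / q) * (h x ^ p * ∫⁻ y, k x y * (f y * (h y)⁻¹) ^ p ∂μ) := by
          rw [ENNReal.mul_rpow_of_nonneg _ _ hp0.le, ← ENNReal.rpow_mul,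
            one_div_mul_cancel hp0.ne', ENNReal.rpow_one, ← ENNReal.rpow_mul,
            one_div_mul_eq_div, ENNReal.mul_rpow_of_nonneg _ _ (by positivity),
            ← ENNReal.rpow_mul, mul_div_cancel₀ _ hq0.ne']
          ring
      _ = _ := by
          rw [lintegral_const_mul]
          exact (hkx x).mul ((hf.mul hh.inv).pow_const _)
  have hm : Measurable (fun z : X × X => h z.1 ^ p * (k z.1 z.2 * (f z.2 * (h z.2)⁻¹) ^ p)) := by
    have h1 : Measurable (fun z : X × X => h z.1) := hh.comp measurable_fst
    have h2 : Measurable (fun z : X × X => h z.2) := hh.comp measurable_snd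
    have h3 : Measurable (fun z : X × X => f z.2) := hf.comp measurable_snd
    exact (h1.pow_const _).mul (hk.mul ((h3.mul h2.inv).pow_const _))
  calc ∫⁻ x, (∫⁻ y, k x y * f y ∂μ) ^ p ∂μ
      ≤ ∫⁻ x, C ^ (p / q) * ∫⁻ y, h x ^ p * (k x y * (f y * (h y)⁻¹) ^ p) ∂μ ∂μ :=
        lintegral_mono_ae step
    _ = C ^ (p / q) * ∫⁻ x, ∫⁻ y, h x ^ p * (k x y * (f y * (h y)⁻¹) ^ p) ∂μ ∂μ :=
        lintegral_const_mul _ hm.lintegral_prod_right'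
    _ = C ^ (p / q) * ∫⁻ y, ∫⁻ x, h x ^ p * (k x y * (f y * (h y)⁻¹) ^ p) ∂μ ∂μ := by
        rw [lintegral_lintegral_swap hm.aemeasurable]
    _ ≤ C ^ (p / q) * ∫⁻ y, C * f y ^ p ∂μ := by
        refine mul_le_mul' le_rfl (lintegral_mono_ae ?_)
        filter_upwards [hCp, hh0, hht] with y hy h0 ht
        calc ∫⁻ x, h x ^ p * (k x y * (f y * (h y)⁻¹) ^ p) ∂μ
            = ∫⁻ x, (f y * (h y)⁻¹) ^ p * (k y x * h x ^ p) ∂μ := by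
              refine lintegral_congr fun x => ?_
              rw [hsymm x y]; ring
          _ = (f y * (h y)⁻¹) ^ p * ∫⁻ x, k y x * h x ^ p ∂μ :=
              lintegral_const_mul _ ((hkx y).mul (hh.pow_const _))
          _ ≤ (f y * (h y)⁻¹) ^ p * (C * h y ^ p) := by gcongr
          _ = C * (f y * (h y)⁻¹ * h y) ^ p := by
              rw [ENNReal.mul_rpow_of_nonneg _ _ hp0.le, ENNReal.mul_rpow_of_nonneg _ _ hp0.le,
                ENNReal.mul_rpow_of_nonneg _ _ hp0.le]
              ring
          _ = C * f y ^ p := by rw [mul_assoc, ENNReal.inv_mul_cancel h0 ht, mul_one]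
    _ = C ^ p * ∫⁻ x, f x ^ p ∂μ := by
        rw [lintegral_const_mul _ (hf.pow_const _), ← mul_assoc]
        congr 1
        conv_lhs => rw [← ENNReal.rpow_one C, ← ENNReal.rpow_mul]
        rw [← ENNReal.rpow_add_of_nonneg _ _ (by positivity) zero_le_one]
        congr 1
        have := hpq.div_conj_eq_sub_one
        linarith

end Schur

section BergmanKernelBound

variable {n : ℕ} {α : ℝ}

/-- The maximal Bergman operator, with kernel `|1 - z̄ w|^{-(n+1+α)}`, is bounded on `L^p_α`. -/
theorem exists_bergman_bound (hn : 1 ≤ n) (hα : -1 < α) {p q : ℝ} (hpq : p.HolderConjugate q) :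
    ∃ C : ℝ≥0∞, C ≠ ∞ ∧ ∀ f : Cn n → ℝ≥0∞, Measurable f →
      ∫⁻ z, (∫⁻ w, ENNReal.ofReal (‖1 - inner ℂ z w‖ ^ (-((n : ℝ) + 1 + α))) * f w ∂(va n α)) ^ p
        ∂(va n α) ≤ C * ∫⁻ w, f w ^ p ∂(va n α) := by
  have hp := hpq.lt
  have hq := hpq.symm.lt
  have hp0 := hpq.pos
  have hq0 := hpq.symm.pos
  have hn' : (0 : ℝ) ≤ n := n.cast_nonneg
  set τ : ℝ := (1 + α) / (2 * p * q) with hτ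
  have e1 : τ * p = (1 + α) / (2 * q) := by rw [hτ]; field_simp
  have e2 : τ * q = (1 + α) / (2 * p) := by rw [hτ]; field_simp
  have hb : ∀ r : ℝ, 1 < r → 0 < (1 + α) / (2 * r) ∧ (1 + α) / (2 * r) < (1 + α) / 2 := by
    intro r hr
    refine ⟨div_pos (by linarith) (by linarith), ?_⟩
    exact div_lt_div_of_pos_left (by linarith) two_pos (by linarith)
  have hb1 := hb q hq
  have hb2 := hb p hp
  rw [← e1] at hb1
  rw [← e2] at hb2
  obtain ⟨C₁, hC₁, H₁⟩ := exists_lintegral_kernel_le (α := α) hn hb1.1 (by linarith) (by linarith)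
  obtain ⟨C₂, hC₂, H₂⟩ := exists_lintegral_kernel_le (α := α) hn hb2.1 (by linarith) (by linarith)
  have hpow : ∀ r : ℝ, 0 ≤ r → ∀ w ∈ ball n, ENNReal.ofReal ((1 - ‖w‖ ^ 2) ^ (-τ)) ^ r =
      ENNReal.ofReal ((1 - ‖w‖ ^ 2) ^ (-(τ * r))) := by
    intro r hr w hw
    have := one_sub_sq_pos hw
    rw [ENNReal.ofReal_rpow_of_nonneg (by positivity) hr, ← Real.rpow_mul this.le, neg_mul]
  refine ⟨max C₁ C₂ ^ p, ENNReal.rpow_ne_top_of_nonneg hp0.le (max_lt hC₁.lt_top hC₂.lt_top).ne,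
    fun f hf => ?_⟩
  refine schur_test (h := fun w => ENNReal.ofReal ((1 - ‖w‖ ^ 2) ^ (-τ))) hpq ?_ ?_ ?_ ?_ ?_ ?_ ?_ hf
  · have hi : Continuous (fun x : Cn n × Cn n => inner ℂ x.1 x.2) := by fun_prop
    exact ((((continuous_const.sub hi).norm).measurable).pow_const _).ennreal_ofReal
  · intro x y
    have : ‖1 - inner ℂ x y‖ = ‖1 - inner ℂ y x‖ := by
      rw [← RCLike.norm_conj]; simp
    rw [this]
  · fun_prop
  · filter_upwards [ae_mem_ball n α] with w hw
    have := Real.rpow_pos_of_pos (one_sub_sq_pos hw) (-τ)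
    simpa using this
  · exact Eventually.of_forall fun _ => ENNReal.ofReal_ne_top
  · filter_upwards [ae_mem_ball n α] with z hz
    rw [hpow p hp0.le z hz]
    refine le_trans (le_of_eq (lintegral_congr_ae ?_)) ((H₁ z hz).trans (by gcongr; exact le_max_left _ _))
    filter_upwards [ae_mem_ball n α] with w hw
    rw [hpow p hp0.le w hw]
  · filter_upwards [ae_mem_ball n α] with z hz
    rw [hpow q hq0.le z hz]
    refine le_trans (le_of_eq (lintegral_congr_ae ?_)) ((H₂ z hz).trans (by gcongr; exact le_max_right _ _))
    filter_upwards [ae_mem_ball n α] with w hw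
    rw [hpow q hq0.le w hw]

end BergmanKernelBound

/-! ### Elements of the Bergman space and their representatives -/

section Representatives

variable {n d : ℕ} {α : ℝ} {p : ℝ≥0∞} [Fact (1 ≤ p)]

theorem rep_differentiableOn (f : A n d α p) : DifferentiableOn ℂ (rep f) (ball n) :=
  (Classical.choose_spec f.2).1

theorem rep_ae_eq (f : A n d α p) : (f : Lp (Cd d p) p (va n α)) =ᵐ[va n α] rep f :=
  (Classical.choose_spec f.2).2

theorem rep_continuousOn (f : A n d α p) : ContinuousOn (rep f) (ball n) :=
  (rep_differentiableOn f).continuousOn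

theorem rep_memLp (f : A n d α p) : MemLp (rep f) p (va n α) :=
  (memLp_congr_ae (rep_ae_eq f)).mp (Lp.memLp _)

theorem enorm_eq_eLpNorm_rep (f : A n d α p) : ‖f‖ₑ = eLpNorm (rep f) p (va n α) := by
  rw [← eLpNorm_congr_ae (rep_ae_eq f), ← Lp.enorm_def]
  rfl

theorem norm_eq_eLpNorm_rep (f : A n d α p) : ‖f‖ = (eLpNorm (rep f) p (va n α)).toReal := by
  rw [← enorm_eq_eLpNorm_rep, toReal_enorm]

/-- The element of `A^p_α` given by a holomorphic function in `L^p`. -/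
def ofHolo (F : Cn n → Cd d p) (hF : DifferentiableOn ℂ F (ball n))
    (hL : MemLp F p (va n α)) : A n d α p :=
  ⟨hL.toLp F, F, hF, MemLp.coeFn_toLp hL⟩

variable [hn : Fact (1 ≤ n)] [hα : Fact (-1 < α)]

instance : IsProbabilityMeasure (va n α) := isProbabilityMeasure_va hn.out hα.out

theorem eqOn_of_ae_eq {E : Type*} [NormedAddCommGroup E] {F G : Cn n → E}
    (hF : ContinuousOn F (ball n)) (hG : ContinuousOn G (ball n)) (h : F =ᵐ[va n α] G) :
    Set.EqOn F G (ball n) :=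
  Measure.eqOn_open_of_ae_eq
    ((restrict_absolutelyContinuous_va hn.out hα.out).ae_eq h) Metric.isOpen_ball hF hG

theorem rep_eqOn {f : A n d α p} {F : Cn n → Cd d p} (hF : ContinuousOn F (ball n))
    (h : (f : Lp (Cd d p) p (va n α)) =ᵐ[va n α] F) : Set.EqOn (rep f) F (ball n) :=
  eqOn_of_ae_eq (rep_continuousOn f) hF ((rep_ae_eq f).symm.trans h)

theorem rep_ofHolo {F : Cn n → Cd d p} (hF : DifferentiableOn ℂ F (ball n))
    (hL : MemLp F p (va n α)) : Set.EqOn (rep (ofHolo F hF hL)) F (ball n) :=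
  rep_eqOn hF.continuousOn (MemLp.coeFn_toLp hL)

theorem A_ext {f g : A n d α p} (h : Set.EqOn (rep f) (rep g) (ball n)) : f = g := by
  refine Subtype.ext (Lp.ext ?_)
  refine (rep_ae_eq f).trans (EventuallyEq.trans ?_ (rep_ae_eq g).symm)
  filter_upwards [ae_mem_ball n α] with w hw using h hw

theorem rep_add (f g : A n d α p) {w : Cn n} (hw : w ∈ ball n) :
    rep (f + g) w = rep f w + rep g w := by
  refine rep_eqOn (f := f + g) (F := fun w => rep f w + rep g w)
    ((rep_continuousOn f).add (rep_continuousOn g)) ?_ hw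
  rw [Submodule.coe_add]
  filter_upwards [Lp.coeFn_add (f : Lp (Cd d p) p (va n α)) (g : Lp (Cd d p) p (va n α)),
    rep_ae_eq f, rep_ae_eq g] with w h1 h2 h3
  rw [h1, Pi.add_apply, h2, h3]

theorem rep_sub (f g : A n d α p) {w : Cn n} (hw : w ∈ ball n) :
    rep (f - g) w = rep f w - rep g w := by
  have h := rep_add (f - g) g hw
  rw [sub_add_cancel] at h
  rw [h, add_sub_cancel_right]

theorem rep_smul (c : ℂ) (f : A n d α p) {w : Cn n} (hw : w ∈ ball n) :
    rep (c • f) w = c • rep f w := by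
  refine rep_eqOn (f := c • f) (F := fun w => c • rep f w)
    ((rep_continuousOn f).const_smul c) ?_ hw
  rw [Submodule.coe_smul]
  filter_upwards [Lp.coeFn_smul c (f : Lp (Cd d p) p (va n α)), rep_ae_eq f] with w h1 h2
  rw [h1, Pi.smul_apply, h2]

theorem rep_zero {w : Cn n} (hw : w ∈ ball n) : rep (0 : A n d α p) w = 0 := by
  have h := rep_add (0 : A n d α p) 0 hw
  rw [add_zero] at h
  exact left_eq_add.mp h

theorem rep_integrable (f : A n d α p) : Integrable (rep f) (va n α) :=
  (rep_memLp f).integrable Fact.out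

end Representatives

/-! ### The pairing -/

section Pairing

variable {n d : ℕ} {α : ℝ} {p q : ℝ≥0∞} [Fact (1 ≤ p)] [Fact (1 ≤ q)]

theorem norm_sum_mul_conj_le (x : Cd d p) (y : Cd d q) :
    ‖∑ i, x i * (starRingEnd ℂ) (y i)‖ ≤ d * (‖x‖ * ‖y‖) := by
  refine (norm_sum_le _ _).trans ?_
  calc ∑ i, ‖x i * (starRingEnd ℂ) (y i)‖ ≤ ∑ _i : Fin d, ‖x‖ * ‖y‖ := by
        refine Finset.sum_le_sum fun i _ => ?_
        rw [norm_mul, RCLike.norm_conj]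
        exact mul_le_mul (PiLp.norm_apply_le x i) (PiLp.norm_apply_le y i) (norm_nonneg _)
          (norm_nonneg _)
    _ = d * (‖x‖ * ‖y‖) := by simp

theorem aestronglyMeasurable_pairing_integrand {F : Cn n → Cd d p} {G : Cn n → Cd d q}
    {μ : Measure (Cn n)} (hF : AEStronglyMeasurable F μ) (hG : AEStronglyMeasurable G μ) :
    AEStronglyMeasurable (fun w => ∑ i, F w i * (starRingEnd ℂ) (G w i)) μ := by
  refine Finset.aestronglyMeasurable_fun_sum _ fun i _ => AEStronglyMeasurable.mul ?_ ?_
  · exact (PiLp.continuous_apply p _ i).comp_aestronglyMeasurable hF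
  · exact Complex.continuous_conj.comp_aestronglyMeasurable
      ((PiLp.continuous_apply q _ i).comp_aestronglyMeasurable hG)

theorem pairing_conj (f : A n d α p) (g : A n d α q) :
    (starRingEnd ℂ) (pairing f g) = pairing g f := by
  unfold pairing
  rw [← integral_conj]
  congr 1
  funext w
  simp [mul_comm]

theorem pairing_congr [Fact (1 ≤ n)] [Fact (-1 < α)] {f : A n d α p} {g : A n d α q} {F : Cn n → Cd d p} {G : Cn n → Cd d q}
    (hF : Set.EqOn (rep f) F (ball n)) (hG : Set.EqOn (rep g) G (ball n)) :
    pairing f g = ∫ w, ∑ i, F w i * (starRingEnd ℂ) (G w i) ∂(va n α) := by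
  unfold pairing
  refine integral_congr_ae ?_
  filter_upwards [ae_mem_ball n α] with w hw
  rw [hF hw, hG hw]

theorem pairing_smul_left [Fact (1 ≤ n)] [Fact (-1 < α)] (c : ℂ) (f : A n d α p) (h : A n d α q) :
    pairing (c • f) h = c * pairing f h := by
  unfold pairing
  rw [← integral_const_mul]
  refine integral_congr_ae ?_
  filter_upwards [ae_mem_ball n α] with w hw
  rw [rep_smul _ _ hw, Finset.mul_sum]
  simp [mul_assoc]

theorem pairing_smul_right [Fact (1 ≤ n)] [Fact (-1 < α)] (c : ℂ) (f : A n d α p) (h : A n d α q) :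
    pairing f (c • h) = (starRingEnd ℂ) c * pairing f h := by
  rw [← pairing_conj, pairing_smul_left, map_mul, pairing_conj]

variable [p.HolderConjugate q]

theorem integrable_norm_mul_norm {F : Cn n → Cd d p} {G : Cn n → Cd d q}
    (hF : MemLp F p (va n α)) (hG : MemLp G q (va n α)) :
    Integrable (fun w => ‖F w‖ * ‖G w‖) (va n α) :=
  hF.norm.integrable_mul hG.norm

theorem integrable_pairing {F : Cn n → Cd d p} {G : Cn n → Cd d q}
    (hF : MemLp F p (va n α)) (hG : MemLp G q (va n α)) :
    Integrable (fun w => ∑ i, F w i * (starRingEnd ℂ) (G w i)) (va n α) := by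
  refine ((integrable_norm_mul_norm hF hG).const_mul (d : ℝ)).mono'
    (aestronglyMeasurable_pairing_integrand hF.1 hG.1) ?_
  exact Eventually.of_forall fun w => norm_sum_mul_conj_le _ _

theorem norm_integral_pairing_le {F : Cn n → Cd d p} {G : Cn n → Cd d q}
    (hF : MemLp F p (va n α)) (hG : MemLp G q (va n α)) :
    ‖∫ w, ∑ i, F w i * (starRingEnd ℂ) (G w i) ∂(va n α)‖ ≤
      d * ((eLpNorm F p (va n α)).toReal * (eLpNorm G q (va n α)).toReal) := by
  have h1 : ‖∫ w, ∑ i, F w i * (starRingEnd ℂ) (G w i) ∂(va n α)‖ ≤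
      ∫ w, d * (‖F w‖ * ‖G w‖) ∂(va n α) :=
    norm_integral_le_of_norm_le ((integrable_norm_mul_norm hF hG).const_mul (d : ℝ))
      (Eventually.of_forall fun w => norm_sum_mul_conj_le _ _)
  refine h1.trans ?_
  rw [integral_const_mul]
  refine mul_le_mul_of_nonneg_left ?_ (Nat.cast_nonneg d)
  have h2 : ∫ w, ‖F w‖ * ‖G w‖ ∂(va n α) =
      (eLpNorm ((fun w => ‖F w‖) • (fun w => ‖G w‖)) 1 (va n α)).toReal := by
    rw [eLpNorm_one_eq_lintegral_enorm, ← integral_norm_eq_lintegral_enorm]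
    · simp
    · exact (integrable_norm_mul_norm hF hG).1
  rw [h2, ← ENNReal.toReal_mul, ← eLpNorm_norm F, ← eLpNorm_norm G]
  refine ENNReal.toReal_mono (ENNReal.mul_ne_top hF.norm.2.ne hG.norm.2.ne) ?_
  exact eLpNorm_smul_le_mul_eLpNorm hG.norm.1 hF.norm.1

theorem norm_pairing_le (f : A n d α p) (g : A n d α q) : ‖pairing f g‖ ≤ d * (‖f‖ * ‖g‖) := by
  rw [norm_eq_eLpNorm_rep, norm_eq_eLpNorm_rep]
  exact norm_integral_pairing_le (rep_memLp f) (rep_memLp g)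

theorem integrable_pairing_rep (f : A n d α p) (g : A n d α q) :
    Integrable (fun w => ∑ i, rep f w i * (starRingEnd ℂ) (rep g w i)) (va n α) :=
  integrable_pairing (rep_memLp f) (rep_memLp g)

variable [hn : Fact (1 ≤ n)] [hα : Fact (-1 < α)]

theorem pairing_add_left (f g : A n d α p) (h : A n d α q) :
    pairing (f + g) h = pairing f h + pairing g h := by
  unfold pairing
  rw [← integral_add (integrable_pairing_rep f h) (integrable_pairing_rep g h)]
  refine integral_congr_ae ?_
  filter_upwards [ae_mem_ball n α] with w hw
  rw [rep_add _ _ hw, ← Finset.sum_add_distrib]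
  simp [add_mul]

theorem pairing_add_right (f : A n d α p) (g h : A n d α q) :
    pairing f (g + h) = pairing f g + pairing f h := by
  rw [← pairing_conj, pairing_add_left, map_add, pairing_conj, pairing_conj]

/-- The bounded linear functional `f ↦ ⟨f, g⟩`. -/
def pairingL (g : A n d α q) : A n d α p →L[ℂ] ℂ :=
  LinearMap.mkContinuous
    { toFun := fun f => pairing f g
      map_add' := fun f h => pairing_add_left f h g
      map_smul' := fun c f => pairing_smul_left c f g } (d * ‖g‖) fun f => by
    refine (norm_pairing_le f g).trans (le_of_eq ?_)
    ring

@[simp] theorem pairingL_apply (f : A n d α p) (g : A n d α q) : pairingL g f = pairing f g := rfl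

theorem norm_pairingL_le (g : A n d α q) : ‖(pairingL g : A n d α p →L[ℂ] ℂ)‖ ≤ d * ‖g‖ :=
  LinearMap.mkContinuous_norm_le _ (by positivity) _

theorem pairing_sub_left (f g : A n d α p) (h : A n d α q) :
    pairing (f - g) h = pairing f h - pairing g h :=
  (pairingL h).map_sub f g

theorem pairing_sub_right (f : A n d α p) (g h : A n d α q) :
    pairing f (g - h) = pairing f g - pairing f h := by
  rw [← pairing_conj, pairing_sub_left, map_sub, pairing_conj, pairing_conj]

end Pairing

/-! ### Reproducing kernels -/

section Kernels

variable {n d : ℕ} {α : ℝ} {p q : ℝ≥0∞} [Fact (1 ≤ p)] [Fact (1 ≤ q)]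

/-- The function `w ↦ (1 - z̄ w)^{-(n+1+α)} v`. -/
def kernFun (α : ℝ) (p : ℝ≥0∞) (z : Bn n) (v : Fin d → ℂ) (w : Cn n) : Cd d p :=
  ((1 - inner ℂ (z : Cn n) w) ^ (((n : ℝ) + 1 + α : ℝ) : ℂ))⁻¹ • WithLp.toLp p v

/-- The power `(1 - |z|²)^{(n+1+α)/r}`, which normalises kernels and weighted compositions. -/
def wt (α : ℝ) (r : ℝ≥0∞) (z : Cn n) : ℝ := (1 - ‖z‖ ^ 2) ^ (((n : ℝ) + 1 + α) / r.toReal)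

theorem wt_pos (α : ℝ) (r : ℝ≥0∞) {z : Cn n} (hz : z ∈ ball n) : 0 < wt α r z :=
  Real.rpow_pos_of_pos (one_sub_sq_pos hz) _

theorem wt_ne_zero (α : ℝ) (r : ℝ≥0∞) {z : Cn n} (hz : z ∈ ball n) : ((wt α r z : ℝ) : ℂ) ≠ 0 := by
  exact_mod_cast (wt_pos α r hz).ne'

theorem kernelFun_eq (z : Bn n) (v : Fin d → ℂ) (w : Cn n) :
    kernelFun α p q z v w = ((wt α q (z : Cn n) : ℝ) : ℂ) • kernFun α p z v w := by
  rw [kernelFun, kernFun, smul_smul, div_eq_mul_inv]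
  rfl

/-- The reproducing kernel `(1 - z̄ w)^{-(n+1+α)} v` as an element of `A^p_α`. -/
def kern (α : ℝ) (p : ℝ≥0∞) [Fact (1 ≤ p)] (z : Bn n) (v : Fin d → ℂ) : A n d α p :=
  (((wt α p (z : Cn n) : ℝ) : ℂ))⁻¹ • kernel α p p z v

theorem exponent_pos (n : ℕ) (α : ℝ) [hα : Fact (-1 < α)] :
    0 < (n : ℝ) + 1 + α := by
  have : (0 : ℝ) ≤ n := n.cast_nonneg
  have := hα.out
  linarith

variable [hn : Fact (1 ≤ n)] [hα : Fact (-1 < α)]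

theorem rep_kernel (z : Bn n) (v : Fin d → ℂ) {w : Cn n} (hw : w ∈ ball n) :
    rep (kernel α p q z v) w = kernelFun α p q z v w := by
  refine rep_eqOn (f := kernel α p q z v) (F := kernelFun α p q z v)
    (kernelFun_differentiableOn α p q z v).continuousOn ?_ hw
  have h : (kernel α p q z v : Lp (Cd d p) p (va n α)) =
    (kernelFun_memLp α p q z v).toLp (kernelFun α p q z v) := rfl
  rw [h]
  exact MemLp.coeFn_toLp _

theorem rep_kern (z : Bn n) (v : Fin d → ℂ) {w : Cn n} (hw : w ∈ ball n) :
    rep (kern α p z v) w = kernFun α p z v w := by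
  rw [kern, rep_smul _ _ hw, rep_kernel z v hw, kernelFun_eq, smul_smul,
    inv_mul_cancel₀ (wt_ne_zero α p z.2), one_smul]

theorem kernel_eq_smul_kern (z : Bn n) (v : Fin d → ℂ) :
    kernel α p q z v = ((wt α q (z : Cn n) : ℝ) : ℂ) • kern α p z v := by
  refine A_ext fun w hw => ?_
  rw [rep_smul _ _ hw, rep_kern z v hw, rep_kernel z v hw, kernelFun_eq]

theorem reproducing_rep (f : A n d α p) {z : Cn n} (hz : z ∈ ball n) :
    ∫ w, ((1 - inner ℂ w z) ^ (((n : ℝ) + 1 + α : ℝ) : ℂ))⁻¹ • rep f w ∂(va n α) = rep f z :=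
  reproducing hn.out hα.out (rep_differentiableOn f) (rep_integrable f) hz

theorem integral_kernel_apply {F : Cn n → Cd d p} (hF : Integrable F (va n α)) {z : Cn n}
    (hz : z ∈ ball n) (i : Fin d) :
    (∫ w, ((1 - inner ℂ w z) ^ (((n : ℝ) + 1 + α : ℝ) : ℂ))⁻¹ • F w ∂(va n α)) i =
      ∫ w, ((1 - inner ℂ w z) ^ (((n : ℝ) + 1 + α : ℝ) : ℂ))⁻¹ * F w i ∂(va n α) := by
  have h := integrable_cpow_inv_smul hF hz (exponent_pos n α)
  exact ((PiLp.proj p (fun _ : Fin d => ℂ) i : Cd d p →L[ℂ] ℂ).integral_comp_comm h).symm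

theorem pairing_kern (f : A n d α p) (z : Bn n) (v : Fin d → ℂ) :
    pairing f (kern α q z v) = ∑ i, rep f z i * (starRingEnd ℂ) (v i) := by
  rw [pairing_congr (fun _ _ => rfl) (fun w hw => rep_kern z v hw)]
  have h := integrable_cpow_inv_smul (rep_integrable f) z.2 (exponent_pos n α)
  have e : ∀ᵐ w ∂(va n α), ∑ i, rep f w i * (starRingEnd ℂ) (kernFun α q z v w i) =
      ∑ i, (((1 - inner ℂ w (z : Cn n)) ^ (((n : ℝ) + 1 + α : ℝ) : ℂ))⁻¹ * rep f w i) *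
        (starRingEnd ℂ) (v i) := by
    filter_upwards [ae_mem_ball n α] with w hw
    refine Finset.sum_congr rfl fun i _ => ?_
    simp only [kernFun, PiLp.smul_apply, smul_eq_mul, map_mul]
    rw [conj_cpow_inv z.2 hw]
    ring
  rw [integral_congr_ae e, integral_finsetSum]
  · refine Finset.sum_congr rfl fun i _ => ?_
    rw [integral_mul_const, ← integral_kernel_apply (rep_integrable f) z.2, reproducing_rep f z.2]
  · intro i _
    refine Integrable.mul_const ?_ _
    exact (PiLp.proj p (fun _ : Fin d => ℂ) i : Cd d p →L[ℂ] ℂ).integrable_comp h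

theorem pairing_kern_single (f : A n d α p) (z : Bn n) (i : Fin d) :
    pairing f (kern α q z (Pi.single i 1)) = rep f z i := by
  rw [pairing_kern, Finset.sum_eq_single i]
  · simp
  · intro j _ hj; simp [hj]
  · simp

/-- Elements of `A^p_α` are determined by their pairings with kernels. -/
theorem ext_of_pairing_kern {f g : A n d α p}
    (h : ∀ (z : Bn n) (i : Fin d), pairing f (kern α q z (Pi.single i 1)) =
      pairing g (kern α q z (Pi.single i 1))) : f = g := by
  refine A_ext fun w hw => PiLp.ext fun i => ?_
  have := h ⟨w, hw⟩ i
  rwa [pairing_kern_single, pairing_kern_single] at this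

end Kernels

/-! ### The Bergman projection -/

section Projection

variable {n d : ℕ} {α : ℝ} {p : ℝ≥0∞} [Fact (1 ≤ p)]

/-- The Bergman projection of a function, as a function. -/
def projFun (α : ℝ) (F : Cn n → Cd d p) (z : Cn n) : Cd d p :=
  ∫ w, ((1 - inner ℂ w z) ^ (((n : ℝ) + 1 + α : ℝ) : ℂ))⁻¹ • F w ∂(va n α)

variable [hn : Fact (1 ≤ n)] [hα : Fact (-1 < α)]

theorem projFun_rep (f : A n d α p) {z : Cn n} (hz : z ∈ ball n) :
    projFun α (rep f) z = rep f z := reproducing_rep f hz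

theorem projFun_differentiableOn {F : Cn n → Cd d p} (hF : Integrable F (va n α)) :
    DifferentiableOn ℂ (projFun α F) (ball n) := by
  intro z₀ hz₀
  set s : ℝ := (n : ℝ) + 1 + α with hs
  have hs0 : 0 < s := exponent_pos n α
  obtain ⟨r, hr0, hr1⟩ := exists_between (norm_lt_one_of_mem hz₀)
  have hr : r < 1 := hr1
  have hnhds : Metric.ball (0 : Cn n) r ∈ 𝓝 z₀ :=
    Metric.isOpen_ball.mem_nhds (by simpa using hr0)
  have hsub : Metric.ball (0 : Cn n) r ⊆ ball n := Metric.ball_subset_ball hr.le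
  let L : Cn n → Cn n → (Cn n →L[ℂ] ℂ) := fun z w =>
    ((s : ℂ) * ((1 - inner ℂ w z) ^ ((s + 1 : ℝ) : ℂ))⁻¹) • innerSL ℂ w
  have hderiv : ∀ w ∈ ball n, ∀ z ∈ Metric.ball (0 : Cn n) r,
      HasFDerivAt (fun z => ((1 - inner ℂ w z) ^ (s : ℂ))⁻¹) (L z w) z := by
    intro w hw z hz
    have hre := one_sub_inner_re_pos hw (hsub hz)
    have h1 : HasFDerivAt (fun z : Cn n => 1 - inner ℂ w z) (-(innerSL ℂ w)) z :=
      (innerSL ℂ w).hasFDerivAt.const_sub 1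
    have h2 : HasDerivAt (fun x : ℂ => x ^ (-(s : ℂ))) (-(s : ℂ) * (1 - inner ℂ w z) ^ (-(s : ℂ) - 1))
        (1 - inner ℂ w z) := by
      simpa using (hasDerivAt_id (1 - inner ℂ w z)).cpow_const (c := -(s : ℂ)) (Or.inl hre)
    have h3 := h2.comp_hasFDerivAt z h1
    simp only [Function.comp_def, Complex.cpow_neg] at h3
    refine h3.congr_fderiv ?_
    have e : -(s : ℂ) - 1 = -((s + 1 : ℝ) : ℂ) := by push_cast; ring
    rw [e, Complex.cpow_neg]
    simp [L]
  have hbound : ∀ w ∈ ball n, ∀ z ∈ Metric.ball (0 : Cn n) r,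
      ‖(L z w).smulRight (F w)‖ ≤ s * ((1 - r) ^ (s + 1))⁻¹ * ‖F w‖ := by
    intro w hw z hz
    have hzr : ‖z‖ < r := by simpa using hz
    rw [ContinuousLinearMap.norm_smulRight_apply]
    refine mul_le_mul_of_nonneg_right ?_ (norm_nonneg _)
    simp only [L]
    rw [norm_smul, norm_mul, Complex.norm_real, Real.norm_of_nonneg hs0.le, innerSL_apply_norm,
      norm_inv, Complex.norm_cpow_real]
    have h1 : 1 - r ≤ ‖1 - inner ℂ w z‖ := by
      have h2 := norm_sub_norm_le (1 : ℂ) (inner ℂ w z)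
      have h3 := norm_inner_le_norm (𝕜 := ℂ) w z
      have := (norm_lt_one_of_mem hw).le
      rw [norm_one] at h2
      nlinarith [norm_nonneg z, norm_nonneg w]
    have h2 : (‖1 - inner ℂ w z‖ ^ (s + 1))⁻¹ ≤ ((1 - r) ^ (s + 1))⁻¹ :=
      inv_anti₀ (Real.rpow_pos_of_pos (by linarith) _)
        (Real.rpow_le_rpow (by linarith) h1 (by linarith))
    have h3 : 0 ≤ ((1 - r) ^ (s + 1))⁻¹ := le_trans (by positivity) h2
    calc _ ≤ s * ((1 - r) ^ (s + 1))⁻¹ * 1 := by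
          gcongr
          exact (norm_lt_one_of_mem hw).le
      _ = _ := mul_one _
  have key := hasFDerivAt_integral_of_dominated_of_fderiv_le (𝕜 := ℂ) (μ := va n α)
    (F := fun z w => ((1 - inner ℂ w z) ^ (s : ℂ))⁻¹ • F w)
    (F' := fun z w => (L z w).smulRight (F w))
    (bound := fun w => s * ((1 - r) ^ (s + 1))⁻¹ * ‖F w‖) hnhds ?_
    (integrable_cpow_inv_smul hF hz₀ hs0) ?_ ?_ (hF.norm.const_mul _) ?_
  · exact key.differentiableAt.differentiableWithinAt
  · filter_upwards [hnhds] with z hz using (integrable_cpow_inv_smul hF (hsub hz) hs0).1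
  · have h1 : AEStronglyMeasurable (fun w => L z₀ w) (va n α) := by
      refine aestronglyMeasurable_of_continuousOn ?_
      have hc : ContinuousOn (fun w : Cn n => innerSL ℂ w) (ball n) :=
        (innerSL ℂ (E := Cn n)).continuous.continuousOn
      refine ContinuousOn.fun_smul (ContinuousOn.fun_mul continuousOn_const
        (ContinuousOn.fun_inv₀ ?_ ?_)) hc
      · exact ContinuousOn.cpow_const (by fun_prop) fun u hu =>
          Or.inl (one_sub_inner_re_pos hu hz₀)
      · exact fun u hu => cpow_ne_zero_of_re_pos (one_sub_inner_re_pos hu hz₀) _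
    exact (ContinuousLinearMap.smulRightL ℂ (Cn n) (Cd d p)).aestronglyMeasurable_comp₂ h1 hF.1
  · filter_upwards [ae_mem_ball n α] with w hw z hz using hbound w hw z hz
  · filter_upwards [ae_mem_ball n α] with w hw z hz using (hderiv w hw z hz).smul_const (F w)

variable [Fact (1 < p)] [Fact (p < ∞)]

theorem p_ne_top (p : ℝ≥0∞) [h : Fact (p < ∞)] : p ≠ ∞ := h.out.ne

theorem p_ne_zero (p : ℝ≥0∞) [h : Fact (1 ≤ p)] : p ≠ 0 := (one_pos.trans_le h.out).ne'

theorem one_lt_toReal (p : ℝ≥0∞) [h : Fact (1 < p)] [h' : Fact (p < ∞)] : 1 < p.toReal := by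
  rw [← ENNReal.toReal_one]
  exact (ENNReal.toReal_lt_toReal ENNReal.one_ne_top h'.out.ne).mpr h.out

theorem exists_eLpNorm_projFun_le (n d : ℕ) (α : ℝ) (p : ℝ≥0∞) [Fact (1 ≤ p)]
    [hn : Fact (1 ≤ n)] [hα : Fact (-1 < α)] [Fact (1 < p)] [Fact (p < ∞)] :
    ∃ C : ℝ≥0∞, C ≠ ∞ ∧ ∀ F : Cn n → Cd d p, StronglyMeasurable F →
      eLpNorm (projFun α F) p (va n α) ≤ C * eLpNorm F p (va n α) := by
  have hp1 := one_lt_toReal p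
  obtain ⟨C, hC, H⟩ := exists_bergman_bound (n := n) (α := α) hn.out hα.out
    (Real.HolderConjugate.conjExponent hp1)
  refine ⟨C ^ (1 / p.toReal), ENNReal.rpow_ne_top_of_nonneg (by positivity) hC, fun F hF => ?_⟩
  rw [eLpNorm_eq_lintegral_rpow_enorm_toReal (p_ne_zero p) (p_ne_top p),
    eLpNorm_eq_lintegral_rpow_enorm_toReal (p_ne_zero p) (p_ne_top p),
    ← ENNReal.mul_rpow_of_nonneg _ _ (by positivity)]
  refine ENNReal.rpow_le_rpow (le_trans (lintegral_mono_ae ?_) (H (fun w => ‖F w‖ₑ) hF.enorm))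
    (by positivity)
  filter_upwards [ae_mem_ball n α] with z hz
  refine ENNReal.rpow_le_rpow ((enorm_integral_le_lintegral_enorm _).trans ?_) (by positivity)
  refine lintegral_mono_ae ?_
  filter_upwards [ae_mem_ball n α] with w hw
  have hN : ‖1 - inner ℂ w z‖ = ‖1 - inner ℂ z w‖ := by
    rw [← RCLike.norm_conj]; simp
  rw [enorm_smul, ← ofReal_norm, norm_inv, Complex.norm_cpow_real, hN,
    Real.rpow_neg (norm_nonneg _)]

theorem projFun_memLp {F : Cn n → Cd d p} (hF : MemLp F p (va n α)) :
    MemLp (projFun α F) p (va n α) := by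
  obtain ⟨C, hC, H⟩ := exists_eLpNorm_projFun_le n d α p
  refine ⟨aestronglyMeasurable_of_continuousOn
    (projFun_differentiableOn (hF.integrable Fact.out)).continuousOn, ?_⟩
  have e : projFun α F = projFun α (hF.1.mk F) := by
    funext z
    refine integral_congr_ae ?_
    filter_upwards [hF.1.ae_eq_mk] with w hw
    rw [hw]
  rw [e]
  refine (H _ hF.1.stronglyMeasurable_mk).trans_lt ?_
  rw [← eLpNorm_congr_ae hF.1.ae_eq_mk]
  exact ENNReal.mul_lt_top hC.lt_top hF.2

/-- The Bergman projection `L^p_α → A^p_α`. -/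
def bergProj (n d : ℕ) (α : ℝ) (p : ℝ≥0∞) [Fact (1 ≤ p)]
    [Fact (1 ≤ n)] [Fact (-1 < α)] [Fact (1 < p)] [Fact (p < ∞)] :
    Lp (Cd d p) p (va n α) →L[ℂ] A n d α p :=
  LinearMap.mkContinuousOfExistsBound
    { toFun := fun F => ofHolo (projFun α F)
        (projFun_differentiableOn ((Lp.memLp F).integrable Fact.out)) (projFun_memLp (Lp.memLp F))
      map_add' := fun F G => by
        refine A_ext fun z hz => ?_
        rw [rep_add _ _ hz, rep_ofHolo _ _ hz, rep_ofHolo _ _ hz, rep_ofHolo _ _ hz]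
        have h1 := integrable_cpow_inv_smul ((Lp.memLp F).integrable Fact.out) hz (exponent_pos n α)
        have h2 := integrable_cpow_inv_smul ((Lp.memLp G).integrable Fact.out) hz (exponent_pos n α)
        unfold projFun
        rw [← integral_add h1 h2]
        refine integral_congr_ae ?_
        filter_upwards [Lp.coeFn_add F G] with w hw
        rw [hw, Pi.add_apply, smul_add]
      map_smul' := fun c F => by
        refine A_ext fun z hz => ?_
        rw [RingHom.id_apply, rep_smul _ _ hz, rep_ofHolo _ _ hz, rep_ofHolo _ _ hz]
        unfold projFun
        rw [← integral_smul]
        refine integral_congr_ae ?_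
        filter_upwards [Lp.coeFn_smul c F] with w hw
        rw [hw, Pi.smul_apply, smul_comm] }
    (by
      obtain ⟨C, hC, H⟩ := exists_eLpNorm_projFun_le n d α p
      refine ⟨C.toReal, fun F => ?_⟩
      have h := H F (Lp.stronglyMeasurable F)
      have h2 := ENNReal.toReal_mono (ENNReal.mul_ne_top hC (Lp.memLp F).2.ne) h
      rw [ENNReal.toReal_mul, ← Lp.norm_def] at h2
      refine le_trans (le_of_eq ?_) h2
      exact Lp.norm_toLp _ (projFun_memLp (Lp.memLp F)))

theorem rep_bergProj (F : Lp (Cd d p) p (va n α)) {z : Cn n} (hz : z ∈ ball n) :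
    rep (bergProj n d α p F) z = projFun α F z :=
  rep_ofHolo (projFun_differentiableOn ((Lp.memLp F).integrable Fact.out))
    (projFun_memLp (Lp.memLp F)) hz

theorem bergProj_coe (f : A n d α p) : bergProj n d α p (f : Lp (Cd d p) p (va n α)) = f := by
  refine A_ext fun z hz => ?_
  rw [rep_bergProj _ hz, ← projFun_rep f hz]
  refine integral_congr_ae ?_
  filter_upwards [rep_ae_eq f] with w hw
  rw [hw]

end Projection

/-! ### Duality of the Bergman spaces -/

section KernelContinuity

variable {n d : ℕ} {α : ℝ} {p : ℝ≥0∞} [Fact (1 ≤ p)] [hn : Fact (1 ≤ n)] [hα : Fact (-1 < α)]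

theorem norm_le_of_norm_rep_le {f : A n d α p} {C : ℝ} (hC : 0 ≤ C)
    (h : ∀ w ∈ ball n, ‖rep f w‖ ≤ C) : ‖f‖ ≤ C := by
  rw [norm_eq_eLpNorm_rep]
  have h1 : ∀ᵐ w ∂(va n α), ‖rep f w‖ ≤ C := by
    filter_upwards [ae_mem_ball n α] with w hw using h w hw
  have h2 := eLpNorm_le_of_ae_bound (p := p) h1
  simp only [measure_univ, ENNReal.one_rpow, one_mul] at h2
  exact ENNReal.toReal_le_of_le_ofReal hC h2

theorem continuous_kern (v : Fin d → ℂ) : Continuous (fun z : Bn n => kern α p z v) := by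
  refine continuous_iff_continuousAt.mpr fun z₀ => ?_
  let k : Cn n → Metric.closedBall (0 : Cn n) 1 → ℂ := fun z w =>
    ((1 - inner ℂ z (w : Cn n)) ^ (((n : ℝ) + 1 + α : ℝ) : ℂ))⁻¹
  have hre : ∀ z ∈ ball n, ∀ w : Metric.closedBall (0 : Cn n) 1,
      0 < (1 - inner ℂ z (w : Cn n)).re := fun z hz w => re_pos_of_mem ⟨z, hz⟩ w.2
  have hc : ContinuousOn (Function.uncurry k) (ball n ×ˢ Set.univ) := by
    refine ContinuousOn.inv₀ (ContinuousOn.cpow_const (by fun_prop) ?_) ?_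
    · rintro ⟨z, w⟩ ⟨hz, -⟩
      exact Or.inl (hre z hz w)
    · rintro ⟨z, w⟩ ⟨hz, -⟩
      exact cpow_ne_zero_of_re_pos (hre z hz w) _
  have : CompactSpace (Metric.closedBall (0 : Cn n) 1) :=
    isCompact_iff_compactSpace.mp (isCompact_closedBall _ _)
  have hu := ContinuousOn.tendstoUniformly (f := k) (Metric.isOpen_ball.mem_nhds z₀.2) hc
  rw [ContinuousAt, Metric.tendsto_nhds]
  intro ε hε
  have hv : 0 < ‖(WithLp.toLp p v : Cd d p)‖ + 1 := by positivity
  have h1 := (continuous_subtype_val.tendsto z₀).eventually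
    (Metric.tendstoUniformly_iff.mp hu (ε / 2 / (‖(WithLp.toLp p v : Cd d p)‖ + 1)) (by positivity))
  filter_upwards [h1] with z hz
  rw [dist_eq_norm]
  refine lt_of_le_of_lt (norm_le_of_norm_rep_le (C := ε / 2) (by positivity) fun w hw => ?_)
    (half_lt_self hε)
  rw [rep_sub _ _ hw, rep_kern _ _ hw, rep_kern _ _ hw, kernFun, kernFun, ← sub_smul, norm_smul]
  have h2 := hz ⟨w, Metric.ball_subset_closedBall hw⟩
  rw [dist_comm, dist_eq_norm, lt_div_iff₀ hv] at h2
  refine le_trans ?_ h2.le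
  exact mul_le_mul_of_nonneg_left (by linarith) (norm_nonneg _)

open Classical in
/-- The kernel as a function on `ℂⁿ`, extended by zero off the ball. -/
def kernExt (α : ℝ) (p : ℝ≥0∞) [Fact (1 ≤ p)] (v : Fin d → ℂ) (z : Cn n) : A n d α p :=
  if h : z ∈ ball n then kern α p ⟨z, h⟩ v else 0

theorem kernExt_of_mem (v : Fin d → ℂ) {z : Cn n} (hz : z ∈ ball n) :
    kernExt α p v z = kern α p ⟨z, hz⟩ v := dif_pos hz

theorem continuousOn_kernExt (v : Fin d → ℂ) : ContinuousOn (kernExt (n := n) α p v) (ball n) := by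
  rw [continuousOn_iff_continuous_domRestrict]
  convert continuous_kern (n := n) (α := α) (p := p) v using 1
  funext z
  exact kernExt_of_mem v z.2

end KernelContinuity

section NormingVector

variable {d : ℕ} {p q : ℝ≥0∞} [Fact (1 ≤ p)] [Fact (1 ≤ q)]

/-- The vector in `ℓᵖ` that norms `x ∈ ℓ^q`, with coordinates `|x_i|^{q-2} x_i`. -/
def normingVec (p : ℝ≥0∞) (x : Cd d q) : Cd d p :=
  WithLp.toLp p fun i => ((‖x i‖ ^ (q.toReal - 2) : ℝ) : ℂ) * x i

theorem norm_rpow_toReal (hp : p ≠ ∞) (x : Cd d p) : ‖x‖ ^ p.toReal = ∑ i, ‖x i‖ ^ p.toReal := by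
  have h : 0 < p.toReal := ENNReal.toReal_pos (p_ne_zero p) hp
  rw [PiLp.norm_eq_sum h, ← Real.rpow_mul (Finset.sum_nonneg fun i _ => by positivity),
    one_div, inv_mul_cancel₀ h.ne', Real.rpow_one]

theorem sum_normingVec_mul_conj (hq1 : 1 < q.toReal) (hq : q ≠ ∞) (x : Cd d q) :
    ∑ i, normingVec p x i * (starRingEnd ℂ) (x i) = ((‖x‖ ^ q.toReal : ℝ) : ℂ) := by
  rw [norm_rpow_toReal hq, Complex.ofReal_sum]
  refine Finset.sum_congr rfl fun i _ => ?_
  change ((‖x i‖ ^ (q.toReal - 2) : ℝ) : ℂ) * x i * (starRingEnd ℂ) (x i) = _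
  rw [mul_assoc, Complex.mul_conj, Complex.normSq_eq_norm_sq, ← Complex.ofReal_mul]
  congr 1
  rcases (norm_nonneg (x i)).eq_or_lt with h | h
  · rw [← h, Real.zero_rpow (x := q.toReal) (by linarith)]; simp
  · rw [← Real.rpow_natCast, ← Real.rpow_add h]; norm_num

theorem norm_normingVec_rpow (hpq : p.toReal.HolderConjugate q.toReal) (hp : p ≠ ∞) (hq : q ≠ ∞)
    (x : Cd d q) : ‖normingVec p x‖ ^ p.toReal = ‖x‖ ^ q.toReal := by
  rw [norm_rpow_toReal hp, norm_rpow_toReal hq]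
  refine Finset.sum_congr rfl fun i _ => ?_
  change ‖((‖x i‖ ^ (q.toReal - 2) : ℝ) : ℂ) * x i‖ ^ p.toReal = _
  rw [norm_mul, Complex.norm_real, Real.norm_of_nonneg (by positivity)]
  rcases (norm_nonneg (x i)).eq_or_lt with h | h
  · rw [← h, mul_zero, Real.zero_rpow hpq.pos.ne', Real.zero_rpow hpq.symm.pos.ne']
  · have e : ‖x i‖ ^ (q.toReal - 2) * ‖x i‖ = ‖x i‖ ^ (q.toReal - 1) := by
      nth_rewrite 2 [← Real.rpow_one ‖x i‖]
      rw [← Real.rpow_add h]; congr 1; ring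
    rw [e, ← Real.rpow_mul h.le]
    congr 1
    have h1 := hpq.inv_add_inv_eq_one
    have h2 := hpq.pos.ne'
    have h3 := hpq.symm.pos.ne'
    field_simp at h1
    linarith

theorem measurable_normingVec : Measurable (normingVec (d := d) (q := q) p) := by
  refine (WithLp.measurable_toLp p (Fin d → ℂ)).comp (measurable_pi_lambda _ fun i => ?_)
  have h : Measurable fun x : Cd d q => x i := (PiLp.continuous_apply q _ i).measurable
  exact (Complex.measurable_ofReal.comp (h.norm.pow_const _)).mul h

end NormingVector

section Duality

variable {n d : ℕ} {α : ℝ} {p q : ℝ≥0∞} [Fact (1 ≤ p)] [Fact (1 ≤ q)]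
  [hn : Fact (1 ≤ n)] [hα : Fact (-1 < α)]

/-- The only possible representative of the functional `y` on `A^p_α`, found by testing `y` on
kernels. -/
def dualFun (q : ℝ≥0∞) (y : A n d α p →L[ℂ] ℂ) (w : Cn n) : Cd d q :=
  WithLp.toLp q fun i => (starRingEnd ℂ) (y (kernExt α p (Pi.single i 1) w))

theorem continuousOn_dualFun (y : A n d α p →L[ℂ] ℂ) : ContinuousOn (dualFun q y) (ball n) := by
  refine (PiLp.continuous_toLp q _).comp_continuousOn (continuousOn_pi.mpr fun i => ?_)
  exact Complex.continuous_conj.comp_continuousOn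
    (y.continuous.comp_continuousOn (continuousOn_kernExt _))

variable [Fact (1 < p)] [Fact (p < ∞)]

theorem isClosed_A : IsClosed (A n d α p : Set (Lp (Cd d p) p (va n α))) := by
  have h : (A n d α p : Set (Lp (Cd d p) p (va n α))) =
      {F | ((bergProj n d α p F : A n d α p) : Lp (Cd d p) p (va n α)) = F} := by
    ext F
    refine ⟨fun hF => ?_, fun hF => ?_⟩
    · exact congrArg Subtype.val (bergProj_coe (⟨F, hF⟩ : A n d α p))
    · rw [Set.mem_ofPred_eq] at hF
      rw [← hF]
      exact (bergProj n d α p F).2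
  rw [h]
  exact isClosed_eq (continuous_subtype_val.comp (bergProj n d α p).continuous) continuous_id

instance : CompleteSpace (A n d α p) := isClosed_A.completeSpace_coe

variable [p.HolderConjugate q]

/-- On functions supported in a compact subset of the ball the functional `y ∘ P` is integration
against `dualFun`. -/
theorem apply_bergProj_of_support (y : A n d α p →L[ℂ] ℂ) {K : Set (Cn n)} (hK : IsCompact K)
    (hKb : K ⊆ ball n) (F : Lp (Cd d p) p (va n α)) (hF : ∀ᵐ w ∂(va n α), w ∉ K → F w = 0) :
    y (bergProj n d α p F) =
      ∫ w, ∑ i, F w i * (starRingEnd ℂ) (dualFun q y w i) ∂(va n α) := by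
  have hFi : Integrable F (va n α) := (Lp.memLp F).integrable Fact.out
  have hint : ∀ i : Fin d,
      Integrable (fun w => F w i • kernExt α p (Pi.single i 1) w) (va n α) := by
    intro i
    obtain ⟨C, hC⟩ := hK.exists_bound_of_continuousOn
      ((continuousOn_kernExt (n := n) (α := α) (p := p) (Pi.single i (1 : ℂ))).mono hKb)
    have hm : AEStronglyMeasurable (fun w => F w i) (va n α) :=
      (PiLp.continuous_apply p _ i).comp_aestronglyMeasurable hFi.1
    refine (hFi.norm.mul_const C).mono'
      (hm.smul (aestronglyMeasurable_of_continuousOn (continuousOn_kernExt _))) ?_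
    filter_upwards [hF] with w hw
    by_cases hwK : w ∈ K
    · rw [norm_smul]
      exact mul_le_mul (PiLp.norm_apply_le _ _) (hC w hwK) (norm_nonneg _) (norm_nonneg _)
    · rw [hw hwK]; simp
  have hsum : Integrable (fun w => ∑ i, F w i • kernExt α p (Pi.single i 1) w) (va n α) :=
    integrable_finsetSum _ fun i _ => hint i
  have hP : bergProj n d α p F = ∫ w, ∑ i, F w i • kernExt α p (Pi.single i 1) w ∂(va n α) := by
    refine A_ext fun z hz => PiLp.ext fun j => ?_
    rw [← pairing_kern_single (q := q) _ ⟨z, hz⟩ j, ← pairing_kern_single (q := q) _ ⟨z, hz⟩ j]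
    have h1 : pairing (∫ w, ∑ i, F w i • kernExt α p (Pi.single i 1) w ∂(va n α))
        (kern α q ⟨z, hz⟩ (Pi.single j 1)) = ∫ w, pairing (∑ i, F w i •
          kernExt α p (Pi.single i 1) w) (kern α q ⟨z, hz⟩ (Pi.single j 1)) ∂(va n α) :=
      ((pairingL (p := p) (kern α q ⟨z, hz⟩ (Pi.single j 1))).integral_comp_comm hsum).symm
    rw [h1, pairing_kern_single, rep_bergProj F hz, projFun, integral_kernel_apply hFi hz]
    refine integral_congr_ae ?_
    filter_upwards [ae_mem_ball n α] with w hw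
    rw [← pairingL_apply, map_sum, Finset.sum_eq_single j]
    · rw [map_smul, pairingL_apply, pairing_kern_single, kernExt_of_mem _ hw, rep_kern _ _ hz]
      simp [kernFun, mul_comm]
    · intro i _ hij
      rw [map_smul, pairingL_apply, pairing_kern_single, kernExt_of_mem _ hw, rep_kern _ _ hz]
      simp [kernFun, hij.symm]
    · simp
  rw [hP, ← ContinuousLinearMap.integral_comp_comm y hsum]
  refine integral_congr_ae (Eventually.of_forall fun w => ?_)
  simp only [map_sum, map_smul, smul_eq_mul, dualFun, RingHomCompTriple.comp_apply, RingHom.id_apply]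

/-- The radii `1 - 1/(k+1)` of the balls exhausting the unit ball. -/
def radius (k : ℕ) : ℝ := 1 - 1 / ((k : ℝ) + 1)

theorem radius_lt_one (k : ℕ) : radius k < 1 := by
  have : (0 : ℝ) < 1 / ((k : ℝ) + 1) := by positivity
  unfold radius; linarith

theorem closedBall_radius_subset (k : ℕ) : Metric.closedBall (0 : Cn n) (radius k) ⊆ ball n :=
  Metric.closedBall_subset_ball (radius_lt_one k)

theorem eventually_mem_closedBall_radius {w : Cn n} (hw : w ∈ ball n) :
    ∀ᶠ k in atTop, w ∈ Metric.closedBall (0 : Cn n) (radius k) := by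
  have h : Tendsto radius atTop (𝓝 (1 - 0)) :=
    tendsto_const_nhds.sub tendsto_one_div_add_atTop_nhds_zero_nat
  rw [sub_zero] at h
  filter_upwards [h.eventually (lt_mem_nhds (norm_lt_one_of_mem hw))] with k hk
  simpa using hk.le

theorem toReal_holderConjugate (p q : ℝ≥0∞) [Fact (1 < p)] [Fact (p < ∞)] [p.HolderConjugate q] :
    p.toReal.HolderConjugate q.toReal := ENNReal.HolderConjugate.toReal (one_lt_toReal p)

variable [Fact (q < ∞)]

/-- Testing the functional on the norming function of `dualFun` truncated to a compact set. -/
theorem eLpNorm_indicator_dualFun_le (y : A n d α p →L[ℂ] ℂ) {K : Set (Cn n)} (hK : IsCompact K)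
    (hKb : K ⊆ ball n) :
    eLpNorm (K.indicator (dualFun q y)) q (va n α) ≤
      ENNReal.ofReal (‖y‖ * ‖bergProj n d α p‖) := by
  have hc := toReal_holderConjugate p q
  have hq1 : 1 < q.toReal := hc.symm.lt
  have hp0 : 0 < p.toReal := hc.pos
  have hq0 : 0 < q.toReal := hc.symm.pos
  set g : Cn n → Cd d q := K.indicator (dualFun q y) with hg
  have hgm : AEStronglyMeasurable g (va n α) :=
    (aestronglyMeasurable_of_continuousOn (continuousOn_dualFun y)).indicator hK.measurableSet
  obtain ⟨C, hC⟩ := hK.exists_bound_of_continuousOn ((continuousOn_dualFun (q := q) y).mono hKb)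
  have hgb : ∀ w, ‖g w‖ ≤ max C 0 := by
    intro w
    by_cases hw : w ∈ K
    · rw [hg, Set.indicator_of_mem hw]; exact (hC w hw).trans (le_max_left _ _)
    · rw [hg, Set.indicator_of_notMem hw, norm_zero]; exact le_max_right _ _
  have hgL : MemLp g q (va n α) := MemLp.of_bound hgm _ (Eventually.of_forall hgb)
  have hpow : ∀ w, ‖normingVec p (g w)‖ₑ ^ p.toReal = ‖g w‖ₑ ^ q.toReal := by
    intro w
    rw [← ofReal_norm, ← ofReal_norm, ENNReal.ofReal_rpow_of_nonneg (norm_nonneg _) hp0.le,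
      ENNReal.ofReal_rpow_of_nonneg (norm_nonneg _) hq0.le,
      norm_normingVec_rpow hc (p_ne_top p) (p_ne_top q)]
  set a : ℝ≥0∞ := ∫⁻ w, ‖g w‖ₑ ^ q.toReal ∂(va n α) with ha
  have hag : eLpNorm g q (va n α) = a ^ (1 / q.toReal) :=
    eLpNorm_eq_lintegral_rpow_enorm_toReal (p_ne_zero q) (p_ne_top q)
  have haφ : eLpNorm (fun w => normingVec p (g w)) p (va n α) = a ^ (1 / p.toReal) := by
    rw [eLpNorm_eq_lintegral_rpow_enorm_toReal (p_ne_zero p) (p_ne_top p), ha]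
    simp_rw [hpow]
  have hatop : a ≠ ∞ := by
    have h := hgL.2.ne
    rw [hag] at h
    intro h'
    rw [h', ENNReal.top_rpow_of_pos (by positivity)] at h
    exact h rfl
  have hφm : AEStronglyMeasurable (fun w => normingVec p (g w)) (va n α) :=
    (measurable_normingVec.comp_aemeasurable hgm.aemeasurable).aestronglyMeasurable
  have hφL : MemLp (fun w => normingVec p (g w)) p (va n α) :=
    ⟨hφm, by rw [haφ]; exact (ENNReal.rpow_ne_top_of_nonneg (by positivity) hatop).lt_top⟩
  have hφ0 : ∀ᵐ w ∂(va n α), w ∉ K → hφL.toLp _ w = 0 := by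
    filter_upwards [hφL.coeFn_toLp] with w hw hwK
    rw [hw, hg, Set.indicator_of_notMem hwK]
    ext i
    simp [normingVec]
  have key := apply_bergProj_of_support (q := q) y hK hKb (hφL.toLp _) hφ0
  have e1 : ∫ w, ∑ i, hφL.toLp _ w i * (starRingEnd ℂ) (dualFun q y w i) ∂(va n α) =
      ((a.toReal : ℝ) : ℂ) := by
    have e2 : ∫ w, ‖g w‖ ^ q.toReal ∂(va n α) = a.toReal := by
      rw [integral_eq_lintegral_of_nonneg_ae (Eventually.of_forall fun w => by positivity)
        (hgm.norm.aemeasurable.pow_const _).aestronglyMeasurable, ha]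
      congr 1
      refine lintegral_congr fun w => ?_
      rw [← ofReal_norm, ENNReal.ofReal_rpow_of_nonneg (norm_nonneg _) hq0.le]
    rw [← e2, ← integral_complex_ofReal]
    refine integral_congr_ae ?_
    filter_upwards [hφL.coeFn_toLp] with w hw
    rw [hw, ← sum_normingVec_mul_conj (p := p) hq1 (p_ne_top q)]
    refine Finset.sum_congr rfl fun i _ => ?_
    by_cases hwK : w ∈ K
    · rw [hg, Set.indicator_of_mem hwK]
    · rw [hg, Set.indicator_of_notMem hwK]; simp [normingVec]
  rw [e1] at key
  have hnorm : ‖hφL.toLp _‖ = a.toReal ^ (1 / p.toReal) := by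
    rw [Lp.norm_toLp, haφ, ENNReal.toReal_rpow]
  have hle : a.toReal ≤ ‖y‖ * ‖bergProj n d α p‖ * a.toReal ^ (1 / p.toReal) := by
    calc a.toReal = ‖((a.toReal : ℝ) : ℂ)‖ := by
          rw [Complex.norm_real, Real.norm_of_nonneg ENNReal.toReal_nonneg]
      _ = ‖y (bergProj n d α p (hφL.toLp _))‖ := by rw [key]
      _ ≤ ‖y‖ * (‖bergProj n d α p‖ * ‖hφL.toLp _‖) :=
          (y.le_opNorm _).trans (mul_le_mul_of_nonneg_left (ContinuousLinearMap.le_opNorm _ _)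
            (by positivity))
      _ = _ := by rw [hnorm, mul_assoc]
  have hfin : a.toReal ^ (1 / q.toReal) ≤ ‖y‖ * ‖bergProj n d α p‖ := by
    rcases (ENNReal.toReal_nonneg (a := a)).eq_or_lt with h | h
    · rw [← h, Real.zero_rpow (by positivity)]; positivity
    · have e : a.toReal = a.toReal ^ (1 / q.toReal) * a.toReal ^ (1 / p.toReal) := by
        rw [← Real.rpow_add h, add_comm, one_div, one_div, hc.inv_add_inv_eq_one, Real.rpow_one]
      have hpos : 0 < a.toReal ^ (1 / p.toReal) := Real.rpow_pos_of_pos h _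
      exact le_of_mul_le_mul_right (e.symm.trans_le hle) hpos
  rw [hag, ← ENNReal.ofReal_toReal hatop, ENNReal.ofReal_rpow_of_nonneg ENNReal.toReal_nonneg
    (by positivity)]
  exact ENNReal.ofReal_le_ofReal hfin

theorem eLpNorm_dualFun_le (y : A n d α p →L[ℂ] ℂ) :
    eLpNorm (dualFun q y) q (va n α) ≤ ENNReal.ofReal (‖y‖ * ‖bergProj n d α p‖) := by
  refine Lp.eLpNorm_le_of_ae_tendsto (u := atTop)
    (f := fun k : ℕ => (Metric.closedBall (0 : Cn n) (radius k)).indicator (dualFun q y))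
    (Eventually.of_forall fun k =>
      eLpNorm_indicator_dualFun_le y (isCompact_closedBall _ _) (closedBall_radius_subset k))
    (fun k => (aestronglyMeasurable_of_continuousOn (continuousOn_dualFun y)).indicator
      Metric.isClosed_closedBall.measurableSet) ?_
  filter_upwards [ae_mem_ball n α] with w hw
  refine tendsto_const_nhds.congr' ?_
  filter_upwards [eventually_mem_closedBall_radius hw] with k hk
  rw [Set.indicator_of_mem hk]

theorem dualFun_memLp (y : A n d α p →L[ℂ] ℂ) : MemLp (dualFun q y) q (va n α) :=
  ⟨aestronglyMeasurable_of_continuousOn (continuousOn_dualFun y),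
    (eLpNorm_dualFun_le y).trans_lt ENNReal.ofReal_lt_top⟩

theorem tendsto_eLpNorm_indicator_sub {F : Cn n → Cd d p} (hF : MemLp F p (va n α)) :
    Tendsto (fun k => eLpNorm ((Metric.closedBall (0 : Cn n) (radius k)).indicator F - F) p
      (va n α)) atTop (𝓝 0) := by
  have hp0 : 0 < p.toReal := zero_lt_one.trans (one_lt_toReal p)
  have hfin : ∫⁻ w, ‖F w‖ₑ ^ p.toReal ∂(va n α) ≠ ∞ :=
    (lintegral_rpow_enorm_lt_top_of_eLpNorm_lt_top (p_ne_zero p) (p_ne_top p) hF.2).ne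
  have h : Tendsto (fun k => ∫⁻ w, ‖((Metric.closedBall (0 : Cn n) (radius k)).indicator F - F) w‖ₑ
      ^ p.toReal ∂(va n α)) atTop (𝓝 (∫⁻ _, 0 ∂(va n α))) := by
    refine tendsto_lintegral_of_dominated_convergence' (fun w => ‖F w‖ₑ ^ p.toReal) (fun k => ?_)
      (fun k => Eventually.of_forall fun w => ?_) hfin ?_
    · exact ((hF.1.indicator Metric.isClosed_closedBall.measurableSet).sub hF.1).enorm.pow_const _
    · refine ENNReal.rpow_le_rpow ?_ hp0.le
      by_cases hw : w ∈ Metric.closedBall (0 : Cn n) (radius k)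
      · simp [Pi.sub_apply, Set.indicator_of_mem hw]
      · simp [Pi.sub_apply, Set.indicator_of_notMem hw]
    · filter_upwards [ae_mem_ball n α] with w hw
      refine tendsto_const_nhds.congr' ?_
      filter_upwards [eventually_mem_closedBall_radius hw] with k hk
      simp [Pi.sub_apply, Set.indicator_of_mem hk, hp0]
  rw [lintegral_zero] at h
  have h2 := (ENNReal.continuous_rpow_const (y := 1 / p.toReal)).tendsto 0 |>.comp h
  rw [ENNReal.zero_rpow_of_pos (by positivity)] at h2
  refine h2.congr fun k => ?_
  rw [eLpNorm_eq_lintegral_rpow_enorm_toReal (p_ne_zero p) (p_ne_top p)]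
  rfl

theorem apply_eq_integral_dualFun (y : A n d α p →L[ℂ] ℂ) (f : A n d α p) :
    y f = ∫ w, ∑ i, rep f w i * (starRingEnd ℂ) (dualFun q y w i) ∂(va n α) := by
  let K : ℕ → Set (Cn n) := fun k => Metric.closedBall (0 : Cn n) (radius k)
  have hK : ∀ k, MeasurableSet (K k) := fun k => Metric.isClosed_closedBall.measurableSet
  have hL : ∀ k, MemLp ((K k).indicator (rep f)) p (va n α) := fun k =>
    (rep_memLp f).indicator (hK k)
  have h1 : ∀ k, y (bergProj n d α p ((hL k).toLp _)) =
      ∫ w, (K k).indicator (fun w => ∑ i, rep f w i * (starRingEnd ℂ) (dualFun q y w i)) w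
        ∂(va n α) := by
    intro k
    rw [apply_bergProj_of_support (q := q) y (isCompact_closedBall (0 : Cn n) (radius k))
      (closedBall_radius_subset k)]
    · refine integral_congr_ae ?_
      filter_upwards [(hL k).coeFn_toLp] with w hw
      rw [hw]
      by_cases hwK : w ∈ K k
      · rw [Set.indicator_of_mem hwK, Set.indicator_of_mem hwK]
      · rw [Set.indicator_of_notMem hwK, Set.indicator_of_notMem hwK]; simp
    · filter_upwards [(hL k).coeFn_toLp] with w hw hwK
      rw [hw, Set.indicator_of_notMem hwK]
  have hint := integrable_pairing (rep_memLp f) (dualFun_memLp (q := q) y)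
  have h2 : Tendsto (fun k => y (bergProj n d α p ((hL k).toLp _))) atTop
      (𝓝 (∫ w, ∑ i, rep f w i * (starRingEnd ℂ) (dualFun q y w i) ∂(va n α))) := by
    simp_rw [h1]
    refine tendsto_integral_of_dominated_convergence _ (fun k => hint.1.indicator (hK k))
      hint.norm (fun k => Eventually.of_forall fun w => norm_indicator_le_norm_self _ _) ?_
    filter_upwards [ae_mem_ball n α] with w hw
    refine tendsto_const_nhds.congr' ?_
    filter_upwards [eventually_mem_closedBall_radius hw] with k hk
    rw [Set.indicator_of_mem hk]
  have h3 : Tendsto (fun k => (hL k).toLp _) atTop (𝓝 (f : Lp (Cd d p) p (va n α))) := by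
    have e : (f : Lp (Cd d p) p (va n α)) = (rep_memLp f).toLp _ := by
      refine Lp.ext ((rep_ae_eq f).trans (rep_memLp f).coeFn_toLp.symm)
    rw [e]
    rw [Lp.tendsto_Lp_iff_tendsto_eLpNorm'']
    exact tendsto_eLpNorm_indicator_sub (rep_memLp f)
  have h4 := ((y.comp (bergProj n d α p)).continuous.tendsto _).comp h3
  have h5 : (y.comp (bergProj n d α p)) (f : Lp (Cd d p) p (va n α)) = y f := by
    rw [ContinuousLinearMap.comp_apply, bergProj_coe]
  rw [h5] at h4
  exact tendsto_nhds_unique h4 h2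

variable [Fact (1 < q)]

/-- The dual of `A^p_α` is `A^q_α`: every functional is a pairing. -/
theorem exists_pairing_eq (y : A n d α p →L[ℂ] ℂ) :
    ∃ g : A n d α q, (∀ f, y f = pairing f g) ∧ ‖g‖ ≤ ‖y‖ * ‖bergProj n d α p‖ := by
  have hL := dualFun_memLp (q := q) y
  -- Evaluating the representation at a kernel shows that `dualFun` is its own Bergman projection.
  have hfix : Set.EqOn (dualFun q y) (projFun α (dualFun q y)) (ball n) := by
    intro z hz
    refine PiLp.ext fun j => ?_
    rw [projFun, integral_kernel_apply (hL.integrable Fact.out) hz]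
    change (starRingEnd ℂ) (y (kernExt α p (Pi.single j 1) z)) = _
    rw [kernExt_of_mem _ hz, apply_eq_integral_dualFun (q := q), ← integral_conj]
    refine integral_congr_ae ?_
    filter_upwards [ae_mem_ball n α] with w hw
    rw [rep_kern _ _ hw, map_sum, Finset.sum_eq_single j]
    · simp only [kernFun, PiLp.smul_apply, smul_eq_mul, map_mul]
      rw [conj_cpow_inv hz hw]
      simp
    · intro i _ hij
      simp [kernFun, hij]
    · simp
  have hd : DifferentiableOn ℂ (dualFun q y) (ball n) :=
    (projFun_differentiableOn (hL.integrable Fact.out)).congr hfix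
  refine ⟨ofHolo _ hd hL, fun f => ?_, ?_⟩
  · rw [pairing_congr (fun _ _ => rfl) (rep_ofHolo hd hL), apply_eq_integral_dualFun (q := q)]
  · change ‖hL.toLp _‖ ≤ _
    rw [Lp.norm_toLp]
    exact ENNReal.toReal_le_of_le_ofReal (by positivity) (eLpNorm_dualFun_le y)

/-- A functional on `A^p_α` vanishing on all kernels vanishes. -/
theorem functional_eq_zero (q : ℝ≥0∞) [Fact (1 ≤ q)] [p.HolderConjugate q] [Fact (q < ∞)]
    [Fact (1 < q)] {y : A n d α p →L[ℂ] ℂ}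
    (h : ∀ (z : Bn n) (i : Fin d), y (kern α p z (Pi.single i 1)) = 0) : y = 0 := by
  obtain ⟨g, hg, -⟩ := exists_pairing_eq (q := q) y
  have hg0 : g = 0 := by
    refine A_ext fun w hw => PiLp.ext fun i => ?_
    have h1 := h ⟨w, hw⟩ i
    rw [hg, ← pairing_conj, pairing_kern_single] at h1
    rw [rep_zero hw]
    simpa using h1
  ext f
  rw [hg, hg0, ← pairing_conj, ← pairingL_apply, map_zero]
  simp

/-- A bounded form on `A^p_α × A^q_α`, linear in the first and conjugate linear in the second
variable, is given by an operator. -/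
theorem exists_operator_of_form (B : A n d α p → A n d α q → ℂ) (M : ℝ) (hM0 : 0 ≤ M)
    (hadd : ∀ f f' g, B (f + f') g = B f g + B f' g)
    (hsmul : ∀ (c : ℂ) f g, B (c • f) g = c * B f g)
    (hadd' : ∀ f g g', B f (g + g') = B f g + B f g')
    (hsmul' : ∀ (c : ℂ) f g, B f (c • g) = (starRingEnd ℂ) c * B f g)
    (hM : ∀ f g, ‖B f g‖ ≤ M * ‖f‖ * ‖g‖) :
    ∃ T : Op n d α p, (∀ f g, pairing (T f) g = B f g) ∧ ∀ f, ‖T f‖ ≤ M * ‖bergProj n d α q‖ * ‖f‖ := by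
  have h1 : ∀ f : A n d α p, ∃ k : A n d α p, (∀ g : A n d α q, pairing k g = B f g) ∧
      ‖k‖ ≤ M * ‖bergProj n d α q‖ * ‖f‖ := by
    intro f
    let y : A n d α q →L[ℂ] ℂ := LinearMap.mkContinuous
      { toFun := fun g => (starRingEnd ℂ) (B f g)
        map_add' := fun g g' => by rw [hadd', map_add]
        map_smul' := fun c g => by rw [hsmul', map_mul, Complex.conj_conj]; rfl } (M * ‖f‖)
      fun g => by rw [← RCLike.norm_conj]; simpa using hM f g
    obtain ⟨k, hk, hkn⟩ := exists_pairing_eq (q := p) y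
    refine ⟨k, fun g => ?_, ?_⟩
    · rw [← pairing_conj, ← hk]
      exact Complex.conj_conj _
    · refine hkn.trans ?_
      have : ‖y‖ ≤ M * ‖f‖ := LinearMap.mkContinuous_norm_le _ (by positivity) _
      calc ‖y‖ * ‖bergProj n d α q‖ ≤ M * ‖f‖ * ‖bergProj n d α q‖ := by gcongr
        _ = _ := by ring
  choose T hT hTn using h1
  refine ⟨LinearMap.mkContinuous
    { toFun := T
      map_add' := fun f f' => ext_of_pairing_kern (q := q) fun z i => by
        rw [pairing_add_left, hT, hT, hT, hadd]
      map_smul' := fun c f => ext_of_pairing_kern (q := q) fun z i => by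
        rw [RingHom.id_apply, pairing_smul_left, hT, hT, hsmul] } _ hTn, hT, hTn⟩

end Duality

/-! ### The weighted composition operators and their adjoints -/

section WeightedComposition

variable {n d : ℕ} {α : ℝ} {p q : ℝ≥0∞} [Fact (1 ≤ p)] [Fact (1 ≤ q)]

/-- The factor `(1 - |z|²)^{(n+1+α)/r} (1 - z̄ w)^{-2(n+1+α)/r}` in the operator `U_z`. -/
def cocycle (α : ℝ) (r : ℝ≥0∞) (z w : Cn n) : ℂ :=
  ((wt α r z : ℝ) : ℂ) / (1 - inner ℂ z w) ^ ((2 * ((n : ℝ) + 1 + α) / r.toReal : ℝ) : ℂ)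

theorem cocycle_ne_zero (α : ℝ) (r : ℝ≥0∞) {z w : Cn n} (hz : z ∈ ball n) (hw : w ∈ ball n) :
    cocycle α r z w ≠ 0 :=
  div_ne_zero (wt_ne_zero α r hz) (cpow_ne_zero_of_re_pos (one_sub_inner_re_pos hz hw) _)

theorem cocycle_zero_right (α : ℝ) (r : ℝ≥0∞) (z : Cn n) :
    cocycle α r z 0 = ((wt α r z : ℝ) : ℂ) := by
  simp [cocycle]

theorem differentiableOn_cocycle (α : ℝ) (r : ℝ≥0∞) {z : Cn n} (hz : z ∈ ball n) :
    DifferentiableOn ℂ (cocycle α r z) (ball n) := by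
  intro w hw
  have hre := one_sub_inner_re_pos hz hw
  have hd : DifferentiableAt ℂ (fun w : Cn n => 1 - inner ℂ z w) w :=
    (differentiableAt_const _).sub (innerSL ℂ z).differentiableAt
  have hc := hd.cpow (differentiableAt_const
    ((2 * ((n : ℝ) + 1 + α) / r.toReal : ℝ) : ℂ)) (Or.inl hre)
  have h := (hc.fun_inv (cpow_ne_zero_of_re_pos hre _)).const_mul ((wt α r z : ℝ) : ℂ)
  exact h.differentiableWithinAt

theorem norm_cocycle_rpow (α : ℝ) (hr : 0 < p.toReal) {z w : Cn n} (hz : z ∈ ball n)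
    (hw : w ∈ ball n) : ‖cocycle α p z w‖ ^ p.toReal = jac α z w := by
  have h0 := one_sub_sq_pos hz
  have h1 := norm_pos_iff.mpr (one_sub_inner_ne_zero hz hw)
  rw [cocycle, norm_div, Complex.norm_real, Real.norm_of_nonneg (wt_pos α p hz).le,
    Complex.norm_cpow_real, Real.div_rpow (wt_pos α p hz).le (by positivity), wt,
    ← Real.rpow_mul h0.le, ← Real.rpow_mul h1.le, div_mul_cancel₀ _ hr.ne', div_mul_cancel₀ _ hr.ne',
    jac, Real.div_rpow h0.le (by positivity), ← Real.rpow_natCast ‖1 - inner ℂ z w‖,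
    ← Real.rpow_mul h1.le, Nat.cast_ofNat]

variable [hn : Fact (1 ≤ n)] [hα : Fact (-1 < α)] [Fact (1 < p)] [Fact (p < ∞)]

theorem differentiableOn_weightedComp {z : Cn n} (hz : z ∈ ball n) (f : A n d α p) :
    DifferentiableOn ℂ (fun w => cocycle α p z w • rep f (phi z w)) (ball n) :=
  (differentiableOn_cocycle α p hz).fun_smul
    ((rep_differentiableOn f).comp (differentiableOn_phi hz) fun _ hw => phi_mem hz hw)

theorem eLpNorm_weightedComp {z : Cn n} (hz : z ∈ ball n) (f : A n d α p) :
    eLpNorm (fun w => cocycle α p z w • rep f (phi z w)) p (va n α) =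
      eLpNorm (rep f) p (va n α) := by
  have hp0 : 0 < p.toReal := zero_lt_one.trans (one_lt_toReal p)
  rw [eLpNorm_eq_lintegral_rpow_enorm_toReal (p_ne_zero p) (p_ne_top p),
    eLpNorm_eq_lintegral_rpow_enorm_toReal (p_ne_zero p) (p_ne_top p),
    lintegral_comp_phi hz (fun w => ‖rep f w‖ₑ ^ p.toReal)]
  congr 1
  refine lintegral_congr_ae ?_
  filter_upwards [ae_mem_ball n α] with w hw
  rw [enorm_smul, ENNReal.mul_rpow_of_nonneg _ _ hp0.le, ← ofReal_norm (cocycle α p z w),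
    ENNReal.ofReal_rpow_of_nonneg (norm_nonneg _) hp0.le, norm_cocycle_rpow α hp0 hz hw]

theorem memLp_weightedComp {z : Cn n} (hz : z ∈ ball n) (f : A n d α p) :
    MemLp (fun w => cocycle α p z w • rep f (phi z w)) p (va n α) :=
  ⟨aestronglyMeasurable_of_continuousOn (differentiableOn_weightedComp hz f).continuousOn, by
    rw [eLpNorm_weightedComp hz f]; exact (rep_memLp f).2⟩

/-- The element `U_z f` of `A^p_α`. -/
def weightedComp (z : Bn n) (f : A n d α p) : A n d α p :=
  ofHolo _ (differentiableOn_weightedComp z.2 f) (memLp_weightedComp z.2 f)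

theorem rep_weightedComp (z : Bn n) (f : A n d α p) {w : Cn n} (hw : w ∈ ball n) :
    rep (weightedComp z f) w = cocycle α p z w • rep f (phi z w) :=
  rep_ofHolo (differentiableOn_weightedComp z.2 f) (memLp_weightedComp z.2 f) hw

theorem norm_weightedComp (z : Bn n) (f : A n d α p) : ‖weightedComp z f‖ = ‖f‖ := by
  rw [norm_eq_eLpNorm_rep, norm_eq_eLpNorm_rep, ← eLpNorm_weightedComp z.2 f]
  congr 1
  refine eLpNorm_congr_ae ?_
  filter_upwards [ae_mem_ball n α] with w hw using rep_weightedComp z f hw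

theorem exists_isU (z : Bn n) : ∃ U : Op n d α p, IsU z U := by
  refine ⟨LinearMap.mkContinuous
    { toFun := weightedComp z
      map_add' := fun f g => A_ext fun w hw => by
        rw [rep_weightedComp _ _ hw, rep_add _ _ hw, rep_weightedComp _ _ hw,
          rep_weightedComp _ _ hw, rep_add _ _ (phi_mem z.2 hw), smul_add]
      map_smul' := fun c f => A_ext fun w hw => by
        rw [rep_weightedComp _ _ hw, RingHom.id_apply, rep_smul _ _ hw, rep_weightedComp _ _ hw,
          rep_smul _ _ (phi_mem z.2 hw), smul_comm] } 1 fun f => ?_,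
    fun f w hw => rep_weightedComp z f hw⟩
  rw [one_mul]
  exact (norm_weightedComp z f).le

theorem isU_opU (z : Bn n) : IsU z (opU d α p z) := by
  have h := exists_isU (d := d) (α := α) (p := p) z
  rw [opU, dif_pos h]
  exact Classical.choose_spec h

theorem rep_opU (z : Bn n) (f : A n d α p) {w : Cn n} (hw : w ∈ ball n) :
    rep (opU d α p z f) w = cocycle α p z w • rep f (phi z w) :=
  isU_opU z f w hw

theorem norm_opU_apply (z : Bn n) (f : A n d α p) : ‖opU d α p z f‖ = ‖f‖ := by
  rw [← norm_weightedComp z f]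
  congr 1
  exact A_ext fun w hw => by rw [rep_opU z f hw, rep_weightedComp z f hw]

theorem norm_opU_le (z : Bn n) : ‖opU d α p z‖ ≤ 1 :=
  ContinuousLinearMap.opNorm_le_bound _ zero_le_one fun f => by rw [norm_opU_apply, one_mul]

/-- The automorphism `φ_z` as a self-map of the ball. -/
def phiB (z w : Bn n) : Bn n := ⟨phi z w, phi_mem z.2 w.2⟩

@[simp] theorem coe_phiB (z w : Bn n) : (phiB z w : Cn n) = phi z w := rfl

theorem phiB_phiB (z w : Bn n) : phiB z (phiB z w) = w := Subtype.ext (phi_phi z.2 w.2)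

variable [p.HolderConjugate q]

theorem pairing_opU_kern (z : Bn n) (f : A n d α p) (w : Bn n) (v : Fin d → ℂ) :
    pairing (opU d α p z f) (kern α q w v) =
      cocycle α p z (w : Cn n) * pairing f (kern α q (phiB z w) v) := by
  rw [pairing_kern, pairing_kern, rep_opU z f w.2, Finset.mul_sum]
  refine Finset.sum_congr rfl fun i _ => ?_
  rw [PiLp.smul_apply, smul_eq_mul, mul_assoc, coe_phiB]

variable [Fact (q < ∞)] [Fact (1 < q)]

/-- The constant in the bound for adjoints. -/
def adjBound (n d : ℕ) (α : ℝ) (q : ℝ≥0∞) [Fact (1 ≤ q)] [Fact (1 ≤ n)] [Fact (-1 < α)]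
    [Fact (1 < q)] [Fact (q < ∞)] : ℝ := d * ‖bergProj n d α q‖

theorem adjBound_nonneg : 0 ≤ adjBound n d α q := by
  unfold adjBound
  positivity

theorem exists_isAdjoint (U : Op n d α q) :
    ∃ V : Op n d α p, IsAdjoint U V ∧ ∀ f, ‖V f‖ ≤ adjBound n d α q * ‖U‖ * ‖f‖ := by
  obtain ⟨V, hV, hVn⟩ := exists_operator_of_form (p := p) (q := q)
    (fun f g => pairing f (U g)) (d * ‖U‖) (by positivity)
    (fun f f' g => pairing_add_left _ _ _) (fun c f g => pairing_smul_left _ _ _)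
    (fun f g g' => by rw [map_add, pairing_add_right])
    (fun c f g => by rw [map_smul, pairing_smul_right])
    (fun f g => by
      refine (norm_pairing_le f (U g)).trans ?_
      have := U.le_opNorm g
      calc (d : ℝ) * (‖f‖ * ‖U g‖) ≤ d * (‖f‖ * (‖U‖ * ‖g‖)) := by gcongr
        _ = _ := by ring)
  refine ⟨V, hV, fun f => (hVn f).trans (le_of_eq ?_)⟩
  rw [adjBound]; ring

theorem isAdjoint_adj (U : Op n d α q) : IsAdjoint U (adj p U) := by
  have h : ∃ V : Op n d α p, IsAdjoint U V := (exists_isAdjoint U).imp fun _ h => h.1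
  rw [adj, dif_pos h]
  exact Classical.choose_spec h

theorem pairing_adj (U : Op n d α q) (f : A n d α p) (g : A n d α q) :
    pairing (adj p U f) g = pairing f (U g) := isAdjoint_adj U f g

theorem norm_adj_apply_le (U : Op n d α q) (f : A n d α p) :
    ‖adj p U f‖ ≤ adjBound n d α q * ‖U‖ * ‖f‖ := by
  obtain ⟨V, hV, hVn⟩ := exists_isAdjoint (p := p) U
  have e : adj p U f = V f := ext_of_pairing_kern (q := q) fun z i => by rw [pairing_adj, hV]
  rw [e]
  exact hVn f

theorem norm_adj_opU_apply_le (z : Bn n) (f : A n d α p) :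
    ‖adj p (opU d α q z) f‖ ≤ adjBound n d α q * ‖f‖ := by
  refine (norm_adj_apply_le _ f).trans ?_
  have := adjBound_nonneg (n := n) (d := d) (α := α) (q := q)
  have h1 := norm_opU_le (d := d) (α := α) (p := q) z
  calc adjBound n d α q * ‖opU d α q z‖ * ‖f‖ ≤ adjBound n d α q * 1 * ‖f‖ := by gcongr
    _ = _ := by rw [mul_one]

theorem adj_opU_kern (z w : Bn n) (v : Fin d → ℂ) :
    adj p (opU d α q z) (kern α p w v) =
      (starRingEnd ℂ) (cocycle α q z (w : Cn n)) • kern α p (phiB z w) v := by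
  refine ext_of_pairing_kern (q := q) fun x i => ?_
  rw [pairing_adj, pairing_smul_left, ← pairing_conj, pairing_opU_kern, map_mul, pairing_conj]

theorem pairing_opAt (S : Op n d α p) (z : Bn n) (f : A n d α p) (g : A n d α q) :
    pairing (opAt q S z f) g =
      pairing (S (adj p (opU d α q z) f)) (adj q (opU d α p z) g) := by
  change pairing (opU d α p z (S (adj p (opU d α q z) f))) g = _
  rw [← pairing_conj (adj q (opU d α p z) g), pairing_adj, pairing_conj]

theorem norm_opAt_apply_le (S : Op n d α p) (z : Bn n) (f : A n d α p) :
    ‖opAt q S z f‖ ≤ ‖S‖ * adjBound n d α q * ‖f‖ := by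
  change ‖opU d α p z (S (adj p (opU d α q z) f))‖ ≤ _
  rw [norm_opU_apply, mul_assoc]
  exact (S.le_opNorm _).trans (mul_le_mul_of_nonneg_left (norm_adj_opU_apply_le z f) (norm_nonneg S))

end WeightedComposition

/-! ### Comparison of neighbouring automorphisms -/

section Comparison

variable {n : ℕ}

/-- The direction of `φ_z(c) - z`, up to the factor `(1 - |z|²)^{1/2}`. -/
def stepVec (z c : Cn n) : Cn n :=
  (1 - inner ℂ z c)⁻¹ • ((inner ℂ z c / (1 + (defect z : ℝ) : ℂ)) • z - c)

/-- The ratio of the defects of `φ_z(c)` and `z`. -/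
def stepRatio (z c : Cn n) : ℝ := defect c / ‖1 - inner ℂ z c‖

theorem phi_eq_add_stepVec {z c : Cn n} (hz : z ∈ ball n) (hc : c ∈ ball n) :
    phi z c = z + ((defect z : ℝ) : ℂ) • stepVec z c := by
  have h1 := one_sub_inner_ne_zero hz hc
  have h2 := one_add_defect_ne_zero z
  rw [phi_eq hz, stepVec, shrink]
  match_scalars
  · field_simp
    ring
  · field_simp

theorem defect_phi {z c : Cn n} (hz : z ∈ ball n) (hc : c ∈ ball n) :
    defect (phi z c) = defect z * stepRatio z c := by
  have h1 : 0 ≤ 1 - ‖z‖ ^ 2 := (one_sub_sq_pos hz).le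
  rw [defect, one_sub_norm_phi_sq hz hc, Real.sqrt_div' _ (sq_nonneg _), Real.sqrt_mul h1,
    Real.sqrt_sq (norm_nonneg _), stepRatio, mul_div_assoc]
  rfl

/-- Composing `Q_z` and `Q_{z'}` for `z' = z + s h`: the factor `s² = 1 - |z|²`, which vanishes on
the boundary, splits off. -/
theorem sub_shrink_sub_shrink {z z' h x : Cn n} {s t g : ℂ} (hz' : z' = z + s • h)
    (hs : (starRingEnd ℂ) s = s) (hg : inner ℂ z z' = 1 - s ^ 2 * g) (h1 : 1 + s ≠ 0)
    (h2 : 1 + s * t ≠ 0) :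
    (1 - inner ℂ z' x) • z - (s • (z' - ((s * t) • x + (inner ℂ z' x / (1 + s * t)) • z')) +
      (inner ℂ z (z' - ((s * t) • x + (inner ℂ z' x / (1 + s * t)) • z')) / (1 + s)) • z) =
    s ^ 2 • (t • x - (1 - inner ℂ z' x / (1 + s * t)) • h +
      ((t * ((t - 1) * inner ℂ z x - (1 + s) * inner ℂ h x) / (1 + s * t) +
        (g - 1) * (1 - inner ℂ z' x / (1 + s * t))) / (1 + s)) • z) := by
  have hL : inner ℂ z' x = inner ℂ z x + s * inner ℂ h x := by
    rw [hz', inner_add_left, inner_smul_left, hs]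
  rw [inner_sub_right, inner_add_right, inner_smul_right, inner_smul_right, hg, hL]
  nth_rewrite 1 [hz']
  nth_rewrite 1 [hz']
  match_scalars
  · field_simp
    ring
  · field_simp
  · field_simp

theorem phi_phi_aux {z z' h x : Cn n} {s t g : ℂ} (hz' : z' = z + s • h)
    (hs : (starRingEnd ℂ) s = s) (hg : inner ℂ z z' = 1 - s ^ 2 * g)
    (h2 : 1 + s * t ≠ 0) :
    1 - inner ℂ z' x - inner ℂ z (z' - ((s * t) • x + (inner ℂ z' x / (1 + s * t)) • z')) =
      s ^ 2 * (g * (1 - inner ℂ z' x / (1 + s * t)) - t * inner ℂ h x +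
        t ^ 2 * (inner ℂ z' x / (1 + s * t))) := by
  have hL : inner ℂ z' x = inner ℂ z x + s * inner ℂ h x := by
    rw [hz', inner_add_left, inner_smul_left, hs]
  rw [inner_sub_right, inner_add_right, inner_smul_right, inner_smul_right, hg, hL]
  field_simp
  ring

/-- The function `φ_z ∘ φ_{z'}` for `z' = φ_z(c)`, written so that every term other than `x` on the
right is a bounded multiple of a quantity tending to zero with `c`, uniformly in `z`. -/
theorem smul_phi_phi {z c x : Cn n} (hz : z ∈ ball n) (hc : c ∈ ball n) (hx : x ∈ ball n) :
    (((1 - inner ℂ z c)⁻¹) * (1 - inner ℂ (phi z c) x / (1 + (defect (phi z c) : ℝ))) -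
        (stepRatio z c : ℝ) * inner ℂ (stepVec z c) x +
        ((stepRatio z c : ℝ) : ℂ) ^ 2 * (inner ℂ (phi z c) x / (1 + (defect (phi z c) : ℝ)))) •
      phi z (phi (phi z c) x) =
    ((stepRatio z c : ℝ) : ℂ) • x -
      (1 - inner ℂ (phi z c) x / (1 + (defect (phi z c) : ℝ))) • stepVec z c +
      (((stepRatio z c : ℝ) * (((stepRatio z c : ℝ) - 1) * inner ℂ z x -
        (1 + (defect z : ℝ)) * inner ℂ (stepVec z c) x) / (1 + (defect (phi z c) : ℝ)) +
        ((1 - inner ℂ z c)⁻¹ - 1) *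
          (1 - inner ℂ (phi z c) x / (1 + (defect (phi z c) : ℝ)))) / (1 + (defect z : ℝ))) • z := by
  have hz'm := phi_mem hz hc
  have hb := phi_mem hz'm hx
  have hL := one_sub_inner_ne_zero hz'm hx
  have hzb := one_sub_inner_ne_zero hz hb
  have hs0 : ((defect z : ℝ) : ℂ) ≠ 0 := by exact_mod_cast (defect_pos hz).ne'
  have hd : ((defect (phi z c) : ℝ) : ℂ) = ((defect z : ℝ) : ℂ) * ((stepRatio z c : ℝ) : ℂ) := by
    rw [defect_phi hz hc]; push_cast; rfl
  have h2 := one_add_defect_ne_zero (phi z c)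
  have h1 := one_add_defect_ne_zero z
  rw [hd] at h2
  have hg : inner ℂ z (phi z c) = 1 - ((defect z : ℝ) : ℂ) ^ 2 * (1 - inner ℂ z c)⁻¹ := by
    have := inner_phi_left hz hc
    rw [← defect_sq hz, Complex.ofReal_pow] at this
    rw [← div_eq_mul_inv, ← this]; ring
  have hA := sub_shrink_sub_shrink (x := x) (phi_eq_add_stepVec hz hc) (Complex.conj_ofReal _) hg h1 h2
  have hB := phi_phi_aux (x := x) (phi_eq_add_stepVec hz hc) (Complex.conj_ofReal _) hg h2
  have hphi := phi_eq hz'm x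
  set z' := phi z c with hz'
  set b := phi z' x with hbdef
  have hb2 : (1 - inner ℂ z' x) • b = z' - ((((defect z : ℝ) : ℂ) * ((stepRatio z c : ℝ) : ℂ)) • x +
      (inner ℂ z' x / (1 + ((defect z : ℝ) : ℂ) * ((stepRatio z c : ℝ) : ℂ))) • z') := by
    rw [hphi, smul_inv_smul₀ hL, shrink, hd]
  rw [← hb2] at hA hB
  rw [inner_smul_right] at hA hB
  rw [hd, ← (smul_right_injective (Cn n) (pow_ne_zero 2 hs0)).eq_iff]
  rw [← hA, smul_smul, ← hB, phi_eq hz, shrink, smul_smul]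
  have e : (1 - inner ℂ z' x - (1 - inner ℂ z' x) * inner ℂ z b) * (1 - inner ℂ z b)⁻¹ =
      1 - inner ℂ z' x := by
    field_simp
  rw [e]
  match_scalars
  · ring
  · ring

theorem norm_inner_le_right {z c : Cn n} (hz : z ∈ ball n) : ‖inner ℂ z c‖ ≤ ‖c‖ := by
  have h1 := norm_inner_le_norm (𝕜 := ℂ) z c
  have h2 := norm_lt_one_of_mem hz
  nlinarith [norm_nonneg c]

theorem one_sub_le_norm_one_sub_inner {z c : Cn n} (hz : z ∈ ball n) :
    1 - ‖c‖ ≤ ‖1 - inner ℂ z c‖ := by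
  have h1 := norm_sub_norm_le (1 : ℂ) (inner ℂ z c)
  have h2 := norm_inner_le_right (c := c) hz
  rw [norm_one] at h1
  linarith

theorem norm_one_sub_inner_inv_le {z c : Cn n} (hz : z ∈ ball n) (hc : ‖c‖ ≤ 1 / 2) :
    ‖(1 - inner ℂ z c)⁻¹‖ ≤ 2 := by
  rw [norm_inv]
  have h1 := one_sub_le_norm_one_sub_inner (c := c) hz
  calc ‖1 - inner ℂ z c‖⁻¹ ≤ (1 / 2)⁻¹ := inv_anti₀ (by norm_num) (by linarith)
    _ = 2 := by norm_num

theorem norm_one_sub_inner_inv_sub_one_le {z c : Cn n} (hz : z ∈ ball n) (hc : ‖c‖ ≤ 1 / 2) :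
    ‖(1 - inner ℂ z c)⁻¹ - 1‖ ≤ 2 * ‖c‖ := by
  have hcm : c ∈ ball n := by rw [mem_ball_zero_iff]; linarith
  have h0 := one_sub_inner_ne_zero hz hcm
  have e : (1 - inner ℂ z c)⁻¹ - 1 = (1 - inner ℂ z c)⁻¹ * inner ℂ z c := by
    field_simp
    ring
  rw [e, norm_mul]
  exact mul_le_mul (norm_one_sub_inner_inv_le hz hc) (norm_inner_le_right hz) (norm_nonneg _)
    (by norm_num)

theorem norm_inv_one_add_defect_le (z : Cn n) : ‖(1 + (defect z : ℝ) : ℂ)⁻¹‖ ≤ 1 := by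
  have h := defect_nonneg z
  have e : (1 + (defect z : ℝ) : ℂ) = ((1 + defect z : ℝ) : ℂ) := by push_cast; rfl
  rw [e, norm_inv, Complex.norm_real, Real.norm_of_nonneg (by linarith)]
  exact inv_le_one_of_one_le₀ (by linarith)

theorem norm_stepVec_le {z c : Cn n} (hz : z ∈ ball n) (hc : ‖c‖ ≤ 1 / 2) :
    ‖stepVec z c‖ ≤ 4 * ‖c‖ := by
  have h1 := norm_inner_le_right (c := c) hz
  have h2 := (norm_lt_one_of_mem hz).le
  have h3 := norm_inv_one_add_defect_le z
  have h4 : ‖(inner ℂ z c / (1 + (defect z : ℝ) : ℂ)) • z‖ ≤ ‖c‖ := by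
    rw [norm_smul, div_eq_mul_inv, norm_mul]
    calc _ ≤ ‖c‖ * 1 * 1 := by gcongr
      _ = _ := by ring
  rw [stepVec, norm_smul]
  calc _ ≤ 2 * (‖c‖ + ‖c‖) := by
        refine mul_le_mul (norm_one_sub_inner_inv_le hz hc) ?_ (norm_nonneg _) (by norm_num)
        exact (norm_sub_le _ _).trans (by gcongr)
    _ = _ := by ring

theorem abs_stepRatio_sub_one_le {z c : Cn n} (hz : z ∈ ball n) (hc : ‖c‖ ≤ 1 / 2) :
    |stepRatio z c - 1| ≤ 2 * ‖c‖ := by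
  have h0 := norm_nonneg c
  have hcm : c ∈ ball n := by rw [mem_ball_zero_iff]; linarith
  have h1 := one_sub_le_norm_one_sub_inner (c := c) hz
  have h2 : ‖1 - inner ℂ z c‖ ≤ 1 + ‖c‖ := by
    have := norm_sub_le (1 : ℂ) (inner ℂ z c)
    rw [norm_one] at this
    linarith [norm_inner_le_right (c := c) hz]
  have h3 : 0 < ‖1 - inner ℂ z c‖ := by linarith
  have h4 := defect_sq hcm
  have h5 := defect_nonneg c
  have h6 : defect c ≤ 1 := by nlinarith
  have h7 : 1 - ‖c‖ ≤ defect c := by nlinarith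
  rw [abs_le, stepRatio]
  constructor
  · rw [neg_le_sub_iff_le_add', ← sub_le_iff_le_add', le_div_iff₀ h3]
    nlinarith
  · rw [sub_le_iff_le_add, div_le_iff₀ h3]
    nlinarith

theorem norm_phi_sub_le {z c : Cn n} (hz : z ∈ ball n) (hc : ‖c‖ ≤ 1 / 2) :
    ‖phi z c - z‖ ≤ 4 * ‖c‖ := by
  have hcm : c ∈ ball n := by rw [mem_ball_zero_iff]; linarith
  rw [phi_eq_add_stepVec hz hcm, add_sub_cancel_left, norm_smul, Complex.norm_real,
    Real.norm_of_nonneg (defect_nonneg z)]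
  have h4 := defect_sq hz
  have h5 := defect_nonneg z
  have h6 : defect z ≤ 1 := by nlinarith [norm_nonneg z]
  calc _ ≤ 1 * (4 * ‖c‖) := mul_le_mul h6 (norm_stepVec_le hz hc) (norm_nonneg _) zero_le_one
    _ = _ := one_mul _

/-- The map `φ_z ∘ φ_{z'}` with `z' = φ_z(c)` is close to the identity, uniformly in `z`. -/
theorem norm_phi_phi_sub_le {z c x : Cn n} (hz : z ∈ ball n) (hc : ‖c‖ ≤ 1 / 2)
    (hx : x ∈ ball n) : ‖phi z (phi (phi z c) x) - x‖ ≤ 52 * ‖c‖ := by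
  have hr := norm_nonneg c
  have hcm : c ∈ ball n := by rw [mem_ball_zero_iff]; linarith
  have hz'm := phi_mem hz hcm
  have key := smul_phi_phi hz hcm hx
  have hν := (norm_lt_one_of_mem (phi_mem hz (phi_mem hz'm hx))).le
  have hγ := norm_one_sub_inner_inv_sub_one_le hz hc
  have hh := norm_stepVec_le hz hc
  have hτ : ‖((stepRatio z c : ℝ) : ℂ) - 1‖ ≤ 2 * ‖c‖ := by
    rw [← Complex.ofReal_one, ← Complex.ofReal_sub, Complex.norm_real]
    exact abs_stepRatio_sub_one_le hz hc
  have hx1 := (norm_lt_one_of_mem hx).le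
  have hη : ‖inner ℂ (stepVec z c) x‖ ≤ 4 * ‖c‖ := by
    refine (norm_inner_le_norm _ _).trans ?_
    nlinarith [norm_nonneg (stepVec z c), norm_nonneg x]
  have hL : ‖inner ℂ z x‖ ≤ 1 := (norm_inner_lt_one hz hx1).le
  have hi' := norm_inv_one_add_defect_le (phi z c)
  have hi := norm_inv_one_add_defect_le z
  have hκ : ‖inner ℂ (phi z c) x / (1 + (defect (phi z c) : ℝ) : ℂ)‖ ≤ 1 := by
    rw [div_eq_mul_inv, norm_mul]
    exact mul_le_one₀ (norm_inner_lt_one hz'm hx1).le (norm_nonneg _) hi'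
  have hs2 : ‖(1 + (defect z : ℝ) : ℂ)‖ ≤ 2 := by
    have h4 := defect_sq hz
    have h5 := defect_nonneg z
    have h6 : defect z ≤ 1 := by nlinarith [norm_nonneg z]
    refine (norm_add_le _ _).trans ?_
    rw [norm_one, Complex.norm_real, Real.norm_of_nonneg h5]
    linarith
  have hz1 := (norm_lt_one_of_mem hz).le
  generalize phi z (phi (phi z c) x) = ν at key hν ⊢
  generalize inner ℂ (phi z c) x / (1 + (defect (phi z c) : ℝ) : ℂ) = κ at key hκ
  rw [div_eq_mul_inv _ (1 + (defect z : ℝ) : ℂ), div_eq_mul_inv] at key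
  generalize (1 + (defect (phi z c) : ℝ) : ℂ)⁻¹ = i' at key hi'
  generalize (1 + (defect z : ℝ) : ℂ)⁻¹ = i at key hi
  generalize (1 + (defect z : ℝ) : ℂ) = s1 at key hs2
  generalize inner ℂ (stepVec z c) x = η at key hη
  generalize stepVec z c = h at key hh
  generalize inner ℂ z x = L at key hL
  generalize ((stepRatio z c : ℝ) : ℂ) = τ at key hτ
  generalize (1 - inner ℂ z c)⁻¹ = γ at key hγ
  have hτ2 : ‖τ‖ ≤ 2 := by
    have := norm_add_le (τ - 1) 1
    rw [sub_add_cancel, norm_one] at this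
    linarith
  have h1κ : ‖1 - κ‖ ≤ 2 := by
    have := norm_sub_le 1 κ
    rw [norm_one] at this
    linarith
  have e : ν - x = (τ - 1) • x - (1 - κ) • h +
      ((τ * ((τ - 1) * L - s1 * η) * i' + (γ - 1) * (1 - κ)) * i) • z -
      ((γ - 1) * (1 - κ) - τ * η + (τ - 1) * (τ + 1) * κ) • ν := by
    have e1 : (γ * (1 - κ) - τ * η + τ ^ 2 * κ) =
      ((γ - 1) * (1 - κ) - τ * η + (τ - 1) * (τ + 1) * κ) + 1 := by ring
    rw [e1, add_smul, one_smul] at key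
    rw [eq_sub_iff_add_eq, sub_add_eq_add_sub, add_comm ν, key]
    module
  have b1 : ‖(τ - 1) • x‖ ≤ 2 * ‖c‖ * 1 := by rw [norm_smul]; gcongr
  have b2 : ‖(1 - κ) • h‖ ≤ 2 * (4 * ‖c‖) := by rw [norm_smul]; gcongr
  have b3 : ‖(γ - 1) * (1 - κ)‖ ≤ 2 * ‖c‖ * 2 := by rw [norm_mul]; gcongr
  have b4 : ‖τ * η‖ ≤ 2 * (4 * ‖c‖) := by rw [norm_mul]; gcongr
  have b5 : ‖(τ - 1) * L - s1 * η‖ ≤ 2 * ‖c‖ * 1 + 2 * (4 * ‖c‖) := by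
    refine (norm_sub_le _ _).trans (add_le_add ?_ ?_) <;> · rw [norm_mul]; gcongr
  have b6 : ‖((τ * ((τ - 1) * L - s1 * η) * i' + (γ - 1) * (1 - κ)) * i) • z‖ ≤
      (2 * (2 * ‖c‖ * 1 + 2 * (4 * ‖c‖)) * 1 + 2 * ‖c‖ * 2) * 1 * 1 := by
    rw [norm_smul, norm_mul]
    gcongr
    refine (norm_add_le _ _).trans (add_le_add ?_ b3)
    rw [norm_mul, norm_mul]
    gcongr
  have b7 : ‖τ + 1‖ ≤ 3 := by
    have := norm_add_le τ 1
    rw [norm_one] at this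
    linarith
  have b8 : ‖((γ - 1) * (1 - κ) - τ * η + (τ - 1) * (τ + 1) * κ) • ν‖ ≤
      (2 * ‖c‖ * 2 + 2 * (4 * ‖c‖) + 2 * ‖c‖ * 3 * 1) * 1 := by
    rw [norm_smul]
    gcongr
    refine (norm_add_le _ _).trans (add_le_add ((norm_sub_le _ _).trans (add_le_add b3 b4)) ?_)
    rw [norm_mul, norm_mul]
    gcongr
  rw [e]
  have t1 := norm_sub_le ((τ - 1) • x - (1 - κ) • h +
      ((τ * ((τ - 1) * L - s1 * η) * i' + (γ - 1) * (1 - κ)) * i) • z)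
      (((γ - 1) * (1 - κ) - τ * η + (τ - 1) * (τ + 1) * κ) • ν)
  have t2 := norm_add_le ((τ - 1) • x - (1 - κ) • h)
      (((τ * ((τ - 1) * L - s1 * η) * i' + (γ - 1) * (1 - κ)) * i) • z)
  have t3 := norm_sub_le ((τ - 1) • x) ((1 - κ) • h)
  linarith

end Comparison

/-! ### Uniform continuity of the conjugated operators -/

section RhoFilter

variable {n : ℕ}

/-- The filter of pairs `(z, z')` with `ρ(z, z') → 0`. -/
def rhoFilter (n : ℕ) : Filter (Bn n × Bn n) := comap (fun x => rho x.1 x.2) (𝓝 0)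

theorem eventually_rhoFilter {P : Bn n × Bn n → Prop} :
    (∀ᶠ x in rhoFilter n, P x) ↔ ∃ δ > 0, ∀ z w : Bn n, rho z w < δ → P (z, w) := by
  have h := (Metric.nhds_basis_ball (x := (0 : ℝ))).comap (fun x : Bn n × Bn n => rho x.1 x.2)
  rw [rhoFilter, h.eventually_iff]
  refine exists_congr fun δ => and_congr_right fun hδ => ⟨fun H z w hzw => H ?_, fun H x hx => ?_⟩
  · simpa [rho] using hzw
  · exact H x.1 x.2 (by simpa [rho] using hx)

theorem rhoUniformContinuous_iff {f : Bn n → ℂ} :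
    RhoUniformContinuous f ↔ Tendsto (fun x : Bn n × Bn n => f x.1 - f x.2) (rhoFilter n) (𝓝 0) := by
  rw [Metric.tendsto_nhds]
  refine forall₂_congr fun ε hε => ?_
  rw [eventually_rhoFilter]
  simp [dist_eq_norm]

theorem tendsto_norm_phi : Tendsto (fun x : Bn n × Bn n => ‖phi (x.1 : Cn n) x.2‖) (rhoFilter n)
    (𝓝 0) := tendsto_comap

theorem eventually_norm_phi_le :
    ∀ᶠ x : Bn n × Bn n in rhoFilter n, ‖phi (x.1 : Cn n) x.2‖ ≤ 1 / 2 :=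
  (tendsto_norm_phi.eventually (gt_mem_nhds (by norm_num : (0 : ℝ) < 1 / 2))).mono fun _ h => h.le

theorem tendsto_coe_sub_coe :
    Tendsto (fun x : Bn n × Bn n => (x.2 : Cn n) - x.1) (rhoFilter n) (𝓝 0) := by
  refine squeeze_zero_norm' (a := fun x : Bn n × Bn n => 4 * ‖phi (x.1 : Cn n) x.2‖) ?_ ?_
  · filter_upwards [eventually_norm_phi_le] with x hx
    have h := norm_phi_sub_le x.1.2 hx
    rwa [phi_phi x.1.2 x.2.2] at h
  · simpa using tendsto_norm_phi.const_mul 4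

theorem tendsto_phi_phi (w : Bn n) :
    Tendsto (fun x : Bn n × Bn n => phi (x.1 : Cn n) (phi x.2 w)) (rhoFilter n) (𝓝 (w : Cn n)) := by
  rw [tendsto_iff_norm_sub_tendsto_zero]
  refine squeeze_zero_norm' (a := fun x : Bn n × Bn n => 52 * ‖phi (x.1 : Cn n) x.2‖) ?_ ?_
  · filter_upwards [eventually_norm_phi_le] with x hx
    have h := norm_phi_phi_sub_le x.1.2 hx w.2
    rw [phi_phi x.1.2 x.2.2] at h
    rwa [norm_norm]
  · simpa using tendsto_norm_phi.const_mul 52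

theorem tendsto_phiB_phiB (w : Bn n) :
    Tendsto (fun x : Bn n × Bn n => phiB x.1 (phiB x.2 w)) (rhoFilter n) (𝓝 w) :=
  tendsto_subtype_rng.mpr (tendsto_phi_phi w)

theorem tendsto_stepRatio :
    Tendsto (fun x : Bn n × Bn n => stepRatio x.1 (phi (x.1 : Cn n) x.2)) (rhoFilter n) (𝓝 1) := by
  rw [tendsto_iff_norm_sub_tendsto_zero]
  refine squeeze_zero_norm' (a := fun x : Bn n × Bn n => 2 * ‖phi (x.1 : Cn n) x.2‖) ?_ ?_
  · filter_upwards [eventually_norm_phi_le] with x hx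
    rw [norm_norm]
    exact abs_stepRatio_sub_one_le x.1.2 hx
  · simpa using tendsto_norm_phi.const_mul 2

theorem tendsto_inner_ratio (w : Bn n) :
    Tendsto (fun x : Bn n × Bn n => (1 - inner ℂ (x.1 : Cn n) (phi (x.1 : Cn n) (phi x.2 w))) /
      (1 - inner ℂ (x.2 : Cn n) w)) (rhoFilter n) (𝓝 1) := by
  rw [tendsto_iff_norm_sub_tendsto_zero]
  have hw : 0 < 1 - ‖(w : Cn n)‖ := by linarith [norm_lt_one w]
  refine squeeze_zero_norm' (a := fun x : Bn n × Bn n =>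
    (1 - ‖(w : Cn n)‖)⁻¹ * (‖(x.2 : Cn n) - x.1‖ +
      ‖phi (x.1 : Cn n) (phi x.2 w) - (w : Cn n)‖)) (Eventually.of_forall fun x => ?_) ?_
  · rw [norm_norm]
    have h0 := one_sub_inner_ne_zero x.2.2 w.2
    have e : (1 - inner ℂ (x.1 : Cn n) (phi (x.1 : Cn n) (phi x.2 w))) /
        (1 - inner ℂ (x.2 : Cn n) w) - 1 = (1 - inner ℂ (x.2 : Cn n) w)⁻¹ *
          (inner ℂ ((x.2 : Cn n) - x.1) (w : Cn n) -
            inner ℂ (x.1 : Cn n) (phi (x.1 : Cn n) (phi x.2 w) - (w : Cn n))) := by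
      rw [inner_sub_left, inner_sub_right]
      field_simp
      ring
    rw [e, norm_mul, norm_inv]
    have h1 := one_sub_le_norm_one_sub_inner (c := (w : Cn n)) x.2.2
    have h2 : ‖inner ℂ ((x.2 : Cn n) - x.1) (w : Cn n)‖ ≤ ‖(x.2 : Cn n) - x.1‖ := by
      refine (norm_inner_le_norm _ _).trans ?_
      nlinarith [norm_nonneg ((x.2 : Cn n) - x.1)]
    have h3 := norm_inner_le_right (c := phi (x.1 : Cn n) (phi x.2 w) - (w : Cn n)) x.1.2
    refine mul_le_mul (inv_anti₀ hw h1) ?_ (norm_nonneg _) (inv_nonneg.mpr hw.le)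
    exact (norm_sub_le _ _).trans (add_le_add h2 h3)
  · have h1 := tendsto_iff_norm_sub_tendsto_zero.mp (tendsto_phi_phi w)
    have h2 := (tendsto_coe_sub_coe (n := n)).norm
    rw [norm_zero] at h2
    simpa using (h2.add h1).const_mul (1 - ‖(w : Cn n)‖)⁻¹

theorem wt_phi (α : ℝ) (r : ℝ≥0∞) {z c : Cn n} (hz : z ∈ ball n) (hc : c ∈ ball n) :
    wt α r (phi z c) = wt α r z * (stepRatio z c ^ 2) ^ (((n : ℝ) + 1 + α) / r.toReal) := by
  rw [wt, wt, ← defect_sq (phi_mem hz hc), ← defect_sq hz, defect_phi hz hc, mul_pow,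
    Real.mul_rpow (sq_nonneg _) (sq_nonneg _)]

theorem tendsto_cocycle_ratio (α : ℝ) (r : ℝ≥0∞) (w : Bn n) :
    Tendsto (fun x : Bn n × Bn n => cocycle α r (x.2 : Cn n) w /
      cocycle α r (x.1 : Cn n) (phi (x.1 : Cn n) (phi x.2 w))) (rhoFilter n) (𝓝 1) := by
  have h1 : Tendsto (fun x : Bn n × Bn n => (stepRatio x.1 (phi (x.1 : Cn n) x.2) ^ 2) ^
      (((n : ℝ) + 1 + α) / r.toReal)) (rhoFilter n) (𝓝 1) := by
    have h := (tendsto_stepRatio (n := n)).pow 2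
    have h2 := h.rpow_const (p := ((n : ℝ) + 1 + α) / r.toReal) (Or.inl (by norm_num))
    simpa using h2
  have h2 := (continuousAt_cpow_const (b := ((2 * ((n : ℝ) + 1 + α) / r.toReal : ℝ) : ℂ))
    (a := 1) (by simp)).tendsto.comp (tendsto_inner_ratio w)
  rw [Complex.one_cpow] at h2
  have h3 := ((Complex.continuous_ofReal.tendsto 1).comp h1).mul h2
  simp only [Complex.ofReal_one, mul_one, Function.comp_def] at h3
  refine h3.congr fun x => ?_
  have hν := phi_mem x.1.2 (phi_mem x.2.2 w.2)
  have hw := wt_phi α r x.1.2 (phi_mem x.1.2 x.2.2)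
  rw [phi_phi x.1.2 x.2.2] at hw
  rw [div_cpow_of_re_pos (one_sub_inner_re_pos x.1.2 hν) (one_sub_inner_re_pos x.2.2 w.2), cocycle,
    cocycle, hw, Complex.ofReal_mul]
  have a1 := wt_ne_zero α r x.1.2
  have a2 := cpow_ne_zero_of_re_pos (one_sub_inner_re_pos x.1.2 hν)
    ((2 * ((n : ℝ) + 1 + α) / r.toReal : ℝ) : ℂ)
  have a3 := cpow_ne_zero_of_re_pos (one_sub_inner_re_pos x.2.2 w.2)
    ((2 * ((n : ℝ) + 1 + α) / r.toReal : ℝ) : ℂ)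
  field_simp

end RhoFilter

section ConjugatedOperators

variable {n d : ℕ} {α : ℝ} {p q : ℝ≥0∞} [Fact (1 ≤ p)] [Fact (1 ≤ q)]
  [hn : Fact (1 ≤ n)] [hα : Fact (-1 < α)] [Fact (1 < p)] [Fact (p < ∞)] [p.HolderConjugate q]
  [Fact (q < ∞)] [Fact (1 < q)]

theorem adj_opU_kern_eq (z z' w : Bn n) (v : Fin d → ℂ) :
    adj p (opU d α q z') (kern α p w v) =
      (starRingEnd ℂ) (cocycle α q (z' : Cn n) w / cocycle α q (z : Cn n) (phi (z : Cn n) (phi z' w))) •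
        adj p (opU d α q z) (kern α p (phiB z (phiB z' w)) v) := by
  rw [adj_opU_kern, adj_opU_kern, phiB_phiB, smul_smul, ← map_mul]
  congr 2
  exact (div_mul_cancel₀ _ (cocycle_ne_zero α q z.2 (phi_mem z.2 (phi_mem z'.2 w.2)))).symm

theorem tendsto_adj_opU_kern (w : Bn n) (v : Fin d → ℂ) :
    Tendsto (fun x : Bn n × Bn n => adj p (opU d α q x.1) (kern α p w v) -
      adj p (opU d α q x.2) (kern α p w v)) (rhoFilter n) (𝓝 0) := by
  let R : Bn n × Bn n → ℂ := fun x => (starRingEnd ℂ) (cocycle α q (x.2 : Cn n) w /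
    cocycle α q (x.1 : Cn n) (phi (x.1 : Cn n) (phi x.2 w)))
  have hR : Tendsto R (rhoFilter n) (𝓝 1) := by
    have := (Complex.continuous_conj.tendsto 1).comp (tendsto_cocycle_ratio α q w)
    rwa [map_one] at this
  have hk : Tendsto (fun x : Bn n × Bn n => kern α p w v - R x • kern α p (phiB x.1 (phiB x.2 w)) v)
      (rhoFilter n) (𝓝 0) := by
    have h1 := ((continuous_kern (n := n) (α := α) (p := p) v).tendsto w).comp (tendsto_phiB_phiB w)
    have h2 := hR.smul h1
    rw [one_smul] at h2
    simpa using (tendsto_const_nhds (x := kern α p w v)).sub h2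
  have hk2 := hk.norm.const_mul (adjBound n d α q)
  rw [norm_zero, mul_zero] at hk2
  refine squeeze_zero_norm (fun x => ?_) hk2
  rw [adj_opU_kern_eq x.1 x.2 w v, ← map_smul, ← map_sub]
  exact norm_adj_opU_apply_le _ _

theorem exists_functional_of_notMem {E : Type*} [NormedAddCommGroup E] [NormedSpace ℂ E]
    {V : Submodule ℂ E} (hV : IsClosed (V : Set E)) {f : E} (hf : f ∉ V) :
    ∃ g : E →L[ℂ] ℂ, (∀ v ∈ V, g v = 0) ∧ g f ≠ 0 := by
  have : IsClosed (V : Set E) := hV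
  have hne : V.mkQL f ≠ 0 := by
    rw [Submodule.mkQL_apply]
    simpa using hf
  obtain ⟨g, -, hg⟩ := exists_dual_vector ℂ (V.mkQL f) (norm_ne_zero_iff.mpr hne)
  refine ⟨g.comp V.mkQL, fun v hv => ?_, ?_⟩
  · have : V.mkQL v = 0 := by
      rw [Submodule.mkQL_apply]
      simpa using hv
    rw [ContinuousLinearMap.comp_apply, this, map_zero]
  · rw [ContinuousLinearMap.comp_apply, hg]
    exact (RCLike.ofReal_ne_zero (K := ℂ)).mpr (norm_ne_zero_iff.mpr hne)

/-- A closed subspace of `A^p_α` containing all kernels is everything. -/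
theorem eq_top_of_kern_mem (q : ℝ≥0∞) [Fact (1 ≤ q)] [p.HolderConjugate q] [Fact (q < ∞)]
    [Fact (1 < q)] {V : Submodule ℂ (A n d α p)}
    (hV : IsClosed (V : Set (A n d α p)))
    (h : ∀ (z : Bn n) (i : Fin d), kern α p z (Pi.single i 1) ∈ V) : V = ⊤ := by
  rw [eq_top_iff]
  intro f _
  by_contra hf
  obtain ⟨g, hgV, hg⟩ := exists_functional_of_notMem hV hf
  have h0 : g = 0 := functional_eq_zero q fun z i => hgV _ (h z i)
  exact hg (by rw [h0]; rfl)

theorem tendsto_adj_opU (f : A n d α p) :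
    Tendsto (fun x : Bn n × Bn n => adj p (opU d α q x.1) f - adj p (opU d α q x.2) f)
      (rhoFilter n) (𝓝 0) := by
  let V : Submodule ℂ (A n d α p) :=
    { carrier := {f | Tendsto (fun x : Bn n × Bn n => adj p (opU d α q x.1) f -
        adj p (opU d α q x.2) f) (rhoFilter n) (𝓝 0)}
      zero_mem' := by simp [tendsto_const_nhds]
      add_mem' := fun {f g} hf hg => by
        have := Tendsto.add hf hg
        rw [add_zero] at this
        refine this.congr fun x => ?_
        rw [map_add, map_add]; abel
      smul_mem' := fun c f hf => by
        have := Tendsto.const_smul hf c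
        rw [smul_zero] at this
        refine this.congr fun x => ?_
        rw [map_smul, map_smul, smul_sub] }
  have hV : IsClosed (V : Set (A n d α p)) := by
    refine isClosed_of_closure_subset fun f hf => ?_
    change Tendsto _ _ _
    have hC := adjBound_nonneg (n := n) (d := d) (α := α) (q := q)
    rw [Metric.tendsto_nhds]
    intro ε hε
    obtain ⟨g, hg, hfg⟩ := Metric.mem_closure_iff.mp hf (ε / 2 / (2 * adjBound n d α q + 1))
      (by positivity)
    filter_upwards [Metric.tendsto_nhds.mp (show Tendsto _ _ _ from hg) (ε / 2) (by positivity)]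
      with x hx
    rw [dist_zero_right] at hx ⊢
    rw [dist_eq_norm, lt_div_iff₀ (by positivity)] at hfg
    have e : adj p (opU d α q x.1) f - adj p (opU d α q x.2) f =
        (adj p (opU d α q x.1) g - adj p (opU d α q x.2) g) +
        (adj p (opU d α q x.1) (f - g) - adj p (opU d α q x.2) (f - g)) := by
      rw [map_sub, map_sub]; abel
    have h1 := norm_adj_opU_apply_le (q := q) x.1 (f - g)
    have h2 := norm_adj_opU_apply_le (q := q) x.2 (f - g)
    have h3 := norm_sub_le (adj p (opU d α q x.1) (f - g)) (adj p (opU d α q x.2) (f - g))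
    rw [e]
    refine (norm_add_le _ _).trans_lt ?_
    nlinarith [norm_nonneg (f - g)]
  have htop := eq_top_of_kern_mem q hV fun z i => tendsto_adj_opU_kern z _
  have : f ∈ V := by rw [htop]; trivial
  exact this

theorem norm_pairing_opAt_le (S : Op n d α p) (z : Bn n) (f : A n d α p) (g : A n d α q) :
    ‖pairing (opAt q S z f) g‖ ≤ d * (‖S‖ * adjBound n d α q) * ‖f‖ * ‖g‖ := by
  refine (norm_pairing_le _ _).trans ?_
  calc (d : ℝ) * (‖opAt q S z f‖ * ‖g‖) ≤ d * (‖S‖ * adjBound n d α q * ‖f‖ * ‖g‖) := by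
        gcongr
        exact norm_opAt_apply_le S z f
    _ = _ := by ring

theorem tendsto_pairing_opAt (S : Op n d α p) (f : A n d α p) (g : A n d α q) :
    Tendsto (fun x : Bn n × Bn n => pairing (opAt q S x.1 f) g - pairing (opAt q S x.2 f) g)
      (rhoFilter n) (𝓝 0) := by
  have h1 := (tendsto_adj_opU (q := q) f).norm.const_mul (d * ‖S‖ * (adjBound n d α p * ‖g‖))
  have h2 := (tendsto_adj_opU (q := p) g).norm.const_mul (d * ‖S‖ * (adjBound n d α q * ‖f‖))
  have h3 := h1.add h2
  simp only [norm_zero, mul_zero, add_zero] at h3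
  refine squeeze_zero_norm (fun x => ?_) h3
  rw [pairing_opAt, pairing_opAt]
  set X := adj p (opU d α q x.1) f
  set X' := adj p (opU d α q x.2) f with hX'
  set Y := adj q (opU d α p x.1) g with hY
  set Y' := adj q (opU d α p x.2) g
  have e : pairing (S X) Y - pairing (S X') Y' = pairing (S (X - X')) Y + pairing (S X') (Y - Y') := by
    rw [map_sub, pairing_sub_left, pairing_sub_right]; ring
  rw [e]
  have b1 : ‖Y‖ ≤ adjBound n d α p * ‖g‖ := norm_adj_opU_apply_le _ _
  have b2 : ‖X'‖ ≤ adjBound n d α q * ‖f‖ := norm_adj_opU_apply_le _ _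
  have c1 : ‖pairing (S (X - X')) Y‖ ≤ d * ‖S‖ * (adjBound n d α p * ‖g‖) * ‖X - X'‖ := by
    refine (norm_pairing_le _ _).trans ?_
    calc (d : ℝ) * (‖S (X - X')‖ * ‖Y‖) ≤ d * ((‖S‖ * ‖X - X'‖) * (adjBound n d α p * ‖g‖)) := by
          gcongr
          exact S.le_opNorm _
      _ = _ := by ring
  have c2 : ‖pairing (S X') (Y - Y')‖ ≤ d * ‖S‖ * (adjBound n d α q * ‖f‖) * ‖Y - Y'‖ := by
    refine (norm_pairing_le _ _).trans ?_
    calc (d : ℝ) * (‖S X'‖ * ‖Y - Y'‖) ≤ d * ((‖S‖ * (adjBound n d α q * ‖f‖)) * ‖Y - Y'‖) := by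
          gcongr
          exact (S.le_opNorm _).trans (by gcongr)
      _ = _ := by ring
  exact (norm_add_le _ _).trans (add_le_add c1 c2)

end ConjugatedOperators

/-! ### The maximal ideal space of the algebra of uniformly continuous functions -/

section MaximalIdealSpace

variable {n : ℕ}

instance isClosed_uniformAlgebra : IsClosed (uniformAlgebra n : Set (Bn n →ᵇ ℂ)) := by
  refine isClosed_of_closure_subset fun f hf => ?_
  change RhoUniformContinuous f
  intro ε hε
  obtain ⟨g, hg, hfg⟩ := Metric.mem_closure_iff.mp hf (ε / 3) (by positivity)
  obtain ⟨δ, hδ, H⟩ := (show RhoUniformContinuous g from hg) (ε / 3) (by positivity)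
  refine ⟨δ, hδ, fun z w hzw => ?_⟩
  have h1 := (BoundedContinuousFunction.dist_coe_le_dist (f := f) (g := g) z).trans_lt hfg
  have h2 := (BoundedContinuousFunction.dist_coe_le_dist (f := f) (g := g) w).trans_lt hfg
  have h3 := H z w hzw
  rw [← dist_eq_norm] at h3 ⊢
  rw [dist_comm] at h2
  have h4 := dist_triangle4 (f z) (g z) (g w) (f w)
  linarith

instance : CommCStarAlgebra (Bn n →ᵇ ℂ) where

theorem evalChar_apply (z : Bn n) (a : uniformAlgebra n) :
    evalChar z a = (a : Bn n →ᵇ ℂ) z := rfl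

/-- The ball is dense in the maximal ideal space. -/
theorem denseRange_evalChar : DenseRange (evalChar (n := n)) := by
  intro x
  by_contra hx
  obtain ⟨f, hf0, hf1, -⟩ := exists_continuous_zero_one_of_isClosed
    (isClosed_closure (s := Set.range (evalChar (n := n)))) (isClosed_singleton (x := x))
    (Set.disjoint_singleton_right.mpr hx)
  let F : C(MA n, ℂ) := ⟨fun y => ((f y : ℝ) : ℂ), by fun_prop⟩
  obtain ⟨a, ha⟩ := (gelfandTransform_bijective (uniformAlgebra n)).2 F
  have ha' : ∀ y : MA n, y a = ((f y : ℝ) : ℂ) := fun y => DFunLike.congr_fun ha y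
  have h0 : a = 0 := by
    refine Subtype.ext (BoundedContinuousFunction.ext fun z => ?_)
    rw [← evalChar_apply, ha', hf0 (subset_closure ⟨z, rfl⟩)]
    simp
  have h1 := ha' x
  rw [h0, map_zero, hf1 rfl] at h1
  simp at h1

instance neBot_comap_evalChar (x : MA n) : (comap (evalChar (n := n)) (𝓝 x)).NeBot :=
  comap_neBot_iff.mpr fun t ht => by
    obtain ⟨_, hy, z, rfl⟩ := mem_closure_iff_nhds.mp (denseRange_evalChar x) t ht
    exact ⟨z, hy⟩

theorem continuous_char_apply (a : uniformAlgebra n) : Continuous fun x : MA n => x a :=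
  (WeakDual.eval_continuous a).comp continuous_subtype_val

theorem tendsto_comap_evalChar (a : uniformAlgebra n) (x : MA n) :
    Tendsto (fun z => (a : Bn n →ᵇ ℂ) z) (comap (evalChar (n := n)) (𝓝 x)) (𝓝 (x a)) :=
  ((continuous_char_apply a).tendsto x).comp tendsto_comap

theorem continuous_phi_left (z : Bn n) : Continuous fun w : Bn n => phi (z : Cn n) w :=
  continuousOn_iff_continuous_domRestrict.mp (differentiableOn_phi z.2).continuousOn

theorem RhoUniformContinuous.continuous {f : Bn n → ℂ} (hf : RhoUniformContinuous f) :
    Continuous f := by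
  refine continuous_iff_continuousAt.mpr fun z => ?_
  rw [ContinuousAt, Metric.tendsto_nhds]
  intro ε hε
  obtain ⟨δ, hδ, H⟩ := hf ε hε
  have h1 : Tendsto (fun w : Bn n => rho z w) (𝓝 z) (𝓝 0) := by
    have := ((continuous_phi_left z).norm).tendsto z
    rwa [phi_self z.2, norm_zero] at this
  filter_upwards [h1.eventually (gt_mem_nhds hδ)] with w hw
  rw [dist_comm, dist_eq_norm]
  exact H z w hw

end MaximalIdealSpace

/-! ### The limit operators -/

section LimitOperators

variable {n d : ℕ} {α : ℝ} {p q : ℝ≥0∞} [Fact (1 ≤ p)] [Fact (1 ≤ q)]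
  [hn : Fact (1 ≤ n)] [hα : Fact (-1 < α)] [Fact (1 < p)] [Fact (p < ∞)] [p.HolderConjugate q]
  [Fact (q < ∞)] [Fact (1 < q)]

theorem rhoUniformContinuous_pairing_opAt (S : Op n d α p) (f : A n d α p) (g : A n d α q) :
    RhoUniformContinuous fun z => pairing (opAt q S z f) g :=
  rhoUniformContinuous_iff.mpr (tendsto_pairing_opAt S f g)

/-- The matrix coefficient `z ↦ ⟨S_z f, g⟩` as an element of the algebra. -/
def coeff (S : Op n d α p) (f : A n d α p) (g : A n d α q) : uniformAlgebra n :=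
  ⟨BoundedContinuousFunction.ofNormedAddCommGroup (fun z => pairing (opAt q S z f) g)
    (rhoUniformContinuous_pairing_opAt S f g).continuous
    (d * (‖S‖ * adjBound n d α q) * ‖f‖ * ‖g‖) fun z => norm_pairing_opAt_le S z f g,
    rhoUniformContinuous_pairing_opAt S f g⟩

theorem coeff_apply (S : Op n d α p) (f : A n d α p) (g : A n d α q) (z : Bn n) :
    (coeff S f g : Bn n →ᵇ ℂ) z = pairing (opAt q S z f) g := rfl

theorem tendsto_coeff (S : Op n d α p) (f : A n d α p) (g : A n d α q) (x : MA n) :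
    Tendsto (fun z => pairing (opAt q S z f) g) (comap (evalChar (n := n)) (𝓝 x))
      (𝓝 (x (coeff S f g))) :=
  tendsto_comap_evalChar (coeff S f g) x

theorem exists_limit_operator (S : Op n d α p) (x : MA n) :
    ∃ T : Op n d α p, ∀ (f : A n d α p) (g : A n d α q), pairing (T f) g = x (coeff S f g) := by
  have hC := adjBound_nonneg (n := n) (d := d) (α := α) (q := q)
  refine Exists.imp (fun T h => h.1) (exists_operator_of_form (p := p) (q := q)
    (fun f g => x (coeff S f g)) (d * (‖S‖ * adjBound n d α q)) (by positivity)
    (fun f f' g => ?_) (fun c f g => ?_) (fun f g g' => ?_) (fun c f g => ?_) (fun f g => ?_))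
  · refine tendsto_nhds_unique (tendsto_coeff S (f + f') g x) ?_
    simp_rw [map_add, pairing_add_left]
    exact (tendsto_coeff S f g x).add (tendsto_coeff S f' g x)
  · refine tendsto_nhds_unique (tendsto_coeff S (c • f) g x) ?_
    simp_rw [map_smul, pairing_smul_left]
    exact (tendsto_coeff S f g x).const_mul c
  · refine tendsto_nhds_unique (tendsto_coeff S f (g + g') x) ?_
    simp_rw [pairing_add_right]
    exact (tendsto_coeff S f g x).add (tendsto_coeff S f g' x)
  · refine tendsto_nhds_unique (tendsto_coeff S f (c • g) x) ?_
    simp_rw [pairing_smul_right]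
    exact (tendsto_coeff S f g x).const_mul _
  · exact le_of_tendsto (tendsto_coeff S f g x).norm
      (Eventually.of_forall fun z => norm_pairing_opAt_le S z f g)

theorem tendsto_opAt_of_pairing {S T : Op n d α p} {x : MA n}
    (hT : ∀ (f : A n d α p) (g : A n d α q), pairing (T f) g = x (coeff S f g)) :
    Tendsto (fun z : Bn n => ContinuousLinearMapWOT.ofCLM (opAt q S z)) (comap evalChar (𝓝 x))
      (𝓝 (ContinuousLinearMapWOT.ofCLM T)) := by
  rw [ContinuousLinearMapWOT.tendsto_iff_forall_dual_apply_tendsto]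
  intro f y
  obtain ⟨g, hg, -⟩ := exists_pairing_eq (q := q) y
  simp only [ContinuousLinearMapWOT.ofCLM_apply, hg, hT]
  exact tendsto_coeff S f g x

theorem opLim_eq_of_pairing {S T : Op n d α p} {x : MA n}
    (hT : ∀ (f : A n d α p) (g : A n d α q), pairing (T f) g = x (coeff S f g)) :
    opLim q S x = ContinuousLinearMapWOT.ofCLM T :=
  (tendsto_opAt_of_pairing hT).limUnder_eq

theorem pairing_opLim (S : Op n d α p) (x : MA n) (f : A n d α p) (g : A n d α q) :
    pairing (opLim q S x f) g = x (coeff S f g) := by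
  obtain ⟨T, hT⟩ := exists_limit_operator (q := q) S x
  rw [opLim_eq_of_pairing hT, ContinuousLinearMapWOT.ofCLM_apply, hT]

theorem continuous_opLim (S : Op n d α p) : Continuous fun x : MA n => opLim q S x := by
  refine ContinuousLinearMapWOT.continuous_of_dual_apply_continuous fun f y => ?_
  obtain ⟨g, hg, -⟩ := exists_pairing_eq (q := q) y
  simp_rw [hg, pairing_opLim]
  exact continuous_char_apply _

theorem opLim_evalChar (S : Op n d α p) (z : Bn n) :
    opLim q S (evalChar z) = ContinuousLinearMapWOT.ofCLM (opAt q S z) :=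
  opLim_eq_of_pairing fun f g => by rw [evalChar_apply, coeff_apply]

end LimitOperators

/-! ### Holomorphy of vector-valued maps -/

section WeakHolomorphy

/-- A continuous map into a Banach space is holomorphic if its compositions with a separating
family of functionals are holomorphic: it satisfies the Cauchy integral formula. -/
theorem differentiableOn_of_separating {E : Type*} [NormedAddCommGroup E] [NormedSpace ℂ E]
    [CompleteSpace E] {ι : Type*} (l : ι → E →L[ℂ] ℂ) (hl : ∀ v, (∀ i, l i v = 0) → v = 0)
    {U : Set ℂ} (hU : IsOpen U) {F : ℂ → E} (hc : ContinuousOn F U)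
    (hd : ∀ i, DifferentiableOn ℂ (fun ζ => l i (F ζ)) U) : DifferentiableOn ℂ F U := by
  intro z₀ hz₀
  obtain ⟨R, hR, hRU⟩ := Metric.nhds_basis_closedBall.mem_iff.mp (hU.mem_nhds hz₀)
  lift R to NNReal using hR.le
  have hR' : 0 < R := by exact_mod_cast hR
  have hci : CircleIntegrable F z₀ R :=
    (hc.mono (Metric.sphere_subset_closedBall.trans hRU)).circleIntegrable R.2
  have hps := hasFPowerSeriesOn_cauchy_integral hci hR'
  have heq : ∀ w ∈ Metric.ball z₀ (R : ℝ),
      (2 * Real.pi * Complex.I : ℂ)⁻¹ • (∮ z in C(z₀, R), (z - w)⁻¹ • F z) = F w := by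
    intro w hw
    rw [← sub_eq_zero]
    refine hl _ fun i => ?_
    have hne : ∀ z ∈ Metric.sphere z₀ (R : ℝ), z - w ≠ 0 := by
      intro z hz h
      rw [sub_eq_zero] at h
      rw [h, Metric.mem_sphere] at hz
      rw [Metric.mem_ball] at hw
      exact hw.ne hz
    have hci2 : CircleIntegrable (fun z => (z - w)⁻¹ • F z) z₀ R := by
      refine ContinuousOn.circleIntegrable R.2 (ContinuousOn.smul ?_
        (hc.mono (Metric.sphere_subset_closedBall.trans hRU)))
      exact ContinuousOn.inv₀ (by fun_prop) hne
    have h1 : l i (∮ z in C(z₀, R), (z - w)⁻¹ • F z) =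
        ∮ z in C(z₀, R), (z - w)⁻¹ • l i (F z) := by
      rw [circleIntegral, circleIntegral, ← ContinuousLinearMap.intervalIntegral_comp_comm _ hci2.out]
      simp only [map_smul]
    have h2 := ((hd i).mono hRU).circleIntegral_sub_inv_smul hw
    rw [map_sub, map_smul, h1, h2, inv_smul_smul₀ Complex.two_pi_I_ne_zero, sub_self]
  have hball : Metric.ball z₀ (R : ℝ) ∈ 𝓝 z₀ := Metric.ball_mem_nhds _ hR
  have hda := hps.analyticAt.differentiableAt
  refine (hda.congr_of_eventuallyEq ?_).differentiableWithinAt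
  filter_upwards [hball] with w hw using (heq w hw).symm

end WeakHolomorphy

/-! ### The Berezin transform and the limit operators -/

section Berezin

variable {n d : ℕ} {α : ℝ} {p q : ℝ≥0∞} [Fact (1 ≤ p)] [Fact (1 ≤ q)]
  [hn : Fact (1 ≤ n)] [hα : Fact (-1 < α)] [Fact (1 < p)] [Fact (p < ∞)] [p.HolderConjugate q]
  [Fact (q < ∞)] [Fact (1 < q)]

/-- The centre of the ball. -/
def centre (n : ℕ) : Bn n := ⟨0, zero_mem_ball⟩

theorem phiB_centre (z : Bn n) : phiB z (centre n) = z := Subtype.ext (phi_zero_right z.2)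

theorem adj_opU_kern_centre (z : Bn n) (v : Fin d → ℂ) :
    adj p (opU d α q z) (kern α p (centre n) v) = kernel α p q z v := by
  rw [adj_opU_kern, phiB_centre, kernel_eq_smul_kern]
  congr 1
  change (starRingEnd ℂ) (cocycle α q (z : Cn n) 0) = _
  rw [cocycle_zero_right, Complex.conj_ofReal]

theorem berezin_apply (S : Op n d α p) (z : Bn n) (i j : Fin d) :
    berezin q S z i j = pairing (opAt q S z (kern α p (centre n) (Pi.single j 1)))
      (kern α q (centre n) (Pi.single i 1)) := by
  rw [pairing_opAt, adj_opU_kern_centre, adj_opU_kern_centre]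
  rfl

theorem norm_cocycle_mul_wt (α : ℝ) (r : ℝ≥0∞) {z w : Cn n} (hz : z ∈ ball n) (hw : w ∈ ball n) :
    ‖cocycle α r z w‖ * wt α r w = wt α r (phi z w) := by
  have h0 := one_sub_sq_pos hz
  have h1 := norm_pos_iff.mpr (one_sub_inner_ne_zero hz hw)
  rw [cocycle, norm_div, Complex.norm_real, Real.norm_of_nonneg (wt_pos α r hz).le,
    Complex.norm_cpow_real, wt, wt, wt, one_sub_norm_phi_sq hz hw,
    Real.div_rpow (mul_nonneg h0.le (one_sub_sq_pos hw).le) (by positivity),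
    Real.mul_rpow h0.le (one_sub_sq_pos hw).le, ← Real.rpow_natCast ‖1 - inner ℂ z w‖,
    ← Real.rpow_mul h1.le, Nat.cast_ofNat, mul_div_assoc]
  ring

/-- On the diagonal the coefficients of `S_z` at kernels are, up to a constant, values of the
Berezin transform. -/
theorem norm_pairing_opAt_kern (S : Op n d α p) (z w : Bn n) (i j : Fin d) :
    ‖pairing (opAt q S z (kern α p w (Pi.single j 1))) (kern α q w (Pi.single i 1))‖ =
      (wt α q (w : Cn n))⁻¹ * (wt α p (w : Cn n))⁻¹ * ‖berezin q S (phiB z w) i j‖ := by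
  have e : berezin q S (phiB z w) i j = ((wt α q (phi z w : Cn n) : ℝ) : ℂ) *
      (((wt α p (phi z w : Cn n) : ℝ) : ℂ) * pairing (S (kern α p (phiB z w) (Pi.single j 1)))
        (kern α q (phiB z w) (Pi.single i 1))) := by
    change pairing (S (kernel α p q (phiB z w) (Pi.single j 1)))
      (kernel α q p (phiB z w) (Pi.single i 1)) = _
    rw [kernel_eq_smul_kern, kernel_eq_smul_kern, map_smul, pairing_smul_left, pairing_smul_right,
      Complex.conj_ofReal, coe_phiB]
  rw [e, pairing_opAt, adj_opU_kern, adj_opU_kern, map_smul, pairing_smul_left, pairing_smul_right,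
    Complex.conj_conj]
  simp only [norm_mul, RCLike.norm_conj, Complex.norm_real]
  rw [Real.norm_of_nonneg (wt_pos α q (phi_mem z.2 w.2)).le,
    Real.norm_of_nonneg (wt_pos α p (phi_mem z.2 w.2)).le, ← norm_cocycle_mul_wt α q z.2 w.2,
    ← norm_cocycle_mul_wt α p z.2 w.2]
  have h1 := (wt_pos α q w.2).ne'
  have h2 := (wt_pos α p w.2).ne'
  field_simp

/-- The filter of points approaching the boundary of the ball. -/
abbrev boundaryFilter (n : ℕ) : Filter (Bn n) := comap (fun z : Bn n => ‖(z : Cn n)‖) (𝓝 1)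

theorem tendsto_phiB_boundary (w : Bn n) :
    Tendsto (fun z : Bn n => phiB z w) (boundaryFilter n) (boundaryFilter n) := by
  rw [boundaryFilter, tendsto_comap_iff]
  have hw : 0 < 1 - ‖(w : Cn n)‖ := by linarith [norm_lt_one w]
  have hN : Tendsto (fun z : Bn n => ‖(z : Cn n)‖) (boundaryFilter n) (𝓝 1) := tendsto_comap
  have h1 : Tendsto (fun z : Bn n => 1 - ‖phi (z : Cn n) w‖ ^ 2) (boundaryFilter n) (𝓝 0) := by
    refine squeeze_zero (g := fun z : Bn n => (1 - ‖(z : Cn n)‖ ^ 2) *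
      ((1 - ‖(w : Cn n)‖ ^ 2) / (1 - ‖(w : Cn n)‖) ^ 2)) (fun z => ?_) (fun z => ?_) ?_
    · exact (one_sub_sq_pos (phi_mem z.2 w.2)).le
    · rw [one_sub_norm_phi_sq z.2 w.2, mul_div_assoc]
      have h2 := one_sub_le_norm_one_sub_inner (c := (w : Cn n)) z.2
      have h3 := (one_sub_sq_pos z.2).le
      have h4 := (one_sub_sq_pos w.2).le
      gcongr
    · have h := ((hN.pow 2).const_sub 1).mul_const
        ((1 - ‖(w : Cn n)‖ ^ 2) / (1 - ‖(w : Cn n)‖) ^ 2)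
      simpa using h
  have h2 := (h1.const_sub 1).sqrt
  simp only [sub_zero, Real.sqrt_one, sub_sub_cancel] at h2
  exact h2.congr fun z => Real.sqrt_sq (norm_nonneg _)

theorem continuous_evalChar : Continuous (evalChar (n := n)) := by
  refine continuous_induced_rng.mpr (WeakDual.continuous_of_continuous_eval fun a => ?_)
  exact (a : Bn n →ᵇ ℂ).continuous

/-- A point of the maximal ideal space off the ball is approached only from the boundary. -/
theorem comap_evalChar_le_boundaryFilter {x : MA n} (hx : x ∉ Set.range (evalChar (n := n))) :
    comap (evalChar (n := n)) (𝓝 x) ≤ boundaryFilter n := by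
  rw [boundaryFilter, ← tendsto_iff_comap, tendsto_order]
  refine ⟨fun r hr => ?_, fun r hr => Eventually.of_forall fun z => (norm_lt_one z).trans hr⟩
  have hK : IsCompact {z : Bn n | ‖(z : Cn n)‖ ≤ r} := by
    have hset : Subtype.val '' {z : Bn n | ‖(z : Cn n)‖ ≤ r} = Metric.closedBall (0 : Cn n) r := by
      refine Set.ext fun z => ?_
      simp only [Set.mem_image, Metric.mem_closedBall, dist_zero_right]
      constructor
      · rintro ⟨w, hw, rfl⟩
        exact hw
      · intro hz
        exact ⟨⟨z, mem_ball_zero_iff.mpr (hz.trans_lt hr)⟩, hz, rfl⟩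
    rw [Subtype.isCompact_iff, hset]
    exact isCompact_closedBall _ _
  have hcl := (hK.image continuous_evalChar).isClosed
  have hxK : x ∉ evalChar '' {z : Bn n | ‖(z : Cn n)‖ ≤ r} := fun ⟨z, _, hz⟩ => hx ⟨z, hz⟩
  filter_upwards [preimage_mem_comap (hcl.isOpen_compl.mem_nhds hxK)] with z hz
  by_contra hzr
  exact hz ⟨z, not_lt.mp hzr, rfl⟩

/-- The function `|z|` as an element of the algebra. -/
def normElement (n : ℕ) : uniformAlgebra n :=
  have h : RhoUniformContinuous fun z : Bn n => ((‖(z : Cn n)‖ : ℝ) : ℂ) := by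
    rw [rhoUniformContinuous_iff]
    have h1 := (tendsto_coe_sub_coe (n := n)).norm
    rw [norm_zero] at h1
    refine squeeze_zero_norm (fun x => ?_) h1
    rw [← Complex.ofReal_sub, Complex.norm_real, norm_sub_rev]
    exact abs_norm_sub_norm_le _ _
  ⟨BoundedContinuousFunction.ofNormedAddCommGroup (fun z : Bn n => ((‖(z : Cn n)‖ : ℝ) : ℂ))
    h.continuous 1 fun z => by
      rw [Complex.norm_real, norm_norm]; exact (norm_lt_one z).le, h⟩

/-- Uniformly continuous functions that vanish off the ball in the maximal ideal space tend to zero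
at the boundary. -/
theorem tendsto_boundary_of_forall_char (a : uniformAlgebra n)
    (h : ∀ x : MA n, x ∉ Set.range (evalChar (n := n)) → x a = 0) :
    Tendsto (a : Bn n →ᵇ ℂ) (boundaryFilter n) (𝓝 0) := by
  rw [tendsto_iff_ultrafilter]
  intro u hu
  obtain ⟨x, -, hx⟩ := isCompact_univ.ultrafilter_le_nhds (u.map evalChar) (by simp)
  have hlim : ∀ b : uniformAlgebra n, Tendsto (b : Bn n →ᵇ ℂ) u (𝓝 (x b)) := fun b =>
    ((continuous_char_apply b).tendsto x).comp hx
  have hxr : x ∉ Set.range (evalChar (n := n)) := by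
    rintro ⟨z, rfl⟩
    have h1 := hlim (normElement n)
    have h2 : Tendsto (fun z : Bn n => ((‖(z : Cn n)‖ : ℝ) : ℂ)) u (𝓝 ((1 : ℝ) : ℂ)) :=
      (Complex.continuous_ofReal.tendsto 1).comp (tendsto_comap.mono_left hu)
    have h3 := tendsto_nhds_unique h1 h2
    have h4 : ‖(z : Cn n)‖ = 1 := by
      have h5 : evalChar z (normElement n) = ((‖(z : Cn n)‖ : ℝ) : ℂ) := rfl
      rw [h5] at h3
      exact_mod_cast h3
    exact (norm_lt_one z).ne h4
  have := hlim a
  rwa [h x hxr] at this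

theorem tendsto_berezin_of_opLim_eq_zero {S : Op n d α p}
    (h : ∀ x : MA n, x ∉ Set.range (evalChar (n := n)) → opLim q S x = 0) :
    Tendsto (fun z : Bn n => berezin q S z) (boundaryFilter n) (𝓝 0) := by
  refine tendsto_pi_nhds.mpr fun i => tendsto_pi_nhds.mpr fun j => ?_
  simp_rw [berezin_apply]
  refine tendsto_boundary_of_forall_char (coeff S _ _) fun x hx => ?_
  rw [← pairing_opLim, h x hx, ContinuousLinearMapWOT.zero_apply, ← pairingL_apply, map_zero]

theorem pairing_opLim_kern_eq_zero {S : Op n d α p}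
    (h : Tendsto (fun z : Bn n => berezin q S z) (boundaryFilter n) (𝓝 0)) {x : MA n}
    (hx : x ∉ Set.range (evalChar (n := n))) (w : Bn n) (i j : Fin d) :
    pairing (opLim q S x (kern α p w (Pi.single j 1))) (kern α q w (Pi.single i 1)) = 0 := by
  rw [pairing_opLim]
  refine tendsto_nhds_unique (tendsto_coeff S _ _ x) ?_
  have h1 := tendsto_pi_nhds.mp (tendsto_pi_nhds.mp h i) j
  have h2 := ((h1.comp (tendsto_phiB_boundary w)).mono_left
    (comap_evalChar_le_boundaryFilter hx)).norm.const_mul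
      ((wt α q (w : Cn n))⁻¹ * (wt α p (w : Cn n))⁻¹)
  rw [tendsto_zero_iff_norm_tendsto_zero]
  simp_rw [norm_pairing_opAt_kern]
  simpa using h2

end Berezin

/-! ### Operators determined by their diagonal -/

section Diagonal

variable {n d : ℕ} {α : ℝ} {p q : ℝ≥0∞} [Fact (1 ≤ p)] [Fact (1 ≤ q)]
  [hn : Fact (1 ≤ n)] [hα : Fact (-1 < α)] [Fact (1 < p)] [Fact (p < ∞)] [p.HolderConjugate q]
  [Fact (q < ∞)] [Fact (1 < q)]

theorem differentiableOn_rep_line (f : A n d α p) (a b : Cn n) (i : Fin d) :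
    DifferentiableOn ℂ (fun ζ : ℂ => rep f (a + ζ • b) i) {ζ | a + ζ • b ∈ ball n} := by
  have h1 : DifferentiableOn ℂ (fun ζ : ℂ => rep f (a + ζ • b)) {ζ | a + ζ • b ∈ ball n} :=
    (rep_differentiableOn f).comp (by fun_prop) fun ζ hζ => hζ
  exact (PiLp.proj p (fun _ : Fin d => ℂ) i : Cd d p →L[ℂ] ℂ).differentiable.comp_differentiableOn h1

theorem isOpen_line (a b : Cn n) : IsOpen {ζ : ℂ | a + ζ • b ∈ ball n} :=
  Metric.isOpen_ball.preimage (by fun_prop)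

theorem isOpen_conj_line (a b : Cn n) : IsOpen {ζ : ℂ | a + (starRingEnd ℂ) ζ • b ∈ ball n} :=
  Metric.isOpen_ball.preimage (by fun_prop)

theorem differentiableOn_kernExt_line (q : ℝ≥0∞) [Fact (1 ≤ q)] [p.HolderConjugate q]
    [Fact (q < ∞)] [Fact (1 < q)] (a b : Cn n) (j : Fin d) :
    DifferentiableOn ℂ (fun ζ : ℂ => kernExt α p (Pi.single j 1) (a + (starRingEnd ℂ) ζ • b))
      {ζ | a + (starRingEnd ℂ) ζ • b ∈ ball n} := by
  have hsep : ∀ f : A n d α p, (∀ g : A n d α q, pairingL g f = 0) → f = 0 := by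
    intro f hf
    refine ext_of_pairing_kern (q := q) fun z i => ?_
    have h0 := (pairingL (p := p) (kern α q z (Pi.single i 1))).map_zero
    rw [pairingL_apply] at h0
    rw [h0]
    exact hf _
  refine differentiableOn_of_separating (E := A n d α p)
    (fun g : A n d α q => (pairingL g : A n d α p →L[ℂ] ℂ)) hsep (isOpen_conj_line a b) ?_
    fun g => ?_
  · exact (continuousOn_kernExt (n := n) (α := α) (p := p) _).comp (by fun_prop) fun ζ hζ => hζ
  · have h1 : ∀ ζ ∈ {ζ : ℂ | a + (starRingEnd ℂ) ζ • b ∈ ball n},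
        pairingL g (kernExt α p (Pi.single j 1) (a + (starRingEnd ℂ) ζ • b)) =
          (starRingEnd ℂ) (rep g (a + (starRingEnd ℂ) ζ • b) j) := by
      intro ζ hζ
      rw [pairingL_apply, kernExt_of_mem _ hζ, ← pairing_conj, pairing_kern_single]
    refine DifferentiableOn.congr (fun ζ hζ => ?_) h1
    have h2 : DifferentiableAt ℂ (fun ζ : ℂ => rep g (a + ζ • b) j) ((starRingEnd ℂ) ζ) :=
      (differentiableOn_rep_line g a b j).differentiableAt ((isOpen_line a b).mem_nhds hζ)
    have h3 := h2.conj_conj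
    rw [Complex.conj_conj] at h3
    exact h3.differentiableWithinAt

theorem differentiableOn_pairingL_kernExt_line (a b : Cn n) (i : Fin d) :
    DifferentiableOn ℂ (fun ζ : ℂ => (pairingL (kernExt α q (Pi.single i 1) (a + ζ • b)) :
      A n d α p →L[ℂ] ℂ)) {ζ | a + ζ • b ∈ ball n} := by
  refine differentiableOn_of_separating (E := A n d α p →L[ℂ] ℂ)
    (fun f : A n d α p => ContinuousLinearMap.apply ℂ ℂ f) (fun y hy => ?_)
    (isOpen_line a b) ?_ fun f => ?_
  · exact ContinuousLinearMap.ext hy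
  · have hc : Continuous fun g : A n d α q => (pairingL g : A n d α p →L[ℂ] ℂ) := by
      refine (LipschitzWith.of_dist_le_mul (K := (d : NNReal)) (f := fun g : A n d α q =>
        (pairingL g : A n d α p →L[ℂ] ℂ)) fun g g' => ?_).continuous
      have e : (pairingL g - pairingL g' : A n d α p →L[ℂ] ℂ) = pairingL (g - g') := by
        ext f
        exact (pairing_sub_right f g g').symm
      refine (dist_eq_norm (pairingL g : A n d α p →L[ℂ] ℂ) (pairingL g')).trans_le ?_
      rw [e, dist_eq_norm]
      exact norm_pairingL_le _
    exact hc.comp_continuousOn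
      ((continuousOn_kernExt (n := n) (α := α) (p := q) _).comp (by fun_prop) fun ζ hζ => hζ)
  · refine (differentiableOn_rep_line f a b i).congr fun ζ hζ => ?_
    change pairing f (kernExt α q (Pi.single i 1) (a + ζ • b)) = _
    rw [kernExt_of_mem _ hζ, pairing_kern_single]

theorem convex_line (a b : Cn n) : Convex ℝ {ζ : ℂ | a + ζ • b ∈ ball n} := by
  intro s hs t ht u v hu hv huv
  obtain rfl : v = 1 - u := by linarith
  have e : a + (u • s + (1 - u) • t) • b = u • (a + s • b) + (1 - u) • (a + t • b) := by
    rw [Complex.real_smul, Complex.real_smul]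
    push_cast
    module
  change a + (u • s + (1 - u) • t) • b ∈ ball n
  rw [e]
  exact convex_ball _ _ hs ht hu hv huv

theorem convex_conj_line (a b : Cn n) :
    Convex ℝ {ζ : ℂ | a + (starRingEnd ℂ) ζ • b ∈ ball n} := by
  intro s hs t ht u v hu hv huv
  have e : (starRingEnd ℂ) (u • s + v • t) = u • (starRingEnd ℂ) s + v • (starRingEnd ℂ) t := by
    simp
  change a + (starRingEnd ℂ) (u • s + v • t) • b ∈ ball n
  rw [e]
  exact convex_line a b hs ht hu hv huv

/-- The line through `w` and `w'`, parametrised so that these points are the values at `-i` and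
`i`. -/
theorem exists_line (w w' : Bn n) : ∃ a b : Cn n, a + Complex.I • b = w' ∧
    a + (starRingEnd ℂ) Complex.I • b = w ∧ a ∈ ball n := by
  have hI : Complex.I * (2 * Complex.I)⁻¹ = 2⁻¹ := by
    field_simp
  refine ⟨(2⁻¹ : ℂ) • ((w : Cn n) + w'), (2 * Complex.I)⁻¹ • ((w' : Cn n) - w), ?_, ?_, ?_⟩
  · rw [smul_smul, hI]
    module
  · rw [Complex.conj_I, smul_smul, neg_mul, hI]
    module
  · have e : (2⁻¹ : ℂ) • ((w : Cn n) + w') = (2⁻¹ : ℝ) • (w : Cn n) + (2⁻¹ : ℝ) • (w' : Cn n) := by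
      rw [← smul_add, ← Complex.coe_smul]
      norm_num
    rw [e]
    exact convex_ball _ _ w.2 w'.2 (by norm_num) (by norm_num) (by norm_num)

/-- If the coefficients `⟨T K_w e_j, K_w e_i⟩` vanish for all `w`, then so do all
`⟨T K_w e_j, K_{w'} e_i⟩`, which are holomorphic in `w'` and antiholomorphic in `w`. -/
theorem pairing_kern_eq_zero_of_diagonal {T : Op n d α p} {i j : Fin d}
    (h : ∀ w : Bn n, pairing (T (kern α p w (Pi.single j 1))) (kern α q w (Pi.single i 1)) = 0)
    (w w' : Bn n) :
    pairing (T (kern α p w (Pi.single j 1))) (kern α q w' (Pi.single i 1)) = 0 := by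
  obtain ⟨a, b, hw', hw, ha⟩ := exists_line w w'
  let U : Set ℂ := {ζ | a + ζ • b ∈ ball n} ∩ {ζ | a + (starRingEnd ℂ) ζ • b ∈ ball n}
  have hU : IsOpen U := (isOpen_line a b).inter (isOpen_conj_line a b)
  have hconv : Convex ℝ U := (convex_line a b).inter (convex_conj_line a b)
  have h0U : (0 : ℂ) ∈ U := by constructor <;> simpa using ha
  have hIU : Complex.I ∈ U := ⟨by change a + Complex.I • b ∈ ball n; rw [hw']; exact w'.2, by
    change a + (starRingEnd ℂ) Complex.I • b ∈ ball n; rw [hw]; exact w.2⟩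
  let H : ℂ → ℂ := fun ζ => (pairingL (kernExt α q (Pi.single i 1) (a + ζ • b)) :
    A n d α p →L[ℂ] ℂ) (T (kernExt α p (Pi.single j 1) (a + (starRingEnd ℂ) ζ • b)))
  have hF : DifferentiableOn ℂ (fun ζ : ℂ => T (kernExt α p (Pi.single j 1)
      (a + (starRingEnd ℂ) ζ • b))) U := fun ζ hζ =>
    (T.differentiableAt (x := kernExt α p (Pi.single j 1) (a + (starRingEnd ℂ) ζ • b))).comp_differentiableWithinAt ζ
      ((differentiableOn_kernExt_line q a b j ζ hζ.2).mono Set.inter_subset_right)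
  have hL : DifferentiableOn ℂ (fun ζ : ℂ => (pairingL (kernExt α q (Pi.single i 1) (a + ζ • b)) :
      A n d α p →L[ℂ] ℂ)) U :=
    (differentiableOn_pairingL_kernExt_line a b i).mono Set.inter_subset_left
  have hH : DifferentiableOn ℂ H U := hL.clm_apply hF
  have hreal : ∀ t : ℝ, (t : ℂ) ∈ U → H t = 0 := by
    intro t ht
    have ht' : a + (starRingEnd ℂ) (t : ℂ) • b ∈ ball n := ht.2
    have ht1 : a + (t : ℂ) • b ∈ ball n := ht.1
    change pairing (T (kernExt α p (Pi.single j 1) (a + (starRingEnd ℂ) (t : ℂ) • b)))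
      (kernExt α q (Pi.single i 1) (a + (t : ℂ) • b)) = 0
    rw [Complex.conj_ofReal, kernExt_of_mem _ ht1, kernExt_of_mem _ ht1]
    exact h _
  have hfreq : ∃ᶠ ζ in 𝓝[≠] (0 : ℂ), H ζ = 0 := by
    have ht : Tendsto (fun t : ℝ => (t : ℂ)) (𝓝[≠] 0) (𝓝[≠] 0) := by
      refine tendsto_nhdsWithin_iff.mpr ⟨?_, ?_⟩
      · exact (Complex.continuous_ofReal.tendsto' 0 0 (by simp)).mono_left nhdsWithin_le_nhds
      · filter_upwards [self_mem_nhdsWithin] with t ht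
        simpa using ht
    refine ht.frequently (Eventually.frequently ?_)
    filter_upwards [ht.eventually (nhdsWithin_le_nhds (hU.mem_nhds h0U))] with t ht using hreal t ht
  have hz := (hH.analyticOnNhd hU).eqOn_zero_of_preconnected_of_frequently_eq_zero
    hconv.isPreconnected h0U hfreq hIU
  have e : H Complex.I = pairing (T (kern α p w (Pi.single j 1))) (kern α q w' (Pi.single i 1)) := by
    change pairing (T (kernExt α p (Pi.single j 1) (a + (starRingEnd ℂ) Complex.I • b)))
      (kernExt α q (Pi.single i 1) (a + Complex.I • b)) = _
    rw [hw, hw', kernExt_of_mem _ w.2, kernExt_of_mem _ w'.2]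
  rw [← e]
  exact hz

theorem eq_zero_of_diagonal {T : Op n d α p}
    (h : ∀ (w : Bn n) (i j : Fin d),
      pairing (T (kern α p w (Pi.single j 1))) (kern α q w (Pi.single i 1)) = 0) : T = 0 := by
  have hker : T.ker = ⊤ := by
    refine eq_top_of_kern_mem q T.isClosed_ker fun w j => ?_
    refine LinearMap.mem_ker.mpr (ext_of_pairing_kern (q := q) fun z i => ?_)
    have h0 := (pairingL (p := p) (kern α q z (Pi.single i 1))).map_zero
    rw [pairingL_apply] at h0
    rw [h0]
    exact pairing_kern_eq_zero_of_diagonal (fun w => h w i j) w z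
  ext1 f
  have : f ∈ T.ker := by rw [hker]; trivial
  exact this

end Diagonal

end

end VectorBergman

theorem proposition4p14 (n d : ℕ) (hn : 1 ≤ n) (hd : 1 ≤ d) (α : ℝ) (hα : -1 < α)
    (p q : ℝ≥0∞) [Fact (1 ≤ p)] [Fact (1 ≤ q)] (hp : 1 < p) (hp' : p < ∞)
    (hpq : p.HolderConjugate q) (S : Op n d α p) :
    -- the operators `U_z^{(p,α)}`, `U_z^{(q,α)}` and the adjoint of the latter are well defined
    (∀ z : Bn n, IsU z (opU d α p z) ∧ IsU z (opU d α q z) ∧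
      IsAdjoint (opU d α q z) (adj p (opU d α q z))) ∧
    -- `x ↦ S_x` is the extension of `z ↦ S_z` to `M_𝒜`, continuous in the weak operator topology
    (Continuous (fun x : MA n => opLim q S x) ∧
      ∀ z : Bn n, opLim q S (evalChar z) = ContinuousLinearMapWOT.ofCLM (opAt q S z)) ∧
    -- the equivalence
    (Tendsto (fun z : Bn n => berezin q S z) (comap (fun z : Bn n => ‖(z : Cn n)‖) (𝓝 1)) (𝓝 0) ↔
      ∀ x : MA n, x ∉ Set.range (evalChar (n := n)) → opLim q S x = 0) := by
  have : Fact (1 ≤ n) := ⟨hn⟩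
  have : Fact (-1 < α) := ⟨hα⟩
  have : Fact (1 < p) := ⟨hp⟩
  have : Fact (p < ∞) := ⟨hp'⟩
  have hq1 : 1 < q.toReal := (toReal_holderConjugate p q).symm.lt
  have hq : q ≠ ∞ := fun h => by
    rw [h, ENNReal.toReal_top] at hq1
    exact absurd hq1 (by norm_num)
  have : Fact (q < ∞) := ⟨hq.lt_top⟩
  have : Fact (1 < q) :=
    ⟨(ENNReal.toReal_lt_toReal ENNReal.one_ne_top hq).mp (by rwa [ENNReal.toReal_one])⟩
  refine ⟨fun z => ⟨isU_opU z, isU_opU z, isAdjoint_adj _⟩,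
    ⟨continuous_opLim S, opLim_evalChar S⟩, fun h x hx => ?_, tendsto_berezin_of_opLim_eq_zero⟩
  have h0 : (opLim q S x).toCLM = 0 :=
    eq_zero_of_diagonal (q := q) fun w i j => pairing_opLim_kern_eq_zero h hx w i j
  exact ContinuousLinearMapWOT.toCLM_injective h0
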